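/- **Theorem 2.4 (Improved Rellich inequality).** Let $M$ be a complete noncompact (smooth) Riemannian manifold of dimension $n>1$, with volume measure $dx$, gradient $\nabla$ and Laplace–Beltrami operator $\Delta$. Let $1<q<2$ and let $\Omega\subset M$ be a bounded open set. Then there is a constant $C_1>0$, depending only on $M$, $q$ and $\Omega$, with the following property. Let $\rho:M\to[0,\infty)$ be locally Lipschitz with $|\nabla\rho|=1$ almost everywhere on $M\setminus\rho^{-1}\{0\}$ and, for a constant $C>0$, $$\Delta\rho\ \ge\ \frac{C}{\rho}\quad\text{on } M\setminus\rho^{-1}\{0\}\text{ in the sense of distributions,}$$ that is, $\int_M\rho\,\Delta\psi\,dx\ge\int_M\frac{C}{\rho}\,\psi\,dx$ for all $0\le\psi\in C_c^\infty(M\setminus\rho^{-1}\{0\})$. Let $\alpha<2$ and $C+\alpha-3>0$. Then for every real-valued $\phi\in C_c^\infty(\Omega\setminus\rho^{-1}\{0\})$, $$\int_M\rho^{\alpha}|\Delta\phi|^2\,dx\ \ge\ \frac{(C+\alpha-3)^2(C-\alpha+1)^2}{16}\int_M\rho^{\alpha}\frac{\phi^2}{\rho^4}\,dx+\frac{(C+\alpha-3)(C-\alpha+1)}{2}\,C_1\Big(\int_M|\nabla\phi|^q\,\rho^{\frac{q(\alpha-2)}{2}}\,dx\Big)^{2/q}.$$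 (Every $\phi\in C_c^\infty(M\setminus\rho^{-1}\{0\})$ is supported in some such $\Omega$.) -/

import Mathlib

open Bundle MeasureTheory
open scoped Manifold ContDiff InnerProductSpace

noncomputable section

namespace RellichRiemannian

variable {n : ℕ} {M : Type*} [MetricSpace M] [ChartedSpace (EuclideanSpace ℝ (Fin n)) M]

/-- The coordinate vector `∂ᵢ` of the preferred chart around `x`, at the point with
coordinates `y`. -/
def coordVector (x : M) (y : EuclideanSpace ℝ (Fin n)) (i : Fin n) :
    TangentSpace (𝓡 n) ((chartAt (EuclideanSpace ℝ (Fin n)) x).symm y) :=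
  mfderiv (𝓡 n) (𝓡 n) (chartAt (EuclideanSpace ℝ (Fin n)) x).symm y
    (EuclideanSpace.single i (1 : ℝ))

variable [IsManifold (𝓡 n) ∞ M] [RiemannianBundle (fun p : M ↦ TangentSpace (𝓡 n) p)]

/-- The matrix `gᵢⱼ = ⟨∂ᵢ, ∂ⱼ⟩` of the Riemannian metric in the preferred chart around `x`, at
the point with coordinates `y`. -/
def gramMatrix (x : M) (y : EuclideanSpace ℝ (Fin n)) : Matrix (Fin n) (Fin n) ℝ :=
  Matrix.of fun i j ↦ ⟪coordVector x y i, coordVector x y j⟫_ℝ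

/-- The density `√(det g)` in the preferred chart around `x`. -/
def volumeDensity (x : M) (y : EuclideanSpace ℝ (Fin n)) : ℝ :=
  √(gramMatrix x y).det

/-- The measure `√(det g) dy¹ ⋯ dyⁿ` carried by the domain of the preferred chart around `x`. -/
def chartVolume (n : ℕ) {M : Type*} [MetricSpace M] [ChartedSpace (EuclideanSpace ℝ (Fin n)) M]
    [IsManifold (𝓡 n) ∞ M] [RiemannianBundle (fun p : M ↦ TangentSpace (𝓡 n) p)]
    [MeasurableSpace M] (x : M) : Measure M :=
  ((volume.restrict (chartAt (EuclideanSpace ℝ (Fin n)) x).target).withDensity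
    (fun y ↦ ENNReal.ofReal (volumeDensity x y))).map
      (chartAt (EuclideanSpace ℝ (Fin n)) x).symm

/-- The Riemannian volume measure. The measures `√(det g) dy¹ ⋯ dyⁿ` of any two charts agree on
the overlap of the charts, so their least upper bound in the lattice of measures is the measure
that equals `√(det g) dy¹ ⋯ dyⁿ` in every chart. -/
def riemannianVolume (n : ℕ) (M : Type*) [MetricSpace M]
    [ChartedSpace (EuclideanSpace ℝ (Fin n)) M]
    [IsManifold (𝓡 n) ∞ M] [RiemannianBundle (fun p : M ↦ TangentSpace (𝓡 n) p)]
    [MeasurableSpace M] : Measure M :=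
  ⨆ x : M, chartVolume n x

/-- The Riemannian gradient: the vector representing the differential of `f` at `p` with respect
to the Riemannian inner product (it is `0` where `f` is not differentiable). -/
def grad (n : ℕ) {M : Type*} [MetricSpace M] [ChartedSpace (EuclideanSpace ℝ (Fin n)) M]
    [IsManifold (𝓡 n) ∞ M] [RiemannianBundle (fun p : M ↦ TangentSpace (𝓡 n) p)]
    (f : M → ℝ) (p : M) : TangentSpace (𝓡 n) p :=
  haveI : FiniteDimensional ℝ (TangentSpace (𝓡 n) p) :=
    inferInstanceAs (FiniteDimensional ℝ (EuclideanSpace ℝ (Fin n)))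
  haveI : CompleteSpace (TangentSpace (𝓡 n) p) := FiniteDimensional.complete ℝ _
  (InnerProductSpace.toDual ℝ (TangentSpace (𝓡 n) p)).symm (mfderiv (𝓡 n) 𝓘(ℝ, ℝ) f p)

/-- The `i`-th component of a vector field in the preferred chart around `x`, as a function of the
coordinates `y`. -/
def coordComponent (X : ∀ p : M, TangentSpace (𝓡 n) p) (x : M)
    (y : EuclideanSpace ℝ (Fin n)) (i : Fin n) : ℝ :=
  (show EuclideanSpace ℝ (Fin n) from
    mfderiv (𝓡 n) (𝓡 n) (chartAt (EuclideanSpace ℝ (Fin n)) x)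
      ((chartAt (EuclideanSpace ℝ (Fin n)) x).symm y)
      (X ((chartAt (EuclideanSpace ℝ (Fin n)) x).symm y))) i

/-- The Riemannian divergence `(1 / √(det g)) ∑ᵢ ∂ᵢ (√(det g) Xⁱ)` at `p`, computed in the
preferred chart around `p`. -/
def divergence (X : ∀ p : M, TangentSpace (𝓡 n) p) (p : M) : ℝ :=
  (volumeDensity p (chartAt (EuclideanSpace ℝ (Fin n)) p p))⁻¹ *
    ∑ i : Fin n,
      fderiv ℝ (fun y ↦ volumeDensity p y * coordComponent X p y i)
        (chartAt (EuclideanSpace ℝ (Fin n)) p p) (EuclideanSpace.single i (1 : ℝ))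

/-- The Laplace–Beltrami operator `Δ f = div (grad f)`. -/
def laplacian (n : ℕ) {M : Type*} [MetricSpace M] [ChartedSpace (EuclideanSpace ℝ (Fin n)) M]
    [IsManifold (𝓡 n) ∞ M] [RiemannianBundle (fun p : M ↦ TangentSpace (𝓡 n) p)]
    (f : M → ℝ) (p : M) : ℝ :=
  divergence (grad n f) p

/-- `f ∈ C_c^∞(U)`: `f` is smooth and its support is a compact subset of `U`. -/
def IsTestFunction (n : ℕ) {M : Type*} [MetricSpace M]
    [ChartedSpace (EuclideanSpace ℝ (Fin n)) M] (U : Set M) (f : M → ℝ) : Prop :=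
  ContMDiff (𝓡 n) 𝓘(ℝ, ℝ) ∞ f ∧ HasCompactSupport f ∧ tsupport f ⊆ U

/-- `Δ ρ ≥ h` on the open set `U` in the sense of distributions. -/
def LaplacianGE (n : ℕ) {M : Type*} [MetricSpace M] [ChartedSpace (EuclideanSpace ℝ (Fin n)) M]
    [IsManifold (𝓡 n) ∞ M] [RiemannianBundle (fun p : M ↦ TangentSpace (𝓡 n) p)]
    [MeasurableSpace M] (U : Set M) (ρ h : M → ℝ) : Prop :=
  ∀ ψ : M → ℝ, IsTestFunction n U ψ → (∀ x, 0 ≤ ψ x) →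
    ∫ x, h x * ψ x ∂(riemannianVolume n M) ≤ ∫ x, ρ x * laplacian n ψ x ∂(riemannianVolume n M)

end RellichRiemannian

end

set_option linter.unusedSectionVars false
set_option linter.style.haveILetI false

noncomputable section

namespace RellichRiemannian

/-! ### The metric, differentials and gradients in a chart -/

section Chart

/-! Put β = α - 2, γ = (C + α - 3)/2 > 0 and A = γ(γ - β) = (C + α - 3)(C - α + 1)/4, and write N =
∫ ρ^(β-2) φ², I = ∫ ρ^(β-1) φ⟨∇φ, ∇ρ⟩ and S = ∫ ρ^β |∇φ + γ(φ/ρ)∇ρ|².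

Rellich part (`rellich_of_remainder`). Integrating ρ^(β-2) (ρ² Δφ + Aφ)² ≥ 0 gives ∫ ρ^α |Δφ|² ≥ -2A
∫ ρ^β φ Δφ - A² N. Green's formula and completion of the square give -∫ ρ^β φ Δφ = S + (β - 2γ) I -
γ² N. The inequality Δρ ≥ C/ρ, tested against ρ^(β-1) φ², says -I ≥ γN. Since β < 2γ, it follows
that -∫ ρ^β φ Δφ ≥ S + AN (`integral_squareDensity_add_le`), and the whole is at least A² N + 2AS.

Remainder (`integral_norm_grad_rpow_le`). It remains to bound S below by the L^q norm of u = ρ^(β/2)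
|∇φ|. Let c = ρ^(β/2-1) φ and let Z be the integrand of S. Now Δρ ≥ C/ρ is tested against a power of
ρ times |φ|^q. Because q < 2, this leaves a surplus k = (C + 1)(1 - q/2) > 0 over the amount qγ
cancelled by the square, and Young's inequality yields ∫ |c|^q ≤ (q/k)^q ∫ Z^(q/2). As u ≤ √Z +
γ|c|, the integral of u^q is controlled by that of Z^(q/2), and Hölder's inequality on Ω gives S
(`integral_rpow_le_of_flux`). The constants do not depend on ρ, C, α, because γ/k ≤ 1/(2 - q).

Geometry. Three facts have to be supplied. Green's formula is proved in charts for Lipschitz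
functions and globalized by a partition of unity (`integral_rpow_mul_laplacian`). The distributional
inequality, assumed for smooth test functions only, is extended by mollification to the Lipschitz
functions ρ^s w (`LaplacianGE.integral_le_of_tsupport_subset_source`,
`integral_rpow_mul_inner_grad_le`). Finally Ω has finite volume because a complete Riemannian
manifold is proper (`properSpace_of_isLength`). -/

theorem eq_sum_single {n : ℕ} (v : EuclideanSpace ℝ (Fin n)) :
    v = ∑ i, v i • EuclideanSpace.single i (1 : ℝ) := by
  ext j
  simp [Finset.sum_apply, Pi.single_apply]

variable {n : ℕ} {M : Type*} [MetricSpace M] [ChartedSpace (EuclideanSpace ℝ (Fin n)) M]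

theorem mfderiv_chart_symm_apply (x : M) (y v : EuclideanSpace ℝ (Fin n)) :
    mfderiv (𝓡 n) (𝓡 n) (chartAt (EuclideanSpace ℝ (Fin n)) x).symm y v =
      ∑ i, v i • coordVector x y i := by
  let L : EuclideanSpace ℝ (Fin n) →L[ℝ]
      TangentSpace (𝓡 n) ((chartAt (EuclideanSpace ℝ (Fin n)) x).symm y) :=
    mfderiv (𝓡 n) (𝓡 n) (chartAt (EuclideanSpace ℝ (Fin n)) x).symm y
  have h : L v = ∑ i, v i • L (EuclideanSpace.single i (1 : ℝ)) := by
    conv_lhs => rw [eq_sum_single v]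
    rw [map_sum]
    exact Finset.sum_congr rfl fun i _ ↦ map_smul _ _ _
  exact h

variable [IsManifold (𝓡 n) ∞ M]

theorem mfderiv_chart_mfderiv_symm {x : M} {y : EuclideanSpace ℝ (Fin n)}
    (hy : y ∈ (chartAt (EuclideanSpace ℝ (Fin n)) x).target) (v : EuclideanSpace ℝ (Fin n)) :
    mfderiv (𝓡 n) (𝓡 n) (chartAt (EuclideanSpace ℝ (Fin n)) x)
      ((chartAt (EuclideanSpace ℝ (Fin n)) x).symm y)
      (mfderiv (𝓡 n) (𝓡 n) (chartAt (EuclideanSpace ℝ (Fin n)) x).symm y v) = v := by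
  have : IsManifold (𝓡 n) 1 M := IsManifold.of_le (n := ∞) (by simp)
  have h := (mdifferentiable_chart (I := 𝓡 n) x).comp_symm_deriv hy
  exact DFunLike.congr_fun h v

theorem mfderiv_symm_mfderiv_chart {x : M} {y : EuclideanSpace ℝ (Fin n)}
    (hy : y ∈ (chartAt (EuclideanSpace ℝ (Fin n)) x).target)
    (v : TangentSpace (𝓡 n) ((chartAt (EuclideanSpace ℝ (Fin n)) x).symm y)) :
    mfderiv (𝓡 n) (𝓡 n) (chartAt (EuclideanSpace ℝ (Fin n)) x).symm y
      (mfderiv (𝓡 n) (𝓡 n) (chartAt (EuclideanSpace ℝ (Fin n)) x)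
      ((chartAt (EuclideanSpace ℝ (Fin n)) x).symm y) v) = v := by
  have : IsManifold (𝓡 n) 1 M := IsManifold.of_le (n := ∞) (by simp)
  have hp := (chartAt (EuclideanSpace ℝ (Fin n)) x).map_target hy
  have h := (mdifferentiable_chart (I := 𝓡 n) x).symm_comp_deriv hp
  have h' := DFunLike.congr_fun h v
  have hr := (chartAt (EuclideanSpace ℝ (Fin n)) x).right_inv hy
  have key : ∀ z, z = y → mfderiv (𝓡 n) (𝓡 n) (chartAt (EuclideanSpace ℝ (Fin n)) x).symm z
      (mfderiv (𝓡 n) (𝓡 n) (chartAt (EuclideanSpace ℝ (Fin n)) x)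
      ((chartAt (EuclideanSpace ℝ (Fin n)) x).symm y) v) =
      mfderiv (𝓡 n) (𝓡 n) (chartAt (EuclideanSpace ℝ (Fin n)) x).symm y
      (mfderiv (𝓡 n) (𝓡 n) (chartAt (EuclideanSpace ℝ (Fin n)) x)
      ((chartAt (EuclideanSpace ℝ (Fin n)) x).symm y) v) := by
    rintro z rfl; rfl
  exact (key _ hr).symm.trans h'

theorem mdifferentiableAt_iff_chart (f : M → ℝ) {x : M} {y : EuclideanSpace ℝ (Fin n)}
    (hy : y ∈ (chartAt (EuclideanSpace ℝ (Fin n)) x).target) :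
    MDifferentiableAt (𝓡 n) 𝓘(ℝ, ℝ) f ((chartAt (EuclideanSpace ℝ (Fin n)) x).symm y) ↔
      DifferentiableAt ℝ (f ∘ (chartAt (EuclideanSpace ℝ (Fin n)) x).symm) y := by
  have : IsManifold (𝓡 n) 1 M := IsManifold.of_le (n := ∞) (by simp)
  have hc := mdifferentiable_chart (I := 𝓡 n) x
  have hp := (chartAt (EuclideanSpace ℝ (Fin n)) x).map_target hy
  have hr := (chartAt (EuclideanSpace ℝ (Fin n)) x).right_inv hy
  rw [← mdifferentiableAt_iff_differentiableAt]
  constructor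
  · intro h
    exact h.comp y (hc.mdifferentiableAt_symm hy)
  · intro h
    have h1 : MDifferentiableAt (𝓡 n) 𝓘(ℝ, ℝ)
        ((f ∘ (chartAt (EuclideanSpace ℝ (Fin n)) x).symm) ∘
          (chartAt (EuclideanSpace ℝ (Fin n)) x))
        ((chartAt (EuclideanSpace ℝ (Fin n)) x).symm y) := by
      refine MDifferentiableAt.comp _ ?_ (hc.mdifferentiableAt hp)
      rw [hr]; exact h
    refine h1.congr_of_eventuallyEq ?_
    filter_upwards [(chartAt (EuclideanSpace ℝ (Fin n)) x).open_source.mem_nhds hp] with z hz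
    simp [(chartAt (EuclideanSpace ℝ (Fin n)) x).left_inv hz]

/-- Where `f` is not differentiable, neither is its coordinate expression, and both derivatives take
the default value zero. The chart formulas below therefore hold at every point, also for functions
that are only Lipschitz. -/
theorem mfderiv_apply_mfderiv_symm (f : M → ℝ) {x : M} {y : EuclideanSpace ℝ (Fin n)}
    (hy : y ∈ (chartAt (EuclideanSpace ℝ (Fin n)) x).target) (v : EuclideanSpace ℝ (Fin n)) :
    (mfderiv (𝓡 n) 𝓘(ℝ, ℝ) f ((chartAt (EuclideanSpace ℝ (Fin n)) x).symm y)
      (mfderiv (𝓡 n) (𝓡 n) (chartAt (EuclideanSpace ℝ (Fin n)) x).symm y v) : ℝ) =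
      fderiv ℝ (f ∘ (chartAt (EuclideanSpace ℝ (Fin n)) x).symm) y v := by
  have : IsManifold (𝓡 n) 1 M := IsManifold.of_le (n := ∞) (by simp)
  have hc := mdifferentiable_chart (I := 𝓡 n) x
  by_cases h : MDifferentiableAt (𝓡 n) 𝓘(ℝ, ℝ) f
      ((chartAt (EuclideanSpace ℝ (Fin n)) x).symm y)
  · have := mfderiv_comp y h (hc.mdifferentiableAt_symm hy)
    rw [mfderiv_eq_fderiv] at this
    rw [this]
    rfl
  · have h' := (mdifferentiableAt_iff_chart f hy).not.1 h
    rw [mfderiv_zero_of_not_mdifferentiableAt h, fderiv_zero_of_not_differentiableAt h']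
    rfl

variable [RiemannianBundle (fun p : M ↦ TangentSpace (𝓡 n) p)]

theorem inner_mfderiv_symm (x : M) (y v w : EuclideanSpace ℝ (Fin n)) :
    ⟪mfderiv (𝓡 n) (𝓡 n) (chartAt (EuclideanSpace ℝ (Fin n)) x).symm y v,
      mfderiv (𝓡 n) (𝓡 n) (chartAt (EuclideanSpace ℝ (Fin n)) x).symm y w⟫_ℝ =
      ∑ i, ∑ j, v i * w j * gramMatrix x y i j := by
  rw [mfderiv_chart_symm_apply, mfderiv_chart_symm_apply, sum_inner]
  refine Finset.sum_congr rfl fun i _ ↦ ?_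
  rw [inner_sum]
  refine Finset.sum_congr rfl fun j _ ↦ ?_
  rw [real_inner_smul_left, real_inner_smul_right]
  simp only [gramMatrix, Matrix.of_apply]
  ring

theorem gramMatrix_isSymm (x : M) (y : EuclideanSpace ℝ (Fin n)) :
    (gramMatrix x y).IsSymm := by
  ext i j
  simp [gramMatrix, real_inner_comm]

/-- The quadratic form of the Gram matrix is the squared norm of the image of a coordinate vector
under the differential of the inverse chart, which is injective because the differential of the
chart is a left inverse. -/
theorem gramMatrix_posDef {x : M} {y : EuclideanSpace ℝ (Fin n)}
    (hy : y ∈ (chartAt (EuclideanSpace ℝ (Fin n)) x).target) : (gramMatrix x y).PosDef := by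
  refine Matrix.PosDef.of_dotProduct_mulVec_pos ?_ ?_
  · rw [Matrix.IsHermitian, Matrix.conjTranspose_eq_transpose_of_trivial]
    exact gramMatrix_isSymm x y
  · intro v hv
    set w : EuclideanSpace ℝ (Fin n) := WithLp.toLp 2 v with hw
    have h0 : mfderiv (𝓡 n) (𝓡 n) (chartAt (EuclideanSpace ℝ (Fin n)) x).symm y w ≠ 0 := by
      intro h
      have h1 := mfderiv_chart_mfderiv_symm hy w
      rw [h, map_zero] at h1
      apply hv
      ext i
      have := congrArg (fun u : EuclideanSpace ℝ (Fin n) ↦ u i) h1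
      exact this.symm
    have h2 := real_inner_self_pos.2 h0
    rw [inner_mfderiv_symm] at h2
    refine h2.trans_eq ?_
    simp only [dotProduct, Matrix.mulVec, Finset.mul_sum, hw, star_trivial]
    refine Finset.sum_congr rfl fun i _ ↦ Finset.sum_congr rfl fun j _ ↦ ?_
    ring

theorem gramMatrix_det_pos {x : M} {y : EuclideanSpace ℝ (Fin n)}
    (hy : y ∈ (chartAt (EuclideanSpace ℝ (Fin n)) x).target) : 0 < (gramMatrix x y).det :=
  (gramMatrix_posDef hy).det_pos

theorem volumeDensity_pos {x : M} {y : EuclideanSpace ℝ (Fin n)}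
    (hy : y ∈ (chartAt (EuclideanSpace ℝ (Fin n)) x).target) : 0 < volumeDensity x y :=
  Real.sqrt_pos.2 (gramMatrix_det_pos hy)

/-- The coordinates of the gradient of `h` in the preferred chart around `x`. -/
def chartGrad (h : M → ℝ) (x : M) (y : EuclideanSpace ℝ (Fin n)) : EuclideanSpace ℝ (Fin n) :=
  WithLp.toLp 2 ((gramMatrix x y)⁻¹.mulVec fun j ↦
    fderiv ℝ (h ∘ (chartAt (EuclideanSpace ℝ (Fin n)) x).symm) y (EuclideanSpace.single j (1 : ℝ)))

theorem inner_grad (f : M → ℝ) (p : M) (v : TangentSpace (𝓡 n) p) :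
    ⟪grad n f p, v⟫_ℝ = (mfderiv (𝓡 n) 𝓘(ℝ, ℝ) f p v : ℝ) := by
  have : FiniteDimensional ℝ (TangentSpace (𝓡 n) p) :=
    inferInstanceAs (FiniteDimensional ℝ (EuclideanSpace ℝ (Fin n)))
  have : CompleteSpace (TangentSpace (𝓡 n) p) := FiniteDimensional.complete ℝ _
  exact InnerProductSpace.toDual_symm_apply

/-- Paired with a tangent vector of coordinates `w`, the right side is `wᵀ G (G⁻¹ d) = wᵀ d`, where
`d` is the vector of partial derivatives; this is the differential of `h`. -/
theorem grad_eq_mfderiv_chartGrad (h : M → ℝ) {x : M} {y : EuclideanSpace ℝ (Fin n)}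
    (hy : y ∈ (chartAt (EuclideanSpace ℝ (Fin n)) x).target) :
    grad n h ((chartAt (EuclideanSpace ℝ (Fin n)) x).symm y) =
      mfderiv (𝓡 n) (𝓡 n) (chartAt (EuclideanSpace ℝ (Fin n)) x).symm y (chartGrad h x y) := by
  refine ext_inner_right ℝ fun v ↦ ?_
  rw [inner_grad, ← mfderiv_symm_mfderiv_chart hy v]
  set w : EuclideanSpace ℝ (Fin n) := mfderiv (𝓡 n) (𝓡 n)
    (chartAt (EuclideanSpace ℝ (Fin n)) x) ((chartAt (EuclideanSpace ℝ (Fin n)) x).symm y) v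
  refine (mfderiv_apply_mfderiv_symm h hy w).trans ?_
  rw [inner_mfderiv_symm]
  set d : Fin n → ℝ := fun j ↦ fderiv ℝ (h ∘ (chartAt (EuclideanSpace ℝ (Fin n)) x).symm) y
    (EuclideanSpace.single j (1 : ℝ))
  have h1 : fderiv ℝ (h ∘ (chartAt (EuclideanSpace ℝ (Fin n)) x).symm) y w = ∑ j, w j * d j := by
    conv_lhs => rw [eq_sum_single w]
    simp [d]
  have hd : (gramMatrix x y).mulVec ((gramMatrix x y)⁻¹.mulVec d) = d := by
    rw [Matrix.mulVec_mulVec, Matrix.mul_nonsing_inv _ (gramMatrix_det_pos hy).ne'.isUnit,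
      Matrix.one_mulVec]
  rw [h1, Finset.sum_comm]
  refine Finset.sum_congr rfl fun j _ ↦ ?_
  have hc : ∀ i, chartGrad h x y i = (gramMatrix x y)⁻¹.mulVec d i := fun _ ↦ rfl
  have hdj : ∑ i, gramMatrix x y j i * (gramMatrix x y)⁻¹.mulVec d i = d j := congrFun hd j
  conv_lhs => rw [← hdj]
  rw [Finset.mul_sum]
  refine Finset.sum_congr rfl fun i _ ↦ ?_
  rw [← (gramMatrix_isSymm x y).apply i j, hc]
  have key : ∀ a b c : ℝ, a * (b * c) = c * a * b := fun a b c ↦ by ring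
  exact key _ _ _

theorem coordComponent_grad (h : M → ℝ) {x : M} {y : EuclideanSpace ℝ (Fin n)}
    (hy : y ∈ (chartAt (EuclideanSpace ℝ (Fin n)) x).target) (i : Fin n) :
    coordComponent (grad n h) x y i = chartGrad h x y i := by
  unfold coordComponent
  rw [grad_eq_mfderiv_chartGrad h hy]
  exact congrArg (fun u : EuclideanSpace ℝ (Fin n) ↦ u i) (mfderiv_chart_mfderiv_symm hy _)

theorem inner_grad_grad (f h : M → ℝ) {x : M} {y : EuclideanSpace ℝ (Fin n)}
    (hy : y ∈ (chartAt (EuclideanSpace ℝ (Fin n)) x).target) :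
    ⟪grad n f ((chartAt (EuclideanSpace ℝ (Fin n)) x).symm y),
      grad n h ((chartAt (EuclideanSpace ℝ (Fin n)) x).symm y)⟫_ℝ =
      fderiv ℝ (f ∘ (chartAt (EuclideanSpace ℝ (Fin n)) x).symm) y (chartGrad h x y) := by
  rw [inner_grad, grad_eq_mfderiv_chartGrad h hy]
  exact mfderiv_apply_mfderiv_symm f hy _

end Chart

/-! ### Smoothness of the metric coefficients and change of charts -/

section Smooth

variable {n : ℕ} {M : Type*} [MetricSpace M] [ChartedSpace (EuclideanSpace ℝ (Fin n)) M]

local notation "𝔼" => EuclideanSpace ℝ (Fin n)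
local notation "𝔠" => chartAt (EuclideanSpace ℝ (Fin n))

theorem contDiffOn_det {s : Set 𝔼} {A : 𝔼 → Matrix (Fin n) (Fin n) ℝ}
    (hA : ∀ i j, ContDiffOn ℝ ∞ (fun y ↦ A y i j) s) : ContDiffOn ℝ ∞ (fun y ↦ (A y).det) s := by
  simp only [Matrix.det_apply']
  exact ContDiffOn.sum fun σ _ ↦ contDiffOn_const.mul (contDiffOn_prod fun i _ ↦ hA _ _)

/-- Cramer's rule: each entry of the adjugate is itself a determinant of smooth entries. -/
theorem contDiffOn_inv_apply {s : Set 𝔼} {A : 𝔼 → Matrix (Fin n) (Fin n) ℝ}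
    (hA : ∀ i j, ContDiffOn ℝ ∞ (fun y ↦ A y i j) s) (hd : ∀ y ∈ s, (A y).det ≠ 0)
    (i j : Fin n) : ContDiffOn ℝ ∞ (fun y ↦ (A y)⁻¹ i j) s := by
  have h : ContDiffOn ℝ ∞ (fun y ↦ (A y).adjugate i j) s := by
    simp only [Matrix.adjugate_apply]
    refine contDiffOn_det fun k l ↦ ?_
    by_cases hk : k = j
    · subst hk
      simp only [Matrix.updateRow_self]
      exact contDiffOn_const
    · simp only [Matrix.updateRow_ne hk]
      exact hA k l
  refine (((contDiffOn_det hA).inv hd).mul h).congr fun y _ ↦ ?_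
  simp [Matrix.inv_def]

variable [IsManifold (𝓡 n) ∞ M]

/-- The coordinate field is the tangent map of the smooth inverse chart applied to a constant field.
-/
theorem contMDiffOn_coordVector (x : M) (i : Fin n) :
    ContMDiffOn (𝓡 n) ((𝓡 n).prod (𝓡 n)) ∞
      (fun y : 𝔼 ↦ (⟨(𝔠 x).symm y, coordVector x y i⟩ : TotalSpace 𝔼 (TangentSpace (𝓡 n) (M := M))))
      (𝔠 x).target := by
  have h1 : ContMDiffOn (𝓡 n) (𝓡 n) ∞ (𝔠 x).symm (𝔠 x).target := contMDiffOn_chart_symm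
  have h2 := h1.contMDiffOn_tangentMapWithin (m := ∞) (by simp)
    (𝔠 x).open_target.uniqueMDiffOn
  have h3 : ContMDiffOn (𝓡 n) ((𝓡 n).prod (𝓡 n)) ∞
      (fun y : 𝔼 ↦ (⟨y, EuclideanSpace.single i (1 : ℝ)⟩ :
        TotalSpace 𝔼 (TangentSpace (𝓡 n) (M := 𝔼)))) (𝔠 x).target :=
    contMDiffOn_vectorSpace_iff_contDiffOn.2 contDiffOn_const
  refine (h2.comp h3 fun y hy ↦ hy).congr fun y hy ↦ ?_
  simp only [Function.comp, tangentMapWithin, coordVector]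
  rw [mfderivWithin_of_isOpen (𝔠 x).open_target hy]

theorem contDiffOn_comp_chart_symm {h : M → ℝ} (hh : ContMDiff (𝓡 n) 𝓘(ℝ, ℝ) ∞ h) (x : M) :
    ContDiffOn ℝ ∞ (h ∘ (𝔠 x).symm) (𝔠 x).target := by
  have h1 : ContMDiffOn (𝓡 n) (𝓡 n) ∞ (𝔠 x).symm (𝔠 x).target := contMDiffOn_chart_symm
  exact (hh.comp_contMDiffOn h1).contDiffOn

theorem contDiffOn_transition (x z : M) :
    ContDiffOn ℝ ∞ (𝔠 z ∘ (𝔠 x).symm) ((𝔠 x).target ∩ (𝔠 x).symm ⁻¹' (𝔠 z).source) := by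
  have h1 : ContMDiffOn (𝓡 n) (𝓡 n) ∞ (𝔠 x).symm (𝔠 x).target := contMDiffOn_chart_symm
  have h2 : ContMDiffOn (𝓡 n) (𝓡 n) ∞ (𝔠 z) (𝔠 z).source := contMDiffOn_chart
  exact (h2.comp (h1.mono Set.inter_subset_left) fun y hy ↦ hy.2).contDiffOn

variable [RiemannianBundle (fun p : M ↦ TangentSpace (𝓡 n) p)]

theorem inner_eq_gramMatrix (z p : M) (hp : p ∈ (𝔠 z).source) (v w : TangentSpace (𝓡 n) p) :
    ⟪v, w⟫_ℝ = ∑ i, ∑ j, (show 𝔼 from mfderiv (𝓡 n) (𝓡 n) (𝔠 z) p v) i *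
      (show 𝔼 from mfderiv (𝓡 n) (𝓡 n) (𝔠 z) p w) j * gramMatrix z (𝔠 z p) i j := by
  obtain ⟨y, hy, rfl⟩ : ∃ y ∈ (𝔠 z).target, (𝔠 z).symm y = p :=
    ⟨𝔠 z p, (𝔠 z).map_source hp, (𝔠 z).left_inv hp⟩
  rw [(𝔠 z).right_inv hy, ← inner_mfderiv_symm]
  exact congrArg₂ (fun a b ↦ ⟪a, b⟫_ℝ) (mfderiv_symm_mfderiv_chart hy v).symm
    (mfderiv_symm_mfderiv_chart hy w).symm

theorem gramMatrix_transition {x z : M} {y : 𝔼} (hy : y ∈ (𝔠 x).target)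
    (hz : (𝔠 x).symm y ∈ (𝔠 z).source) (k l : Fin n) :
    gramMatrix x y k l = ∑ i, ∑ j,
      fderiv ℝ (𝔠 z ∘ (𝔠 x).symm) y (EuclideanSpace.single k (1 : ℝ)) i *
      fderiv ℝ (𝔠 z ∘ (𝔠 x).symm) y (EuclideanSpace.single l (1 : ℝ)) j *
      gramMatrix z (𝔠 z ((𝔠 x).symm y)) i j := by
  have : IsManifold (𝓡 n) 1 M := IsManifold.of_le (n := ∞) (by simp)
  have hc : ∀ v : 𝔼, (show 𝔼 from mfderiv (𝓡 n) (𝓡 n) (𝔠 z) ((𝔠 x).symm y)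
      (mfderiv (𝓡 n) (𝓡 n) (𝔠 x).symm y v)) = fderiv ℝ (𝔠 z ∘ (𝔠 x).symm) y v := by
    intro v
    have h := mfderiv_comp y ((mdifferentiable_chart (I := 𝓡 n) z).mdifferentiableAt hz)
      ((mdifferentiable_chart (I := 𝓡 n) x).mdifferentiableAt_symm hy)
    rw [mfderiv_eq_fderiv] at h
    rw [h]
    rfl
  have h := inner_eq_gramMatrix z _ hz (coordVector x y k) (coordVector x y l)
  refine h.trans ?_
  rw [← hc, ← hc]
  rfl

/-- With `J` the Jacobian matrix of the transition map, the Gram matrices satisfy `G = Jᵀ G' J`. The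
square root of the determinant then acquires the factor `|det J|` of the change of variables
formula. -/
theorem volumeDensity_transition {x z : M} {y : 𝔼} (hy : y ∈ (𝔠 x).target)
    (hz : (𝔠 x).symm y ∈ (𝔠 z).source) :
    volumeDensity x y = |(fderiv ℝ (𝔠 z ∘ (𝔠 x).symm) y).det| *
      volumeDensity z (𝔠 z ((𝔠 x).symm y)) := by
  set T := fderiv ℝ (𝔠 z ∘ (𝔠 x).symm) y
  set b := (EuclideanSpace.basisFun (Fin n) ℝ).toBasis
  set J : Matrix (Fin n) (Fin n) ℝ := LinearMap.toMatrix b b T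
  have hJ : ∀ i k, J i k = T (EuclideanSpace.single k (1 : ℝ)) i := by
    intro i k
    simp [J, b, LinearMap.toMatrix_apply]
  have hg : gramMatrix x y = J.transpose * gramMatrix z (𝔠 z ((𝔠 x).symm y)) * J := by
    ext k l
    rw [gramMatrix_transition hy hz, Finset.sum_comm]
    simp only [Matrix.mul_apply, Matrix.transpose_apply, hJ, Finset.sum_mul]
    refine Finset.sum_congr rfl fun i _ ↦ Finset.sum_congr rfl fun j _ ↦ ?_
    ring
  have hdet : J.det = T.det := LinearMap.det_toMatrix b _
  unfold volumeDensity
  rw [hg, Matrix.det_mul, Matrix.det_mul, Matrix.det_transpose, hdet,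
    show T.det * (gramMatrix z (𝔠 z ((𝔠 x).symm y))).det * T.det =
      T.det ^ 2 * (gramMatrix z (𝔠 z ((𝔠 x).symm y))).det by ring,
    Real.sqrt_mul (sq_nonneg _), Real.sqrt_sq_eq_abs]

variable [IsContMDiffRiemannianBundle (𝓡 n) ∞ (EuclideanSpace ℝ (Fin n))
      (fun p : M ↦ TangentSpace (𝓡 n) p)]

theorem contDiffOn_gramMatrix (x : M) (i j : Fin n) :
    ContDiffOn ℝ ∞ (fun y ↦ gramMatrix x y i j) (𝔠 x).target := by
  have h := (contMDiffOn_coordVector x i).inner_bundle (contMDiffOn_coordVector x j)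
  exact h.contDiffOn

theorem contDiffOn_volumeDensity (x : M) :
    ContDiffOn ℝ ∞ (volumeDensity x) (𝔠 x).target :=
  (contDiffOn_det (contDiffOn_gramMatrix x)).sqrt fun _ hy ↦ (gramMatrix_det_pos hy).ne'

theorem contDiffOn_chartGrad {h : M → ℝ} (hh : ContMDiff (𝓡 n) 𝓘(ℝ, ℝ) ∞ h) (x : M)
    (i : Fin n) : ContDiffOn ℝ ∞ (fun y ↦ chartGrad h x y i) (𝔠 x).target := by
  have h1 := (contDiffOn_comp_chart_symm hh x).fderiv_of_isOpen (m := ∞) (𝔠 x).open_target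
    (by simp)
  have h2 : ∀ j, ContDiffOn ℝ ∞ (fun y ↦ (gramMatrix x y)⁻¹ i j *
      fderiv ℝ (h ∘ (𝔠 x).symm) y (EuclideanSpace.single j (1 : ℝ))) (𝔠 x).target := fun j ↦
    (contDiffOn_inv_apply (contDiffOn_gramMatrix x) (fun _ hy ↦ (gramMatrix_det_pos hy).ne') i j).mul
      (h1.clm_apply contDiffOn_const)
  have h3 := ContDiffOn.sum (s := Finset.univ) fun j _ ↦ h2 j
  exact h3

end Smooth

/-! ### The Riemannian volume measure -/

section Volume

variable {n : ℕ} {M : Type*} [MetricSpace M] [ChartedSpace (EuclideanSpace ℝ (Fin n)) M]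

local notation "𝔼" => EuclideanSpace ℝ (Fin n)
local notation "𝔠" => chartAt (EuclideanSpace ℝ (Fin n))

variable [MeasurableSpace M] [BorelSpace M]

theorem aemeasurable_chart_symm (x : M) :
    AEMeasurable (𝔠 x).symm ((volume : Measure 𝔼).restrict (𝔠 x).target) :=
  (𝔠 x).continuousOn_symm.aemeasurable (𝔠 x).open_target.measurableSet

theorem measurableSet_chart_symm_preimage (x : M) {A : Set M} (hA : MeasurableSet A) :
    MeasurableSet ((𝔠 x).target ∩ (𝔠 x).symm ⁻¹' A) := by
  classical
  have h : Measurable ((𝔠 x).target.piecewise (𝔠 x).symm fun _ ↦ x) :=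
    (𝔠 x).continuousOn_symm.measurable_piecewise continuousOn_const
      (𝔠 x).open_target.measurableSet
  convert (𝔠 x).open_target.measurableSet.inter (h hA) using 1
  ext y
  refine and_congr_right fun hy ↦ ?_
  simp [Set.piecewise_eq_of_mem _ _ _ hy]

variable [IsManifold (𝓡 n) ∞ M] [RiemannianBundle (fun p : M ↦ TangentSpace (𝓡 n) p)]

theorem aemeasurable_chart_symm_withDensity (x : M) (d : 𝔼 → ENNReal) :
    AEMeasurable (𝔠 x).symm
      (((volume : Measure 𝔼).restrict (𝔠 x).target).withDensity d) :=
  (aemeasurable_chart_symm x).mono_ac (withDensity_absolutelyContinuous _ _)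

theorem chartVolume_apply (x : M) {A : Set M} (hA : MeasurableSet A) :
    chartVolume n x A = ∫⁻ y in (𝔠 x).target ∩ (𝔠 x).symm ⁻¹' A,
      ENNReal.ofReal (volumeDensity x y) := by
  rw [chartVolume, Measure.map_apply_of_aemeasurable (aemeasurable_chart_symm_withDensity x _) hA,
    withDensity_apply', Measure.restrict_restrict' (𝔠 x).open_target.measurableSet, Set.inter_comm]

/-- Change of variables under the transition map, whose Jacobian is exactly the ratio of the two
densities. -/
theorem chartVolume_eq_of_subset (x z : M) {A : Set M} (hA : MeasurableSet A)
    (hx : A ⊆ (𝔠 x).source) (hz : A ⊆ (𝔠 z).source) :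
    chartVolume n x A = chartVolume n z A := by
  rw [chartVolume_apply x hA, chartVolume_apply z hA]
  set B := (𝔠 x).target ∩ (𝔠 x).symm ⁻¹' A with hB
  have himg : (𝔠 z).target ∩ (𝔠 z).symm ⁻¹' A = (𝔠 z ∘ (𝔠 x).symm) '' B := by
    ext w
    constructor
    · rintro ⟨hw, hwA⟩
      refine ⟨𝔠 x ((𝔠 z).symm w), ⟨(𝔠 x).map_source (hx hwA), ?_⟩, ?_⟩
      · simpa [(𝔠 x).left_inv (hx hwA)] using hwA
      · simp [(𝔠 x).left_inv (hx hwA), (𝔠 z).right_inv hw]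
    · rintro ⟨y, ⟨-, hyA⟩, rfl⟩
      refine ⟨(𝔠 z).map_source (hz hyA), ?_⟩
      simpa [(𝔠 z).left_inv (hz hyA)] using hyA
  have hder : ∀ y ∈ B, HasFDerivWithinAt (𝔠 z ∘ (𝔠 x).symm)
      (fderiv ℝ (𝔠 z ∘ (𝔠 x).symm) y) B y := by
    intro y hy
    have ho : IsOpen ((𝔠 x).target ∩ (𝔠 x).symm ⁻¹' (𝔠 z).source) :=
      (𝔠 x).symm.isOpen_inter_preimage (𝔠 z).open_source
    exact (((contDiffOn_transition x z).contDiffAt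
      (ho.mem_nhds ⟨hy.1, hz hy.2⟩)).differentiableAt (by simp)).hasFDerivAt.hasFDerivWithinAt
  have hinj : Set.InjOn (𝔠 z ∘ (𝔠 x).symm) B := by
    intro y hy y' hy' h
    exact (𝔠 x).symm.injOn hy.1 hy'.1 ((𝔠 z).injOn (hz hy.2) (hz hy'.2) h)
  rw [himg, lintegral_image_eq_lintegral_abs_det_fderiv_mul volume
    (measurableSet_chart_symm_preimage x hA) hder hinj]
  refine setLIntegral_congr_fun (measurableSet_chart_symm_preimage x hA) fun y hy ↦ ?_
  simp only [Function.comp]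
  rw [volumeDensity_transition hy.1 (hz hy.2), ENNReal.ofReal_mul (abs_nonneg _)]

theorem chartVolume_inter_source (x : M) {A : Set M} (hA : MeasurableSet A) :
    chartVolume n x (A ∩ (𝔠 x).source) = chartVolume n x A := by
  rw [chartVolume_apply x hA, chartVolume_apply x (hA.inter (𝔠 x).open_source.measurableSet)]
  congr 2
  ext y
  simp only [Set.mem_inter_iff, Set.mem_preimage]
  exact ⟨fun h ↦ ⟨h.1, h.2.1⟩, fun h ↦ ⟨h.1, h.2, (𝔠 x).map_target h.1⟩⟩

/-- This turns the supremum defining the volume into something computable: no other chart adds mass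
inside the domain of the chart around `x`. -/
theorem restrict_riemannianVolume (x : M) :
    (riemannianVolume n M).restrict (𝔠 x).source = chartVolume n x := by
  have hS : MeasurableSet (𝔠 x).source := (𝔠 x).open_source.measurableSet
  refine le_antisymm ?_ ?_
  -- An upper bound for all chart measures at once: inside the domain each is dominated by the chart
  -- measure of `x`, and outside it the measure `⊤` costs nothing, since the restriction removes it.
  · have h1 : riemannianVolume n M ≤
        chartVolume n x + (⊤ : Measure M).restrict (𝔠 x).sourceᶜ := by
      refine iSup_le fun z ↦ Measure.le_iff.2 fun A hA ↦ ?_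
      rw [← measure_inter_add_sdiff A hS, Measure.add_apply, Measure.restrict_apply hA]
      refine add_le_add ?_ ((le_top : chartVolume n z ≤ ⊤) _)
      have hAS := hA.inter hS
      rw [← chartVolume_inter_source z hAS, ← chartVolume_eq_of_subset x z
        (hAS.inter (𝔠 z).open_source.measurableSet)
        (fun p hp ↦ hp.1.2) (fun p hp ↦ hp.2)]
      exact measure_mono fun p hp ↦ hp.1.1
    refine (Measure.restrict_mono le_rfl h1).trans ?_
    rw [Measure.restrict_add, Measure.restrict_restrict hS, Set.inter_compl_self,
      Measure.restrict_empty, add_zero]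
    exact Measure.restrict_le_self
  · refine Measure.le_iff.2 fun A hA ↦ ?_
    rw [← chartVolume_inter_source x hA, Measure.restrict_apply hA]
    exact (le_iSup (fun z : M ↦ chartVolume n z) x) _

theorem riemannianVolume_eq_chartVolume (x : M) {A : Set M} (hA : A ⊆ (𝔠 x).source) :
    riemannianVolume n M A = chartVolume n x A := by
  rw [← restrict_riemannianVolume x, Measure.restrict_apply' (𝔠 x).open_source.measurableSet,
    Set.inter_eq_left.2 hA]

theorem chartVolume_ae_mem_source (x : M) : ∀ᵐ p ∂(chartVolume n x), p ∈ (𝔠 x).source := by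
  rw [← restrict_riemannianVolume x]
  exact ae_restrict_mem (𝔠 x).open_source.measurableSet

theorem aestronglyMeasurable_chartVolume (x : M) {F : M → ℝ}
    (hF : AEStronglyMeasurable (F ∘ (𝔠 x).symm) ((volume : Measure 𝔼).restrict (𝔠 x).target)) :
    AEStronglyMeasurable F (chartVolume n x) := by
  have he : AEMeasurable (𝔠 x) (chartVolume n x) := by
    rw [← restrict_riemannianVolume x]
    exact (𝔠 x).continuousOn.aemeasurable (𝔠 x).open_source.measurableSet
  have hmap : (chartVolume n x).map (𝔠 x) ≪ (volume : Measure 𝔼).restrict (𝔠 x).target := by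
    unfold chartVolume at he ⊢
    rw [AEMeasurable.map_map_of_aemeasurable he (aemeasurable_chart_symm_withDensity x _)]
    have hid : (𝔠 x ∘ (𝔠 x).symm) =ᵐ[((volume : Measure 𝔼).restrict (𝔠 x).target).withDensity
        fun y ↦ ENNReal.ofReal (volumeDensity x y)] id := by
      refine (withDensity_absolutelyContinuous _ _).ae_le ?_
      filter_upwards [ae_restrict_mem (𝔠 x).open_target.measurableSet] with y hy
      exact (𝔠 x).right_inv hy
    rw [Measure.map_congr hid, Measure.map_id]
    exact withDensity_absolutelyContinuous _ _
  refine ((hF.mono_ac hmap).comp_aemeasurable he).congr ?_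
  filter_upwards [chartVolume_ae_mem_source x] with p hp
  simp [(𝔠 x).left_inv hp]

variable [IsContMDiffRiemannianBundle (𝓡 n) ∞ (EuclideanSpace ℝ (Fin n))
      (fun p : M ↦ TangentSpace (𝓡 n) p)]

theorem integral_chartVolume (x : M) (F : M → ℝ) :
    ∫ p, F p ∂(chartVolume n x) =
      ∫ y in (𝔠 x).target, volumeDensity x y * F ((𝔠 x).symm y) := by
  have hd : AEMeasurable (fun y ↦ ENNReal.ofReal (volumeDensity x y))
      ((volume : Measure 𝔼).restrict (𝔠 x).target) :=
    ((contDiffOn_volumeDensity x).continuousOn.aemeasurable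
      (𝔠 x).open_target.measurableSet).ennreal_ofReal
  have hpos : ∀ᵐ y ∂((volume : Measure 𝔼).restrict (𝔠 x).target), 0 < volumeDensity x y := by
    filter_upwards [ae_restrict_mem (𝔠 x).open_target.measurableSet] with y hy
    exact volumeDensity_pos hy
  have h2 : ∫ y, F ((𝔠 x).symm y) ∂(((volume : Measure 𝔼).restrict (𝔠 x).target).withDensity
        fun y ↦ ENNReal.ofReal (volumeDensity x y)) =
      ∫ y in (𝔠 x).target, volumeDensity x y * F ((𝔠 x).symm y) := by
    rw [integral_withDensity_eq_integral_toReal_smul₀ hd (by simp)]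
    refine integral_congr_ae ?_
    filter_upwards [hpos] with y hy
    rw [ENNReal.toReal_ofReal hy.le, smul_eq_mul]
  rw [← h2]
  by_cases hF : AEStronglyMeasurable F (chartVolume n x)
  · exact integral_map (aemeasurable_chart_symm_withDensity x _) hF
  -- For non-measurable `F` both integrals are zero by default. Positivity of the density is what
  -- transfers non-measurability to coordinates, and it frees the formula from any hypothesis on
  -- `F`.
  · rw [integral_non_aestronglyMeasurable hF, integral_non_aestronglyMeasurable]
    intro h
    refine hF (aestronglyMeasurable_chartVolume x (h.mono_ac ?_))
    refine withDensity_absolutelyContinuous' hd ?_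
    filter_upwards [hpos] with y hy
    simpa using hy

theorem integral_riemannianVolume_eq_chart (x : M) {F : M → ℝ}
    (hF : ∀ p ∉ (𝔠 x).source, F p = 0) :
    ∫ p, F p ∂(riemannianVolume n M) =
      ∫ y in (𝔠 x).target, volumeDensity x y * F ((𝔠 x).symm y) := by
  rw [← integral_chartVolume, ← restrict_riemannianVolume,
    setIntegral_eq_integral_of_forall_compl_eq_zero hF]

theorem aestronglyMeasurable_riemannianVolume [SecondCountableTopology M] {F : M → ℝ}
    (hF : ∀ x : M, AEStronglyMeasurable (F ∘ (𝔠 x).symm)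
      ((volume : Measure 𝔼).restrict (𝔠 x).target)) :
    AEStronglyMeasurable F (riemannianVolume n M) := by
  obtain ⟨t, ht, htU⟩ := countable_cover_nhds
    (fun x : M ↦ (𝔠 x).open_source.mem_nhds (mem_chart_source 𝔼 x))
  have := ht.to_subtype
  rw [Set.biUnion_eq_iUnion] at htU
  rw [← Measure.restrict_univ (μ := riemannianVolume n M), ← htU, aestronglyMeasurable_iUnion_iff]
  intro x
  rw [restrict_riemannianVolume]
  exact aestronglyMeasurable_chartVolume _ (hF _)

theorem isLocallyFiniteMeasure_riemannianVolume :
    IsLocallyFiniteMeasure (riemannianVolume n M) := by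
  refine ⟨fun x ↦ ?_⟩
  have hx : 𝔠 x x ∈ (𝔠 x).target := mem_chart_target 𝔼 x
  obtain ⟨K, hK, hxK, hKt⟩ := exists_compact_subset (𝔠 x).open_target hx
  have hU : (𝔠 x).source ∩ 𝔠 x ⁻¹' interior K ∈ nhds x :=
    ((𝔠 x).isOpen_inter_preimage isOpen_interior).mem_nhds ⟨mem_chart_source 𝔼 x, hxK⟩
  refine ⟨_, hU, ?_⟩
  have hUm : MeasurableSet ((𝔠 x).source ∩ 𝔠 x ⁻¹' interior K) :=
    ((𝔠 x).isOpen_inter_preimage isOpen_interior).measurableSet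
  rw [riemannianVolume_eq_chartVolume x Set.inter_subset_left, chartVolume_apply x hUm]
  have hsub : (𝔠 x).target ∩ (𝔠 x).symm ⁻¹' ((𝔠 x).source ∩ 𝔠 x ⁻¹' interior K) ⊆ K := by
    rintro y ⟨hy, -, hyK⟩
    have : 𝔠 x ((𝔠 x).symm y) ∈ interior K := hyK
    rw [(𝔠 x).right_inv hy] at this
    exact interior_subset this
  refine (lintegral_mono_set hsub).trans_lt ?_
  have hi : IntegrableOn (volumeDensity x) K :=
    ((contDiffOn_volumeDensity x).continuousOn.mono hKt).integrableOn_compact hK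
  exact hi.lintegral_lt_top

theorem isOpenPosMeasure_riemannianVolume :
    (riemannianVolume n M).IsOpenPosMeasure := by
  refine ⟨fun U hU ⟨x, hx⟩ h0 ↦ ?_⟩
  have hV : IsOpen ((𝔠 x).source ∩ U) := (𝔠 x).open_source.inter hU
  have h1 : riemannianVolume n M ((𝔠 x).source ∩ U) = 0 :=
    measure_mono_null Set.inter_subset_right h0
  rw [riemannianVolume_eq_chartVolume x Set.inter_subset_left,
    chartVolume_apply x hV.measurableSet] at h1
  have hW : IsOpen ((𝔠 x).target ∩ (𝔠 x).symm ⁻¹' ((𝔠 x).source ∩ U)) :=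
    (𝔠 x).symm.isOpen_inter_preimage hV
  have hWne : ((𝔠 x).target ∩ (𝔠 x).symm ⁻¹' ((𝔠 x).source ∩ U)).Nonempty := by
    refine ⟨𝔠 x x, mem_chart_target 𝔼 x, ?_⟩
    simp [hx]
  have hd : AEMeasurable (fun y ↦ ENNReal.ofReal (volumeDensity x y))
      ((volume : Measure 𝔼).restrict ((𝔠 x).target ∩ (𝔠 x).symm ⁻¹' ((𝔠 x).source ∩ U))) :=
    (((contDiffOn_volumeDensity x).continuousOn.mono Set.inter_subset_left).aemeasurable
      hW.measurableSet).ennreal_ofReal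
  rw [lintegral_eq_zero_iff' hd] at h1
  have h2 : ∀ᵐ y ∂((volume : Measure 𝔼).restrict
      ((𝔠 x).target ∩ (𝔠 x).symm ⁻¹' ((𝔠 x).source ∩ U))), False := by
    filter_upwards [h1, ae_restrict_mem hW.measurableSet] with y hy hyW
    have := volumeDensity_pos hyW.1
    simp only [Pi.zero_apply, ENNReal.ofReal_eq_zero] at hy
    exact absurd hy (not_le.2 this)
  rw [Filter.eventually_false_iff_eq_bot, ae_eq_bot, Measure.restrict_eq_zero] at h2
  exact (hW.measure_pos volume hWne).ne' h2

end Volume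

/-! ### Lipschitz functions and integration by parts in Euclidean space -/

section Euclidean

open Filter Topology

/-- `f` is Lipschitz on some neighbourhood of `y`. -/
def LipschitzAround {X Y : Type*} [PseudoEMetricSpace X] [PseudoEMetricSpace Y] (f : X → Y)
    (y : X) : Prop :=
  ∃ K, ∃ t ∈ 𝓝 y, LipschitzOnWith K f t

theorem LipschitzAround.congr {X Y : Type*} [PseudoEMetricSpace X] [PseudoEMetricSpace Y]
    {f g : X → Y} {y : X} (hf : LipschitzAround f y) (h : f =ᶠ[𝓝 y] g) : LipschitzAround g y := by
  obtain ⟨K, t, ht, hK⟩ := hf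
  refine ⟨K, t ∩ {z | f z = g z}, inter_mem ht h, fun a ha b hb ↦ ?_⟩
  rw [← ha.2, ← hb.2]
  exact hK ha.1 hb.1

theorem LipschitzAround.continuousAt {X Y : Type*} [PseudoEMetricSpace X] [PseudoEMetricSpace Y]
    {f : X → Y} {y : X} (hf : LipschitzAround f y) : ContinuousAt f y := by
  obtain ⟨K, t, ht, hK⟩ := hf
  exact hK.continuousOn.continuousAt ht

theorem LipschitzAround.prodMk {X Y Z : Type*} [PseudoEMetricSpace X] [PseudoEMetricSpace Y]
    [PseudoEMetricSpace Z] {f : X → Y} {g : X → Z} {y : X} (hf : LipschitzAround f y)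
    (hg : LipschitzAround g y) : LipschitzAround (fun z ↦ (f z, g z)) y := by
  obtain ⟨K, t, ht, hK⟩ := hf
  obtain ⟨L, s, hs, hL⟩ := hg
  exact ⟨_, t ∩ s, inter_mem ht hs, (hK.mono Set.inter_subset_left).prodMk
    (hL.mono Set.inter_subset_right)⟩

theorem LipschitzAround.comp {X Y Z : Type*} [PseudoEMetricSpace X] [PseudoEMetricSpace Y]
    [PseudoEMetricSpace Z] {g : Y → Z} {f : X → Y} {y : X} (hg : LipschitzAround g (f y))
    (hf : LipschitzAround f y) : LipschitzAround (g ∘ f) y := by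
  have hc := hf.continuousAt
  obtain ⟨K, t, ht, hK⟩ := hf
  obtain ⟨L, s, hs, hL⟩ := hg
  exact ⟨_, t ∩ f ⁻¹' s, inter_mem ht (hc hs),
    hL.comp (hK.mono Set.inter_subset_left) fun z hz ↦ hz.2⟩

theorem _root_.ContDiffAt.lipschitzAround {X Y : Type*} [NormedAddCommGroup X] [NormedSpace ℝ X]
    [NormedAddCommGroup Y] [NormedSpace ℝ Y] {f : X → Y} {y : X} (hf : ContDiffAt ℝ 1 f y) :
    LipschitzAround f y :=
  hf.exists_lipschitzOnWith

/-- Compactness gives one Lipschitz constant on the closed 1-neighbourhood of the support. For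
points at distance more than 1, the oscillation `2 * m` of the bounded function is itself a
Lipschitz bound. -/
theorem lipschitzWith_of_lipschitzAround {E : Type*} [NormedAddCommGroup E]
    [NormedSpace ℝ E] [FiniteDimensional ℝ E] {f : E → ℝ} (hf : ∀ y, LipschitzAround f y)
    (hc : HasCompactSupport f) : ∃ K, LipschitzWith K f := by
  have hcont : Continuous f := continuous_iff_continuousAt.2 fun y ↦ (hf y).continuousAt
  have hcomp : IsCompact (Metric.cthickening 1 (tsupport f)) := hc.isCompact.cthickening
  have hll : LocallyLipschitz f := fun y ↦ hf y
  obtain ⟨K, hK⟩ := (hll.locallyLipschitzOn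
    (s := Metric.cthickening 1 (tsupport f))).exists_lipschitzOnWith_of_compact hcomp
  obtain ⟨m, hm⟩ := hc.exists_bound_of_continuous hcont
  have hm0 : 0 ≤ m := (norm_nonneg _).trans (hm 0)
  have hsub : tsupport f ⊆ Metric.cthickening 1 (tsupport f) := Metric.self_subset_cthickening _
  have key : ∀ x ∈ tsupport f, ∀ y, dist (f x) (f y) ≤ max K (2 * m).toNNReal * dist x y := by
    intro x hx y
    by_cases hy : dist x y ≤ 1
    · have hy' : y ∈ Metric.cthickening 1 (tsupport f) :=
        Metric.mem_cthickening_of_dist_le y x 1 _ hx (by rwa [dist_comm])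
      refine (hK.dist_le_mul x (hsub hx) y hy').trans ?_
      gcongr
      exact le_max_left _ _
    · have h1 : dist (f x) (f y) ≤ 2 * m := by
        rw [Real.dist_eq]
        have := norm_sub_le (f x) (f y)
        rw [Real.norm_eq_abs] at this
        linarith [hm x, hm y]
      have h2 : 2 * m ≤ max (K : ℝ) ((2 * m).toNNReal : ℝ) :=
        (Real.le_coe_toNNReal _).trans (le_max_right _ _)
      rw [NNReal.coe_max]
      nlinarith [not_le.1 hy]
  refine ⟨max K (2 * m).toNNReal, LipschitzWith.of_dist_le_mul fun x y ↦ ?_⟩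
  push_cast
  by_cases hx : x ∈ tsupport f
  · exact key x hx y
  by_cases hy : y ∈ tsupport f
  · rw [dist_comm, dist_comm x y]
    exact key y hy x
  · rw [image_eq_zero_of_notMem_tsupport hx, image_eq_zero_of_notMem_tsupport hy]
    simp only [dist_self]
    positivity

variable {n : ℕ}

local notation "𝔼" => EuclideanSpace ℝ (Fin n)

theorem exists_smooth_cutoff {K U : Set 𝔼} (hK : IsCompact K) (hU : IsOpen U) (hKU : K ⊆ U) :
    ∃ θ : 𝔼 → ℝ, ContDiff ℝ ∞ θ ∧ HasCompactSupport θ ∧ tsupport θ ⊆ U ∧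
      ∀ᶠ y in 𝓝ˢ K, θ y = 1 := by
  obtain ⟨L, hL, hKL, hLU⟩ := exists_compact_between hK hU hKU
  obtain ⟨θ, h1, h0, -⟩ := exists_contMDiffMap_one_nhds_of_subset_interior (𝓘(ℝ, 𝔼)) (n := ⊤)
    hK.isClosed hKL
  have hs : tsupport θ ⊆ L := by
    refine closure_minimal (fun y hy ↦ ?_) hL.isClosed
    by_contra hyL
    exact hy (h0 y hyL)
  exact ⟨θ, θ.contMDiff.contDiff, HasCompactSupport.of_support_subset_isCompact hL
    ((subset_tsupport _).trans hs), hs.trans hLU, h1⟩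

theorem fderiv_apply_eq_zero_of_notMem_tsupport {f : 𝔼 → ℝ} {y : 𝔼} (hy : y ∉ tsupport f)
    (v : 𝔼) : fderiv ℝ f y v = 0 := by
  have h : f =ᶠ[𝓝 y] fun _ ↦ 0 := by
    filter_upwards [(isClosed_tsupport f).isOpen_compl.mem_nhds hy] with z hz
    exact image_eq_zero_of_notMem_tsupport hz
  rw [h.fderiv_eq]
  simp

/-- Integration by parts of a compactly supported Lipschitz function against the divergence of a
vector field that is `C¹` near the support. -/
theorem integral_mul_divergence_eq {f : 𝔼 → ℝ} {K : NNReal} (hf : LipschitzWith K f)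
    (hfc : HasCompactSupport f) {V : Set 𝔼} (hV : IsOpen V) (hfV : tsupport f ⊆ V)
    {H : Fin n → 𝔼 → ℝ} (hH : ∀ i, ContDiffOn ℝ 1 (H i) V) :
    ∫ y, f y * ∑ i, fderiv ℝ (H i) y (EuclideanSpace.single i (1 : ℝ)) =
      -∫ y, ∑ i, fderiv ℝ f y (EuclideanSpace.single i (1 : ℝ)) * H i y := by
  -- The cutoff makes the field `C¹` with compact support on the whole space and leaves it unchanged
  -- near the support of `f`, so neither integrand changes.
  obtain ⟨θ, hθ, hθc, hθV, hθ1⟩ := exists_smooth_cutoff hfc.isCompact hV hfV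
  set G : Fin n → 𝔼 → ℝ := fun i y ↦ θ y * H i y with hG
  have hGc : ∀ i, HasCompactSupport (G i) := fun i ↦ hθc.mul_right
  have hGs : ∀ i, ContDiff ℝ 1 (G i) := by
    intro i
    refine contDiff_iff_contDiffAt.2 fun y ↦ ?_
    by_cases hy : y ∈ tsupport θ
    · exact (hθ.contDiffAt.of_le (by simp)).mul ((hH i).contDiffAt (hV.mem_nhds (hθV hy)))
    · have h0 : G i =ᶠ[𝓝 y] fun _ ↦ 0 := by
        filter_upwards [(isClosed_tsupport θ).isOpen_compl.mem_nhds hy] with z hz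
        simp [hG, image_eq_zero_of_notMem_tsupport hz]
      exact contDiffAt_const.congr_of_eventuallyEq h0
  have hGH : ∀ i, ∀ y ∈ tsupport f, G i =ᶠ[𝓝 y] H i := by
    intro i y hy
    filter_upwards [eventually_nhdsSet_iff_forall.1 hθ1 y hy] with z hz
    simp [hG, hz]
  have hA : ∀ y, f y * ∑ i, fderiv ℝ (H i) y (EuclideanSpace.single i (1 : ℝ)) =
      ∑ i, f y * fderiv ℝ (G i) y (EuclideanSpace.single i (1 : ℝ)) := by
    intro y
    rw [Finset.mul_sum]
    refine Finset.sum_congr rfl fun i _ ↦ ?_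
    by_cases hy : y ∈ tsupport f
    · rw [(hGH i y hy).fderiv_eq]
    · simp [image_eq_zero_of_notMem_tsupport hy]
  have hB : ∀ y, ∑ i, fderiv ℝ f y (EuclideanSpace.single i (1 : ℝ)) * H i y =
      ∑ i, fderiv ℝ f y (EuclideanSpace.single i (1 : ℝ)) * G i y := by
    intro y
    refine Finset.sum_congr rfl fun i _ ↦ ?_
    by_cases hy : y ∈ tsupport f
    · rw [(hGH i y hy).eq_of_nhds]
    · simp [fderiv_apply_eq_zero_of_notMem_tsupport hy]
  have hAi : ∀ i, Integrable fun y ↦ f y * fderiv ℝ (G i) y (EuclideanSpace.single i (1 : ℝ)) := by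
    intro i
    refine Continuous.integrable_of_hasCompactSupport ?_ hfc.mul_right
    exact hf.continuous.mul (((hGs i).continuous_fderiv one_ne_zero).clm_apply continuous_const)
  have hBi : ∀ i, Integrable fun y ↦
      fderiv ℝ f y (EuclideanSpace.single i (1 : ℝ)) * G i y := by
    intro i
    have h1 : Integrable (G i) := (hGs i).continuous.integrable_of_hasCompactSupport (hGc i)
    refine h1.bdd_mul (c := K) (measurable_fderiv_apply_const ℝ f _).aestronglyMeasurable ?_
    refine Eventually.of_forall fun y ↦ ?_
    refine ((fderiv ℝ f y).le_opNorm _).trans ?_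
    simpa using norm_fderiv_le_of_lipschitz ℝ hf
  simp_rw [hA, hB]
  rw [integral_finsetSum _ fun i _ ↦ hAi i, integral_finsetSum _ fun i _ ↦ hBi i,
    ← Finset.sum_neg_distrib]
  refine Finset.sum_congr rfl fun i _ ↦ ?_
  obtain ⟨D, hD⟩ := (hGs i).lipschitzWith_of_hasCompactSupport (hGc i) one_ne_zero
  have h := hf.integral_lineDeriv_mul_eq hD (hGc i) (μ := volume)
    (EuclideanSpace.single i (1 : ℝ))
  -- Rademacher's theorem identifies line derivatives with the Fréchet derivative almost everywhere.
  have h1 : ∫ y, lineDeriv ℝ f y (EuclideanSpace.single i (1 : ℝ)) * G i y =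
      ∫ y, fderiv ℝ f y (EuclideanSpace.single i (1 : ℝ)) * G i y := by
    refine integral_congr_ae ?_
    filter_upwards [hf.ae_differentiableAt] with y hy
    rw [hy.lineDeriv_eq_fderiv]
  rw [← h1, h, ← integral_neg]
  refine integral_congr_ae (Eventually.of_forall fun y ↦ ?_)
  simp only
  rw [((hGs i).differentiable one_ne_zero).differentiableAt.lineDeriv_eq_fderiv, map_neg]
  ring

end Euclidean

/-! ### Green's formula in a chart and chart independence of the Laplacian -/

section ChartGreen

open Filter Topology

variable {n : ℕ} {M : Type*} [MetricSpace M] [ChartedSpace (EuclideanSpace ℝ (Fin n)) M]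

local notation "𝔼" => EuclideanSpace ℝ (Fin n)
local notation "𝔠" => chartAt (EuclideanSpace ℝ (Fin n))

/-- The expression of `f` in the preferred chart around `x`, extended by zero. -/
def chartExt (n : ℕ) {M : Type*} [MetricSpace M] [ChartedSpace (EuclideanSpace ℝ (Fin n)) M]
    (f : M → ℝ) (x : M) :
    EuclideanSpace ℝ (Fin n) → ℝ :=
  (chartAt (EuclideanSpace ℝ (Fin n)) x).target.indicator (f ∘ (chartAt (EuclideanSpace ℝ (Fin n)) x).symm)

theorem chartExt_eventuallyEq (f : M → ℝ) {x : M} {y : 𝔼} (hy : y ∈ (𝔠 x).target) :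
    chartExt n f x =ᶠ[𝓝 y] f ∘ (𝔠 x).symm := by
  filter_upwards [(𝔠 x).open_target.mem_nhds hy] with z hz
  exact Set.indicator_of_mem hz _

theorem isCompact_chart_image {f : M → ℝ} {x : M} (hfc : HasCompactSupport f)
    (hfs : tsupport f ⊆ (𝔠 x).source) : IsCompact (𝔠 x '' tsupport f) :=
  hfc.isCompact.image_of_continuousOn ((𝔠 x).continuousOn.mono hfs)

theorem tsupport_chartExt_subset {f : M → ℝ} {x : M} (hfc : HasCompactSupport f)
    (hfs : tsupport f ⊆ (𝔠 x).source) : tsupport (chartExt n f x) ⊆ 𝔠 x '' tsupport f := by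
  refine closure_minimal (fun y hy ↦ ?_) (isCompact_chart_image hfc hfs).isClosed
  have hyt : y ∈ (𝔠 x).target := Set.mem_of_indicator_ne_zero hy
  refine ⟨(𝔠 x).symm y, subset_tsupport _ ?_, (𝔠 x).right_inv hyt⟩
  have h : chartExt n f x y ≠ 0 := hy
  rwa [chartExt, Set.indicator_of_mem hyt] at h

theorem tsupport_chartExt_subset_target {f : M → ℝ} {x : M} (hfc : HasCompactSupport f)
    (hfs : tsupport f ⊆ (𝔠 x).source) : tsupport (chartExt n f x) ⊆ (𝔠 x).target := by
  refine (tsupport_chartExt_subset hfc hfs).trans ?_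
  rintro _ ⟨p, hp, rfl⟩
  exact (𝔠 x).map_source (hfs hp)

theorem hasCompactSupport_chartExt {f : M → ℝ} {x : M} (hfc : HasCompactSupport f)
    (hfs : tsupport f ⊆ (𝔠 x).source) : HasCompactSupport (chartExt n f x) :=
  HasCompactSupport.of_support_subset_isCompact (isCompact_chart_image hfc hfs)
    ((subset_tsupport _).trans (tsupport_chartExt_subset hfc hfs))

theorem exists_lipschitzWith_chartExt {f : M → ℝ} {x : M}
    (hf : ∀ y ∈ (𝔠 x).target, LipschitzAround (f ∘ (𝔠 x).symm) y) (hfc : HasCompactSupport f)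
    (hfs : tsupport f ⊆ (𝔠 x).source) : ∃ K, LipschitzWith K (chartExt n f x) := by
  refine lipschitzWith_of_lipschitzAround (fun y ↦ ?_) (hasCompactSupport_chartExt hfc hfs)
  by_cases hy : y ∈ (𝔠 x).target
  · exact (hf y hy).congr (chartExt_eventuallyEq f hy).symm
  · have hy' : y ∉ tsupport (chartExt n f x) := fun h ↦ hy (tsupport_chartExt_subset_target hfc hfs h)
    have h0 : (fun _ ↦ 0) =ᶠ[𝓝 y] chartExt n f x := by
      filter_upwards [(isClosed_tsupport (chartExt n f x)).isOpen_compl.mem_nhds hy'] with z hz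
      exact (image_eq_zero_of_notMem_tsupport hz).symm
    exact (contDiffAt_const (c := (0 : ℝ))).lipschitzAround.congr h0

theorem mfderiv_eq_zero_of_notMem_tsupport {f : M → ℝ} {p : M} (hp : p ∉ tsupport f) :
    mfderiv (𝓡 n) 𝓘(ℝ, ℝ) f p = 0 := by
  have h : f =ᶠ[𝓝 p] fun _ ↦ 0 := by
    filter_upwards [(isClosed_tsupport f).isOpen_compl.mem_nhds hp] with z hz
    exact image_eq_zero_of_notMem_tsupport hz
  rw [h.mfderiv_eq, mfderiv_const]
  rfl

variable [IsManifold (𝓡 n) ∞ M] [RiemannianBundle (fun p : M ↦ TangentSpace (𝓡 n) p)]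

theorem grad_eq_zero_of_notMem_tsupport {f : M → ℝ} {p : M} (hp : p ∉ tsupport f) :
    grad n f p = 0 := by
  have h := mfderiv_eq_zero_of_notMem_tsupport (n := n) hp
  unfold grad
  rw [h]
  exact map_zero _

/-- The Laplace–Beltrami operator computed in the preferred chart around `x`. -/
def chartLaplacian (n : ℕ) {M : Type*} [MetricSpace M] [ChartedSpace (EuclideanSpace ℝ (Fin n)) M]
    [IsManifold (𝓡 n) ∞ M] [RiemannianBundle (fun p : M ↦ TangentSpace (𝓡 n) p)]
    (h : M → ℝ) (x p : M) : ℝ :=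
  (volumeDensity x (chartAt (EuclideanSpace ℝ (Fin n)) x p))⁻¹ * ∑ i : Fin n,
    fderiv ℝ (fun y ↦ volumeDensity x y * chartGrad h x y i) (chartAt (EuclideanSpace ℝ (Fin n)) x p)
      (EuclideanSpace.single i (1 : ℝ))

theorem laplacian_eq_chartLaplacian_self (h : M → ℝ) (p : M) :
    laplacian n h p = chartLaplacian n h p p := by
  unfold laplacian divergence chartLaplacian
  congr 1
  refine Finset.sum_congr rfl fun i _ ↦ ?_
  have he : (fun y ↦ volumeDensity p y * coordComponent (grad n h) p y i) =ᶠ[𝓝 (𝔠 p p)]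
      fun y ↦ volumeDensity p y * chartGrad h p y i := by
    filter_upwards [(𝔠 p).open_target.mem_nhds (mem_chart_target 𝔼 p)] with y hy
    rw [coordComponent_grad h hy]
  rw [he.fderiv_eq]

theorem chartGrad_eq_zero_of_notMem_tsupport {h : M → ℝ} {x : M} {y : 𝔼}
    (hy : y ∈ (𝔠 x).target) (hp : (𝔠 x).symm y ∉ tsupport h) : chartGrad h x y = 0 := by
  have h1 := grad_eq_mfderiv_chartGrad h hy
  rw [grad_eq_zero_of_notMem_tsupport hp] at h1
  have h2 := mfderiv_chart_mfderiv_symm hy (chartGrad h x y)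
  rw [← h1] at h2
  exact h2.symm.trans (map_zero _)

theorem chartLaplacian_eq_zero_of_notMem_tsupport {h : M → ℝ} {x p : M} (hx : p ∈ (𝔠 x).source)
    (hp : p ∉ tsupport h) : chartLaplacian n h x p = 0 := by
  unfold chartLaplacian
  refine mul_eq_zero_of_right _ (Finset.sum_eq_zero fun i _ ↦ ?_)
  have he : (fun y ↦ volumeDensity x y * chartGrad h x y i) =ᶠ[𝓝 (𝔠 x p)] fun _ ↦ 0 := by
    have ho : IsOpen ((𝔠 x).target ∩ (𝔠 x).symm ⁻¹' (tsupport h)ᶜ) :=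
      (𝔠 x).symm.isOpen_inter_preimage (isClosed_tsupport h).isOpen_compl
    filter_upwards [ho.mem_nhds ⟨(𝔠 x).map_source hx, by
      simpa [(𝔠 x).left_inv hx] using hp⟩] with y hy
    rw [chartGrad_eq_zero_of_notMem_tsupport hy.1 hy.2]
    simp
  rw [he.fderiv_eq]
  simp

theorem laplacian_eq_zero_of_notMem_tsupport {h : M → ℝ} {p : M} (hp : p ∉ tsupport h) :
    laplacian n h p = 0 := by
  rw [laplacian_eq_chartLaplacian_self,
    chartLaplacian_eq_zero_of_notMem_tsupport (mem_chart_source 𝔼 p) hp]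

variable [IsContMDiffRiemannianBundle (𝓡 n) ∞ (EuclideanSpace ℝ (Fin n))
      (fun p : M ↦ TangentSpace (𝓡 n) p)]

theorem continuousOn_chartLaplacian {h : M → ℝ} (hh : ContMDiff (𝓡 n) 𝓘(ℝ, ℝ) ∞ h) (x : M) :
    ContinuousOn (chartLaplacian n h x) (𝔠 x).source := by
  have h1 : ContinuousOn (fun y ↦ (volumeDensity x y)⁻¹ * ∑ i : Fin n,
      fderiv ℝ (fun y ↦ volumeDensity x y * chartGrad h x y i) y
        (EuclideanSpace.single i (1 : ℝ))) (𝔠 x).target := by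
    refine ((contDiffOn_volumeDensity x).continuousOn.inv₀ fun y hy ↦
      (volumeDensity_pos hy).ne').mul (continuousOn_finsetSum _ fun i _ ↦ ?_)
    exact (((contDiffOn_volumeDensity x).mul (contDiffOn_chartGrad hh x i)).continuousOn_fderiv_of_isOpen
      (𝔠 x).open_target (by simp)).clm_apply continuousOn_const
  exact h1.comp (𝔠 x).continuousOn fun p hp ↦ (𝔠 x).map_source hp

variable [MeasurableSpace M] [BorelSpace M]

/-- Green's formula in a chart. -/
theorem integral_mul_chartLaplacian {f h : M → ℝ} {x : M}
    (hf : ∀ y ∈ (𝔠 x).target, LipschitzAround (f ∘ (𝔠 x).symm) y) (hfc : HasCompactSupport f)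
    (hfs : tsupport f ⊆ (𝔠 x).source) (hh : ContMDiff (𝓡 n) 𝓘(ℝ, ℝ) ∞ h) :
    ∫ p, f p * chartLaplacian n h x p ∂(riemannianVolume n M) =
      -∫ p, ⟪grad n f p, grad n h p⟫_ℝ ∂(riemannianVolume n M) := by
  obtain ⟨K, hK⟩ := exists_lipschitzWith_chartExt hf hfc hfs
  -- The field is `√(det g)` times the gradient, so its Euclidean divergence is `√(det g)` times the
  -- Laplacian: the density of the volume is absorbed on both sides.
  have hF := integral_mul_divergence_eq hK (hasCompactSupport_chartExt hfc hfs)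
    (𝔠 x).open_target (tsupport_chartExt_subset_target hfc hfs)
    (H := fun i y ↦ volumeDensity x y * chartGrad h x y i)
    (fun i ↦ ((contDiffOn_volumeDensity x).mul (contDiffOn_chartGrad hh x i)).of_le (by simp))
  have hoff : ∀ y ∉ (𝔠 x).target, y ∉ tsupport (chartExt n f x) :=
    fun y hy h' ↦ hy (tsupport_chartExt_subset_target hfc hfs h')
  rw [integral_riemannianVolume_eq_chart x, integral_riemannianVolume_eq_chart x]
  · have hL := setIntegral_eq_integral_of_forall_compl_eq_zero (μ := volume) (s := (𝔠 x).target)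
      (f := fun y ↦ chartExt n f x y * ∑ i, fderiv ℝ (fun y ↦ volumeDensity x y *
        chartGrad h x y i) y (EuclideanSpace.single i (1 : ℝ))) fun y hy ↦ by
      rw [image_eq_zero_of_notMem_tsupport (hoff y hy), zero_mul]
    have hR := setIntegral_eq_integral_of_forall_compl_eq_zero (μ := volume) (s := (𝔠 x).target)
      (f := fun y ↦ ∑ i, fderiv ℝ (chartExt n f x) y (EuclideanSpace.single i (1 : ℝ)) *
        (volumeDensity x y * chartGrad h x y i)) fun y hy ↦
      Finset.sum_eq_zero fun i _ ↦ by
        rw [fderiv_apply_eq_zero_of_notMem_tsupport (hoff y hy), zero_mul]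
    rw [← hL, ← hR] at hF
    convert hF using 1
    · refine setIntegral_congr_fun (𝔠 x).open_target.measurableSet fun y hy ↦ ?_
      simp only [chartLaplacian, (𝔠 x).right_inv hy]
      rw [(chartExt_eventuallyEq f hy).eq_of_nhds]
      simp only [Function.comp]
      field_simp [(volumeDensity_pos hy).ne']
    · congr 1
      refine setIntegral_congr_fun (𝔠 x).open_target.measurableSet fun y hy ↦ ?_
      simp only
      rw [inner_grad_grad f h hy, (chartExt_eventuallyEq f hy).fderiv_eq]
      conv_lhs => rw [eq_sum_single (chartGrad h x y)]
      simp only [map_sum, map_smul, smul_eq_mul, Finset.mul_sum]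
      exact Finset.sum_congr rfl fun i _ ↦ by ring
  · intro p hp
    rw [grad_eq_zero_of_notMem_tsupport fun h' ↦ hp (hfs h'), inner_zero_left]
  · intro p hp
    rw [image_eq_zero_of_notMem_tsupport fun h' ↦ hp (hfs h'), zero_mul]

theorem lipschitzAround_comp_chart_symm {f : M → ℝ} (hf : ContMDiff (𝓡 n) 𝓘(ℝ, ℝ) 1 f) (x : M) :
    ∀ y ∈ (𝔠 x).target, LipschitzAround (f ∘ (𝔠 x).symm) y := by
  intro y hy
  have h1 : ContMDiffOn (𝓡 n) (𝓡 n) ∞ (𝔠 x).symm (𝔠 x).target := contMDiffOn_chart_symm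
  have h2 := (hf.comp_contMDiffOn (h1.of_le (by simp))).contDiffOn
  exact (h2.contDiffAt ((𝔠 x).open_target.mem_nhds hy)).lipschitzAround

/-- No transformation law is computed. Against test functions supported in the overlap, both sides
satisfy Green's formula with the same chart-free right side; hence they agree almost everywhere, and
everywhere by continuity. -/
theorem chartLaplacian_eq_chartLaplacian [SecondCountableTopology M] {h : M → ℝ}
    (hh : ContMDiff (𝓡 n) 𝓘(ℝ, ℝ) ∞ h) (x z : M) :
    Set.EqOn (chartLaplacian n h x) (chartLaplacian n h z) ((𝔠 x).source ∩ (𝔠 z).source) := by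
  have := ChartedSpace.locallyCompactSpace 𝔼 M
  have := isLocallyFiniteMeasure_riemannianVolume (n := n) (M := M)
  have := isOpenPosMeasure_riemannianVolume (n := n) (M := M)
  have hO : IsOpen ((𝔠 x).source ∩ (𝔠 z).source) := (𝔠 x).open_source.inter (𝔠 z).open_source
  have hcx := (continuousOn_chartLaplacian hh x).mono
    (Set.inter_subset_left (t := (𝔠 z).source))
  have hcz := (continuousOn_chartLaplacian hh z).mono
    (Set.inter_subset_right (s := (𝔠 x).source))
  have hae := hO.ae_eq_zero_of_integral_contMDiff_smul_eq_zero (𝓡 n)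
    (μ := riemannianVolume n M) (f := fun p ↦ chartLaplacian n h x p - chartLaplacian n h z p)
    ((hcx.sub hcz).locallyIntegrableOn hO.measurableSet) (by
      intro g hg hgc hgs
      have hgL := fun w : M ↦ lipschitzAround_comp_chart_symm (hg.of_le (by simp)) w
      have hx := integral_mul_chartLaplacian (hgL x) hgc (hgs.trans Set.inter_subset_left) hh
      have hz := integral_mul_chartLaplacian (hgL z) hgc (hgs.trans Set.inter_subset_right) hh
      have hint : ∀ w : M, (𝔠 x).source ∩ (𝔠 z).source ⊆ (𝔠 w).source →
          Integrable (fun p ↦ g p * chartLaplacian n h w p) (riemannianVolume n M) := by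
        intro w hw
        refine Continuous.integrable_of_hasCompactSupport ?_ hgc.mul_right
        refine continuous_iff_continuousAt.2 fun p ↦ ?_
        by_cases hp : p ∈ tsupport g
        · exact hg.continuous.continuousAt.mul ((continuousOn_chartLaplacian hh w).continuousAt
            ((𝔠 w).open_source.mem_nhds (hw (hgs hp))))
        · have h0 : (fun p ↦ g p * chartLaplacian n h w p) =ᶠ[𝓝 p] fun _ ↦ 0 := by
            filter_upwards [(isClosed_tsupport g).isOpen_compl.mem_nhds hp] with q hq
            rw [image_eq_zero_of_notMem_tsupport hq, zero_mul]
          exact continuousAt_const.congr h0.symm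
      simp only [smul_eq_mul, mul_sub]
      rw [integral_sub (hint x Set.inter_subset_left) (hint z Set.inter_subset_right), hx, hz,
        sub_self])
  refine Measure.eqOn_open_of_ae_eq (μ := riemannianVolume n M) ?_ hO hcx hcz
  rw [EventuallyEq, ae_restrict_iff' hO.measurableSet]
  filter_upwards [hae] with p hp hpO
  exact sub_eq_zero.1 (hp hpO)

theorem laplacian_eq_chartLaplacian [SecondCountableTopology M] {h : M → ℝ}
    (hh : ContMDiff (𝓡 n) 𝓘(ℝ, ℝ) ∞ h) {x p : M} (hp : p ∈ (𝔠 x).source) :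
    laplacian n h p = chartLaplacian n h x p := by
  rw [laplacian_eq_chartLaplacian_self]
  exact chartLaplacian_eq_chartLaplacian hh p x ⟨mem_chart_source 𝔼 p, hp⟩

/-- The definition uses a different chart at each point; chart independence allows a single chart
near `x`. -/
theorem continuous_laplacian [SecondCountableTopology M] {h : M → ℝ}
    (hh : ContMDiff (𝓡 n) 𝓘(ℝ, ℝ) ∞ h) : Continuous (laplacian n h) := by
  refine continuous_iff_continuousAt.2 fun x ↦ ?_
  have hx := (𝔠 x).open_source.mem_nhds (mem_chart_source 𝔼 x)
  refine ((continuousOn_chartLaplacian hh x).continuousAt hx).congr ?_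
  filter_upwards [hx] with p hp
  exact (laplacian_eq_chartLaplacian hh hp).symm

/-- Green's formula for a Lipschitz function supported in the domain of a chart. -/
theorem integral_mul_laplacian_of_tsupport_subset_source [SecondCountableTopology M]
    {f h : M → ℝ} {x : M}
    (hf : ∀ y ∈ (𝔠 x).target, LipschitzAround (f ∘ (𝔠 x).symm) y) (hfc : HasCompactSupport f)
    (hfs : tsupport f ⊆ (𝔠 x).source) (hh : ContMDiff (𝓡 n) 𝓘(ℝ, ℝ) ∞ h) :
    ∫ p, f p * laplacian n h p ∂(riemannianVolume n M) =
      -∫ p, ⟪grad n f p, grad n h p⟫_ℝ ∂(riemannianVolume n M) := by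
  rw [← integral_mul_chartLaplacian hf hfc hfs hh]
  congr 1
  ext p
  by_cases hp : p ∈ tsupport f
  · rw [laplacian_eq_chartLaplacian hh (hfs hp)]
  · rw [image_eq_zero_of_notMem_tsupport hp, zero_mul, zero_mul]

end ChartGreen

/-! ### Mollification of Lipschitz functions -/

section Mollification

open Filter Topology
open scoped Convolution

variable {n : ℕ}

local notation "𝔼" => EuclideanSpace ℝ (Fin n)

theorem abs_convolution_normed_le (η : ContDiffBump (0 : 𝔼)) {f : 𝔼 → ℝ} {y : 𝔼} {c : ℝ}
    (hf : ∀ t, |f (y - t)| ≤ c) :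
    |∫ t, η.normed volume t * f (y - t)| ≤ c := by
  have h := norm_integral_le_of_norm_le (f := fun t ↦ η.normed volume t * f (y - t))
    (g := fun t ↦ η.normed volume t * c) (η.integrable_normed.mul_const c)
    (Eventually.of_forall fun t ↦ by
      rw [norm_mul, Real.norm_of_nonneg (η.nonneg_normed t)]
      exact mul_le_mul_of_nonneg_left (hf t) (η.nonneg_normed t))
  rwa [integral_mul_const, η.integral_normed, one_mul] at h

/-- A translation moves the increment from the kernel to `f`, so difference quotients of the
mollification are mollified difference quotients of `f`. By Rademacher's theorem the limit is the
mollified almost everywhere derivative. -/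
theorem fderiv_convolution_normed (η : ContDiffBump (0 : 𝔼)) {f : 𝔼 → ℝ} {K : NNReal}
    (hf : LipschitzWith K f)
    (hu : Differentiable ℝ (η.normed volume ⋆[ContinuousLinearMap.lsmul ℝ ℝ, volume] f))
    (y v : 𝔼) :
    fderiv ℝ (η.normed volume ⋆[ContinuousLinearMap.lsmul ℝ ℝ, volume] f) y v =
      (η.normed volume ⋆[ContinuousLinearMap.lsmul ℝ ℝ, volume] fun z ↦ fderiv ℝ f z v) y := by
  set u := η.normed volume ⋆[ContinuousLinearMap.lsmul ℝ ℝ, volume] f with hu_def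
  set g : 𝔼 → ℝ := fun z ↦ η.normed volume (y - z) with hg
  have hgc : Continuous g := η.continuous_normed.comp (continuous_const.sub continuous_id)
  have hgs : HasCompactSupport g :=
    η.hasCompactSupport_normed.comp_homeomorph (Homeomorph.subLeft y)
  have hgi : Integrable g := hgc.integrable_of_hasCompactSupport hgs
  have hlim := hf.integral_inv_smul_sub_mul_tendsto_integral_lineDeriv_mul hgi v
  have hu' : ∀ w : 𝔼, u (y + w) = ∫ z, f (z + w) * g z := by
    intro w
    rw [hu_def, convolution_eq_swap,
      ← integral_add_right_eq_self (fun z ↦ (ContinuousLinearMap.lsmul ℝ ℝ)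
        (η.normed volume (y + w - z)) (f z)) w]
    refine integral_congr_ae (Eventually.of_forall fun z ↦ ?_)
    simp [hg, mul_comm]
  have hint : ∀ w : 𝔼, Integrable fun z ↦ f (z + w) * g z := fun w ↦
    ((hf.continuous.comp (continuous_id.add continuous_const)).mul
      hgc).integrable_of_hasCompactSupport hgs.mul_left
  have hquot : ∀ t : ℝ, ∫ x, (t⁻¹ • (f (x + t • v) - f x)) * g x = t⁻¹ • (u (y + t • v) - u y) := by
    intro t
    have h0 := hu' 0
    simp only [add_zero] at h0
    rw [hu', h0, ← integral_sub (hint _) (by simpa using hint 0), ← integral_smul]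
    refine integral_congr_ae (Eventually.of_forall fun z ↦ ?_)
    simp only [smul_eq_mul]
    ring
  simp_rw [hquot] at hlim
  have hd := ((hu y).hasFDerivAt.hasLineDerivAt v).tendsto_slope_zero_right
  rw [tendsto_nhds_unique hd hlim, convolution_eq_swap]
  refine integral_congr_ae ?_
  filter_upwards [hf.ae_differentiableAt (μ := volume)] with z hz
  simp [hz.lineDeriv_eq_fderiv, hg, mul_comm]

/-- A nonnegative compactly supported Lipschitz function is a limit of smooth nonnegative functions
with controlled supports, values and derivatives. -/
theorem exists_smooth_approx {f : 𝔼 → ℝ} {K : NNReal} (hf : LipschitzWith K f)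
    (hfc : HasCompactSupport f) (hf0 : ∀ y, 0 ≤ f y) {V : Set 𝔼} (hV : IsOpen V)
    (hfV : tsupport f ⊆ V) :
    ∃ (L : Set 𝔼) (B : ℝ) (u : ℕ → 𝔼 → ℝ), IsCompact L ∧ L ⊆ V ∧ tsupport f ⊆ L ∧
      (∀ k, ContDiff ℝ ∞ (u k)) ∧ (∀ k y, 0 ≤ u k y) ∧ (∀ k, tsupport (u k) ⊆ L) ∧
      (∀ k y, |u k y| ≤ B) ∧ (∀ k y, ‖fderiv ℝ (u k) y‖ ≤ K) ∧
      (∀ y, Tendsto (fun k ↦ u k y) atTop (𝓝 (f y))) ∧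
      ∀ᵐ y, ∀ i, Tendsto (fun k ↦ fderiv ℝ (u k) y (EuclideanSpace.single i (1 : ℝ))) atTop
        (𝓝 (fderiv ℝ f y (EuclideanSpace.single i (1 : ℝ)))) := by
  -- All mollification radii stay below `δ`, so a single compact subset of `V` contains every
  -- support.
  obtain ⟨δ, hδ, hδV⟩ := hfc.isCompact.exists_cthickening_subset_open hV hfV
  obtain ⟨B, hB⟩ := hfc.exists_bound_of_continuous hf.continuous
  have hk : ∀ k : ℕ, 0 < δ / (k + 1) := fun k ↦ by positivity
  -- The fixed ratio 2 between outer and inner radius is what the almost everywhere convergence of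
  -- mollified derivatives at Lebesgue points requires.
  let η : ℕ → ContDiffBump (0 : 𝔼) := fun k ↦
    ⟨δ / (k + 1) / 2, δ / (k + 1), half_pos (hk k), half_lt_self (hk k)⟩
  have hη0 : Tendsto (fun k ↦ (η k).rOut) atTop (𝓝 0) :=
    tendsto_const_nhds.div_atTop (tendsto_natCast_atTop_atTop.atTop_add tendsto_const_nhds)
  have hηδ : ∀ k, (η k).rOut ≤ δ := fun k ↦ div_le_self hδ.le (by simp)
  let u : ℕ → 𝔼 → ℝ := fun k ↦
    ((η k).normed volume ⋆[ContinuousLinearMap.lsmul ℝ ℝ, volume] f)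
  have hudef : ∀ k y, u k y = ∫ t, (η k).normed volume t * f (y - t) := fun k y ↦ rfl
  have hus : ∀ k, ContDiff ℝ ∞ (u k) := fun k ↦
    (η k).hasCompactSupport_normed.contDiff_convolution_left _ (η k).contDiff_normed
      hf.continuous.locallyIntegrable
  have hint : ∀ k y, Integrable fun t ↦ (η k).normed volume t * f (y - t) := fun k y ↦
    ((η k).continuous_normed.mul (hf.continuous.comp
      (continuous_const.sub continuous_id))).integrable_of_hasCompactSupport
        (η k).hasCompactSupport_normed.mul_right
  have hulip : ∀ k, LipschitzWith K (u k) := by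
    intro k
    refine LipschitzWith.of_dist_le_mul fun y z ↦ ?_
    rw [Real.dist_eq, hudef, hudef, ← integral_sub (hint k y) (hint k z)]
    have h := abs_convolution_normed_le (η k) (f := fun w ↦ f w - f (w + (z - y))) (y := y)
      (c := K * dist y z) (fun t ↦ by
        have := hf.dist_le_mul (y - t) (y - t + (z - y))
        rw [Real.dist_eq] at this
        refine this.trans_eq ?_
        simp [dist_eq_norm])
    refine le_of_eq_of_le ?_ h
    congr 2
    ext t
    rw [show y - t + (z - y) = z - t by abel]
    ring
  refine ⟨Metric.cthickening δ (tsupport f), B, u, hfc.isCompact.cthickening, hδV,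
    Metric.self_subset_cthickening _, hus, fun k y ↦ ?_, fun k ↦ ?_, fun k y ↦ ?_, fun k y ↦ ?_,
    fun y ↦ ?_, ?_⟩
  · exact integral_nonneg fun t ↦ mul_nonneg ((η k).nonneg_normed t) (hf0 _)
  · refine closure_minimal ?_ Metric.isClosed_cthickening
    refine (support_convolution_subset _).trans ?_
    rw [(η k).support_normed_eq]
    rintro _ ⟨a, ha, b, hb, rfl⟩
    refine Metric.mem_cthickening_of_dist_le _ b _ _ (subset_tsupport _ hb) ?_
    simp only [dist_eq_norm, add_sub_cancel_right]
    rw [mem_ball_zero_iff] at ha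
    exact ha.le.trans (hηδ k)
  · exact abs_convolution_normed_le (η k) fun t ↦ hB _
  · exact norm_fderiv_le_of_lipschitz ℝ (hulip k)
  · exact ContDiffBump.convolution_tendsto_right_of_continuous hη0 hf.continuous y
  · rw [ae_all_iff]
    intro i
    set d : 𝔼 → ℝ := fun z ↦ fderiv ℝ f z (EuclideanSpace.single i (1 : ℝ)) with hd
    have hdl : LocallyIntegrable d := by
      refine (locallyIntegrable_const (K : ℝ)).mono
        (measurable_fderiv_apply_const ℝ f _).aestronglyMeasurable ?_
      refine Eventually.of_forall fun y ↦ ((fderiv ℝ f y).le_opNorm _).trans ?_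
      simpa using norm_fderiv_le_of_lipschitz ℝ hf
    filter_upwards [ContDiffBump.ae_convolution_tendsto_right_of_locallyIntegrable (φ := η)
      (K := 2) hη0 (Eventually.of_forall fun k ↦ by
        change δ / (k + 1) ≤ 2 * (δ / (k + 1) / 2)
        linarith) hdl] with y hy
    refine hy.congr fun k ↦ ?_
    exact (fderiv_convolution_normed (η k) hf ((hus k).differentiable (by simp)) y _).symm

end Mollification

/-! ### The distributional inequality for Lipschitz test functions -/

section DistributionalInequality

open Filter Topology

variable {n : ℕ} {M : Type*} [MetricSpace M] [ChartedSpace (EuclideanSpace ℝ (Fin n)) M]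

local notation "𝔼" => EuclideanSpace ℝ (Fin n)
local notation "𝔠" => chartAt (EuclideanSpace ℝ (Fin n))

variable [IsManifold (𝓡 n) ∞ M]

variable (n) in
theorem exists_contMDiff_cutoff [SecondCountableTopology M] {K U : Set M} (hK : IsCompact K)
    (hU : IsOpen U) (hKU : K ⊆ U) :
    ∃ θ : M → ℝ, ContMDiff (𝓡 n) 𝓘(ℝ, ℝ) ∞ θ ∧ HasCompactSupport θ ∧ tsupport θ ⊆ U ∧
      (∀ p, θ p ∈ Set.Icc 0 1) ∧ ∀ᶠ y in 𝓝ˢ K, θ y = 1 := by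
  have := ChartedSpace.locallyCompactSpace 𝔼 M
  obtain ⟨L, hL, hKL, hLU⟩ := exists_compact_between hK hU hKU
  obtain ⟨θ, h1, h0, h01⟩ := exists_contMDiffMap_one_nhds_of_subset_interior (𝓡 n) (n := ⊤)
    hK.isClosed hKL
  have hs : tsupport θ ⊆ L := by
    refine closure_minimal (fun y hy ↦ ?_) hL.isClosed
    by_contra hyL
    exact hy (h0 y hyL)
  exact ⟨θ, θ.contMDiff, HasCompactSupport.of_support_subset_isCompact hL
    ((subset_tsupport _).trans hs), hs.trans hLU, h01, h1⟩

/-- The function on `M` given by `u` in the preferred chart around `x`, extended by zero. -/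
def chartPull {n : ℕ} {M : Type*} [MetricSpace M] [ChartedSpace (EuclideanSpace ℝ (Fin n)) M]
    (u : EuclideanSpace ℝ (Fin n) → ℝ) (x : M) : M → ℝ :=
  (chartAt (EuclideanSpace ℝ (Fin n)) x).source.indicator
    (u ∘ chartAt (EuclideanSpace ℝ (Fin n)) x)

theorem chartPull_comp_symm (u : 𝔼 → ℝ) {x : M} {y : 𝔼} (hy : y ∈ (𝔠 x).target) :
    chartPull u x ((𝔠 x).symm y) = u y := by
  rw [chartPull, Set.indicator_of_mem ((𝔠 x).map_target hy)]
  simp [(𝔠 x).right_inv hy]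

theorem isCompact_chart_symm_image {L : Set 𝔼} {x : M} (hL : IsCompact L)
    (hLt : L ⊆ (𝔠 x).target) : IsCompact ((𝔠 x).symm '' L) :=
  hL.image_of_continuousOn ((𝔠 x).continuousOn_symm.mono hLt)

theorem tsupport_chartPull_subset {u : 𝔼 → ℝ} {L : Set 𝔼} {x : M} (hL : IsCompact L)
    (hLt : L ⊆ (𝔠 x).target) (hu : tsupport u ⊆ L) :
    tsupport (chartPull u x) ⊆ (𝔠 x).symm '' L := by
  refine closure_minimal (fun p hp ↦ ?_) (isCompact_chart_symm_image hL hLt).isClosed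
  have hps : p ∈ (𝔠 x).source := Set.mem_of_indicator_ne_zero hp
  refine ⟨𝔠 x p, hu (subset_tsupport _ ?_), (𝔠 x).left_inv hps⟩
  have h : chartPull u x p ≠ 0 := hp
  rwa [chartPull, Set.indicator_of_mem hps] at h

theorem chart_symm_image_subset_source {L : Set 𝔼} {x : M} (hLt : L ⊆ (𝔠 x).target) :
    (𝔠 x).symm '' L ⊆ (𝔠 x).source := by
  rintro _ ⟨y, hy, rfl⟩
  exact (𝔠 x).map_target (hLt hy)

theorem contMDiff_chartPull {u : 𝔼 → ℝ} {L : Set 𝔼} {x : M} (hL : IsCompact L)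
    (hLt : L ⊆ (𝔠 x).target) (hu : tsupport u ⊆ L) (hus : ContDiff ℝ ∞ u) :
    ContMDiff (𝓡 n) 𝓘(ℝ, ℝ) ∞ (chartPull u x) := by
  refine contMDiff_of_tsupport fun p hp ↦ ?_
  have hps := chart_symm_image_subset_source hLt (tsupport_chartPull_subset hL hLt hu hp)
  have h2 : ContMDiffOn (𝓡 n) (𝓡 n) ∞ (𝔠 x) (𝔠 x).source := contMDiffOn_chart
  have h3 := hus.contMDiff.comp_contMDiffOn h2
  refine (h3.contMDiffAt ((𝔠 x).open_source.mem_nhds hps)).congr_of_eventuallyEq ?_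
  filter_upwards [(𝔠 x).open_source.mem_nhds hps] with q hq
  rw [chartPull, Set.indicator_of_mem hq]

variable [RiemannianBundle (fun p : M ↦ TangentSpace (𝓡 n) p)]

theorem fderiv_chartGrad (f : M → ℝ) (x : M) (y : 𝔼) (g : 𝔼 → ℝ) :
    fderiv ℝ g y (chartGrad f x y) = ∑ i, ∑ j, (gramMatrix x y)⁻¹ i j *
      (fderiv ℝ g y (EuclideanSpace.single i (1 : ℝ)) *
        fderiv ℝ (f ∘ (𝔠 x).symm) y (EuclideanSpace.single j (1 : ℝ))) := by
  conv_lhs => rw [eq_sum_single (chartGrad f x y)]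
  simp only [map_sum, map_smul, smul_eq_mul]
  refine Finset.sum_congr rfl fun i _ ↦ ?_
  have hc : chartGrad f x y i = ∑ j, (gramMatrix x y)⁻¹ i j *
    fderiv ℝ (f ∘ (𝔠 x).symm) y (EuclideanSpace.single j (1 : ℝ)) := rfl
  rw [hc, Finset.sum_mul]
  exact Finset.sum_congr rfl fun j _ ↦ by ring

variable [IsContMDiffRiemannianBundle (𝓡 n) ∞ (EuclideanSpace ℝ (Fin n))
      (fun p : M ↦ TangentSpace (𝓡 n) p)] [MeasurableSpace M] [BorelSpace M]

/-- Dominated convergence: on the compact set `L` the metric coefficients are bounded, and the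
Lipschitz constants bound the two derivatives. -/
theorem tendsto_setIntegral_chartGrad {L : Set 𝔼} (hL : IsCompact L) {x : M}
    (hLt : L ⊆ (𝔠 x).target) {u : ℕ → 𝔼 → ℝ} {g : 𝔼 → ℝ} {f : M → ℝ} {K K' : NNReal}
    (hf : ∀ y ∈ L, ‖fderiv ℝ (f ∘ (𝔠 x).symm) y‖ ≤ K')
    (hu : ∀ k y, ‖fderiv ℝ (u k) y‖ ≤ K)
    (hlim : ∀ᵐ y, ∀ i, Tendsto (fun k ↦ fderiv ℝ (u k) y (EuclideanSpace.single i (1 : ℝ))) atTop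
        (𝓝 (fderiv ℝ g y (EuclideanSpace.single i (1 : ℝ))))) :
    Tendsto (fun k ↦ ∫ y in L, volumeDensity x y * fderiv ℝ (u k) y (chartGrad f x y)) atTop
      (𝓝 (∫ y in L, volumeDensity x y * fderiv ℝ g y (chartGrad f x y))) := by
  have hc : ∀ i j, ContinuousOn (fun y ↦ volumeDensity x y * (gramMatrix x y)⁻¹ i j) L :=
    fun i j ↦ ((contDiffOn_volumeDensity x).mul (contDiffOn_inv_apply (contDiffOn_gramMatrix x)
      (fun _ hy ↦ (gramMatrix_det_pos hy).ne') i j)).continuousOn.mono hLt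
  choose c hc' using fun i j ↦ hL.exists_bound_of_continuousOn (hc i j)
  simp only [fderiv_chartGrad, Finset.mul_sum, ← mul_assoc]
  have hae := hL.isClosed.measurableSet
  refine tendsto_integral_of_dominated_convergence
    (fun _ ↦ ∑ i, ∑ j, c i j * (K * K')) ?_ ?_ ?_ ?_
  · intro k
    refine Finset.aestronglyMeasurable_fun_sum _ fun i _ ↦
      Finset.aestronglyMeasurable_fun_sum _ fun j _ ↦ ?_
    exact (((hc i j).aestronglyMeasurable hae).mul
      (measurable_fderiv_apply_const ℝ _ _).aestronglyMeasurable).mul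
      (measurable_fderiv_apply_const ℝ _ _).aestronglyMeasurable
  · have : IsFiniteMeasure ((volume : Measure 𝔼).restrict L) := ⟨by
      rw [Measure.restrict_apply_univ]; exact hL.measure_lt_top⟩
    exact integrable_const _
  · intro k
    filter_upwards [ae_restrict_mem hae] with y hy
    refine norm_sum_le_of_le _ fun i _ ↦ norm_sum_le_of_le _ fun j _ ↦ ?_
    rw [mul_assoc]
    have h1 : ‖fderiv ℝ (u k) y (EuclideanSpace.single i (1 : ℝ))‖ ≤ K :=
      ((fderiv ℝ (u k) y).le_opNorm _).trans (by simpa using hu k y)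
    have h2 : ‖fderiv ℝ (f ∘ (𝔠 x).symm) y (EuclideanSpace.single j (1 : ℝ))‖ ≤ K' :=
      ((fderiv ℝ (f ∘ (𝔠 x).symm) y).le_opNorm _).trans (by simpa using hf y hy)
    exact norm_mul_le_of_le (hc' i j y hy) (norm_mul_le_of_le h1 h2)
  · filter_upwards [ae_restrict_of_ae hlim] with y hy
    exact tendsto_finsetSum _ fun i _ ↦ tendsto_finsetSum _ fun j _ ↦
      ((hy i).const_mul _).mul_const _

/-- A lower bound for the Laplacian in the sense of distributions can be tested against nonnegative
Lipschitz functions supported in the domain of a chart. -/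
theorem LaplacianGE.integral_le_of_tsupport_subset_source [SecondCountableTopology M]
    {ρ h ψ : M → ℝ} {U : Set M} {x : M} (hU : IsOpen U) (hGE : LaplacianGE n U ρ h)
    (hh : ContinuousOn h U) (hρ : ∀ y ∈ (𝔠 x).target, LipschitzAround (ρ ∘ (𝔠 x).symm) y)
    (hψ : ∀ y ∈ (𝔠 x).target, LipschitzAround (ψ ∘ (𝔠 x).symm) y) (hψc : HasCompactSupport ψ)
    (hψs : tsupport ψ ⊆ (𝔠 x).source) (hψU : tsupport ψ ⊆ U) (hψ0 : ∀ p, 0 ≤ ψ p) :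
    ∫ p, h p * ψ p ∂(riemannianVolume n M) ≤
      -∫ p, ⟪grad n ψ p, grad n ρ p⟫_ℝ ∂(riemannianVolume n M) := by
  obtain ⟨K, hK⟩ := exists_lipschitzWith_chartExt hψ hψc hψs
  set V := (𝔠 x).target ∩ (𝔠 x).symm ⁻¹' U with hV_def
  have hV : IsOpen V := (𝔠 x).symm.isOpen_inter_preimage hU
  have hFV : tsupport (chartExt n ψ x) ⊆ V := by
    refine (tsupport_chartExt_subset hψc hψs).trans ?_
    rintro _ ⟨p, hp, rfl⟩
    refine ⟨(𝔠 x).map_source (hψs hp), ?_⟩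
    simpa [(𝔠 x).left_inv (hψs hp)] using hψU hp
  have hF0 : ∀ y, 0 ≤ chartExt n ψ x y := fun y ↦ Set.indicator_nonneg (fun _ _ ↦ hψ0 _) y
  obtain ⟨L, B, u, hL, hLV, hFL, hus, hu0, huL, huB, huK, hulim, hudlim⟩ :=
    exists_smooth_approx hK (hasCompactSupport_chartExt hψc hψs) hF0 hV hFV
  have hLt : L ⊆ (𝔠 x).target := hLV.trans Set.inter_subset_left
  have hLm : MeasurableSet L := hL.isClosed.measurableSet
  have htm : MeasurableSet (𝔠 x).target := (𝔠 x).open_target.measurableSet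
  have hLs := chart_symm_image_subset_source hLt
  -- Green's formula needs its Lipschitz factor compactly supported in the chart, so `ρ` is replaced
  -- by `θ * ρ`, which agrees with it near all supports of the approximations.
  obtain ⟨θ, hθ, hθc, hθs, -, hθ1⟩ := exists_contMDiff_cutoff n
    (isCompact_chart_symm_image hL hLt) (𝔠 x).open_source hLs
  set f : M → ℝ := fun p ↦ θ p * ρ p with hf_def
  have hfc : HasCompactSupport f := hθc.mul_right
  have hfs : tsupport f ⊆ (𝔠 x).source := (tsupport_mul_subset_left).trans hθs
  have hfL : ∀ y ∈ (𝔠 x).target, LipschitzAround (f ∘ (𝔠 x).symm) y := by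
    intro y hy
    have h1 := (lipschitzAround_comp_chart_symm (hθ.of_le (by simp)) x y hy).prodMk (hρ y hy)
    have h2 : ContDiffAt ℝ 1 (fun q : ℝ × ℝ ↦ q.1 * q.2)
        ((θ ∘ (𝔠 x).symm) y, (ρ ∘ (𝔠 x).symm) y) := (contDiff_fst.mul contDiff_snd).contDiffAt
    exact LipschitzAround.comp (f := fun z ↦ ((θ ∘ (𝔠 x).symm) z, (ρ ∘ (𝔠 x).symm) z))
      (g := fun q : ℝ × ℝ ↦ q.1 * q.2) h2.lipschitzAround h1
  obtain ⟨K', hK'⟩ := exists_lipschitzWith_chartExt hfL hfc hfs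
  have hfK' : ∀ y ∈ L, ‖fderiv ℝ (f ∘ (𝔠 x).symm) y‖ ≤ K' := by
    intro y hy
    rw [← (chartExt_eventuallyEq f (hLt hy)).fderiv_eq]
    exact norm_fderiv_le_of_lipschitz ℝ hK'
  have hf_near : ∀ p ∈ (𝔠 x).symm '' L, f =ᶠ[𝓝 p] ρ := by
    intro p hp
    filter_upwards [eventually_nhdsSet_iff_forall.1 hθ1 p hp] with q hq
    simp [hf_def, hq]
  -- the inequality for the smooth approximations
  have hstep : ∀ k, ∫ y in L, volumeDensity x y * (h ((𝔠 x).symm y) * u k y) ≤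
      -∫ y in L, volumeDensity x y * fderiv ℝ (u k) y (chartGrad f x y) := by
    intro k
    have hts := tsupport_chartPull_subset hL hLt (huL k)
    have hsm := contMDiff_chartPull hL hLt (huL k) (hus k)
    have hcs : HasCompactSupport (chartPull (u k) x) := HasCompactSupport.of_support_subset_isCompact
      (isCompact_chart_symm_image hL hLt) ((subset_tsupport _).trans hts)
    have hUs : tsupport (chartPull (u k) x) ⊆ U := by
      refine hts.trans ?_
      rintro _ ⟨y, hy, rfl⟩
      exact (hLV hy).2
    have h1 := hGE (chartPull (u k) x) ⟨hsm, hcs, hUs⟩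
      (fun p ↦ Set.indicator_nonneg (fun _ _ ↦ hu0 k _) p)
    have h2 : ∫ p, ρ p * laplacian n (chartPull (u k) x) p ∂(riemannianVolume n M) =
        ∫ p, f p * laplacian n (chartPull (u k) x) p ∂(riemannianVolume n M) := by
      congr 1
      ext p
      by_cases hp : p ∈ tsupport (chartPull (u k) x)
      · rw [(hf_near p (hts hp)).eq_of_nhds]
      · rw [laplacian_eq_zero_of_notMem_tsupport hp, mul_zero, mul_zero]
    rw [h2, integral_mul_laplacian_of_tsupport_subset_source hfL hfc hfs hsm,
      integral_riemannianVolume_eq_chart x, integral_riemannianVolume_eq_chart x,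
      setIntegral_eq_of_subset_of_forall_sdiff_eq_zero htm hLt,
      setIntegral_eq_of_subset_of_forall_sdiff_eq_zero htm hLt] at h1
    · refine le_of_eq_of_le ?_ (h1.trans_eq ?_)
      · refine setIntegral_congr_fun hLm fun y hy ↦ ?_
        rw [chartPull_comp_symm (u k) (hLt hy)]
      · congr 1
        refine setIntegral_congr_fun hLm fun y hy ↦ ?_
        have he : chartPull (u k) x ∘ (𝔠 x).symm =ᶠ[𝓝 y] u k := by
          filter_upwards [(𝔠 x).open_target.mem_nhds (hLt hy)] with z hz
          exact chartPull_comp_symm (u k) hz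
        beta_reduce
        rw [real_inner_comm, inner_grad_grad _ _ (hLt hy), he.fderiv_eq]
    · intro y hy
      have hp : (𝔠 x).symm y ∉ tsupport (chartPull (u k) x) := by
        intro hp
        obtain ⟨z, hz, hzy⟩ := hts hp
        exact hy.2 ((𝔠 x).symm.injOn (hLt hz) hy.1 hzy ▸ hz)
      rw [grad_eq_zero_of_notMem_tsupport hp, inner_zero_right, mul_zero]
    · intro y hy
      have hp : y ∉ tsupport (u k) := fun hp ↦ hy.2 (huL k hp)
      rw [chartPull_comp_symm _ hy.1, image_eq_zero_of_notMem_tsupport hp, mul_zero, mul_zero]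
    · intro p hp
      rw [grad_eq_zero_of_notMem_tsupport fun h' ↦ hp (hfs h'), inner_zero_left]
    · intro p hp
      rw [image_eq_zero_of_notMem_tsupport fun h' ↦ hp (hLs (hts h')), mul_zero]
  have hlim1 : Tendsto (fun k ↦ ∫ y in L, volumeDensity x y * (h ((𝔠 x).symm y) * u k y)) atTop
      (𝓝 (∫ y in L, volumeDensity x y * (h ((𝔠 x).symm y) * chartExt n ψ x y))) := by
    have hcont : ContinuousOn (fun y ↦ volumeDensity x y * h ((𝔠 x).symm y)) L :=
      ((contDiffOn_volumeDensity x).continuousOn.mono hLt).mul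
        (hh.comp ((𝔠 x).continuousOn_symm.mono hLt) fun y hy ↦ (hLV hy).2)
    obtain ⟨c, hc⟩ := hL.exists_bound_of_continuousOn hcont
    simp only [← mul_assoc]
    refine tendsto_integral_of_dominated_convergence (fun _ ↦ c * B) ?_ ?_ ?_ ?_
    · intro k
      exact (hcont.aestronglyMeasurable hLm).mul (hus k).continuous.aestronglyMeasurable
    · have : IsFiniteMeasure ((volume : Measure 𝔼).restrict L) := ⟨by
        rw [Measure.restrict_apply_univ]; exact hL.measure_lt_top⟩
      exact integrable_const _
    · intro k
      filter_upwards [ae_restrict_mem hLm] with y hy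
      rw [norm_mul]
      exact mul_le_mul (hc y hy) (huB k y) (norm_nonneg _) ((norm_nonneg _).trans (hc y hy))
    · exact Eventually.of_forall fun y ↦ (hulim y).const_mul _
  have hlim2 := (tendsto_setIntegral_chartGrad (M := M) hL hLt hfK' huK hudlim).neg
  have hfin := le_of_tendsto_of_tendsto' hlim1 hlim2 hstep
  rw [integral_riemannianVolume_eq_chart x, integral_riemannianVolume_eq_chart x,
      setIntegral_eq_of_subset_of_forall_sdiff_eq_zero htm hLt,
      setIntegral_eq_of_subset_of_forall_sdiff_eq_zero htm hLt]
  · refine le_of_eq_of_le ?_ (hfin.trans_eq ?_)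
    · refine setIntegral_congr_fun hLm fun y hy ↦ ?_
      rw [(chartExt_eventuallyEq ψ (hLt hy)).eq_of_nhds, Function.comp]
    · congr 1
      refine setIntegral_congr_fun hLm fun y hy ↦ ?_
      beta_reduce
      have hg : grad n ρ ((𝔠 x).symm y) = grad n f ((𝔠 x).symm y) := by
        unfold grad
        rw [(hf_near _ ⟨y, hy, rfl⟩).mfderiv_eq]
      rw [hg, inner_grad_grad _ _ (hLt hy), (chartExt_eventuallyEq ψ (hLt hy)).fderiv_eq]
  · intro y hy
    rw [inner_grad_grad ψ ρ hy.1, ← (chartExt_eventuallyEq ψ hy.1).fderiv_eq,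
      fderiv_apply_eq_zero_of_notMem_tsupport fun h' ↦ hy.2 (hFL h'), mul_zero]
  · intro y hy
    have h0 : ψ ((𝔠 x).symm y) = 0 := by
      have := image_eq_zero_of_notMem_tsupport (f := chartExt n ψ x) fun h' ↦ hy.2 (hFL h')
      rwa [(chartExt_eventuallyEq ψ hy.1).eq_of_nhds] at this
    rw [h0, mul_zero, mul_zero]
  · intro p hp
    rw [grad_eq_zero_of_notMem_tsupport fun h' ↦ hp (hψs h'), inner_zero_left]
  · intro p hp
    rw [image_eq_zero_of_notMem_tsupport fun h' ↦ hp (hψs h'), mul_zero]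

end DistributionalInequality

/-! ### Partition of unity and weighted formulas on the manifold -/

section Global

open Filter Topology

variable {n : ℕ} {M : Type*} [MetricSpace M] [ChartedSpace (EuclideanSpace ℝ (Fin n)) M]

local notation "𝔼" => EuclideanSpace ℝ (Fin n)
local notation "𝔠" => chartAt (EuclideanSpace ℝ (Fin n))

variable [IsManifold (𝓡 n) ∞ M]

variable (n) in
theorem exists_finite_partition [SecondCountableTopology M] {K : Set M} (hK : IsCompact K) :
    ∃ (F : Finset M) (χ : M → M → ℝ), (∀ i, ContMDiff (𝓡 n) 𝓘(ℝ, ℝ) ∞ (χ i)) ∧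
      (∀ i p, 0 ≤ χ i p) ∧ (∀ i, tsupport (χ i) ⊆ (𝔠 i).source) ∧
      ∀ p ∈ K, ∑ i ∈ F, χ i p = 1 := by
  have := ChartedSpace.locallyCompactSpace 𝔼 M
  obtain ⟨f, hf⟩ := SmoothPartitionOfUnity.exists_isSubordinate_chartAt_source (𝓡 n) M
  have hfin := f.locallyFinite.finite_nonempty_inter_compact hK
  refine ⟨hfin.toFinset, fun i ↦ f i, fun i ↦ (f i).contMDiff, fun i ↦ f.nonneg i, hf,
    fun p hp ↦ ?_⟩
  rw [← f.sum_eq_one (Set.mem_univ p), finsum_eq_sum_of_support_subset]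
  intro i hi
  simp only [Set.Finite.coe_toFinset, Set.mem_ofPred_eq]
  exact ⟨p, hi, hp⟩

variable [RiemannianBundle (fun p : M ↦ TangentSpace (𝓡 n) p)]

theorem inner_grad_grad_self_chart (f h : M → ℝ) (p : M) :
    ⟪grad n f p, grad n h p⟫_ℝ =
      fderiv ℝ (f ∘ (𝔠 p).symm) (𝔠 p p) (chartGrad h p (𝔠 p p)) := by
  have h1 := inner_grad_grad f h (mem_chart_target 𝔼 p)
  rwa [(𝔠 p).left_inv (mem_chart_source 𝔼 p)] at h1

theorem differentiableAt_self_chart {f : M → ℝ} {p : M}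
    (hf : MDifferentiableAt (𝓡 n) 𝓘(ℝ, ℝ) f p) :
    DifferentiableAt ℝ (f ∘ (𝔠 p).symm) (𝔠 p p) := by
  rw [← mdifferentiableAt_iff_chart f (mem_chart_target 𝔼 p),
    (𝔠 p).left_inv (mem_chart_source 𝔼 p)]
  exact hf

theorem inner_grad_rpow_mul {ρ w : M → ℝ} (h : M → ℝ) (s : ℝ) {p : M} (hp : ρ p ≠ 0)
    (hρ : MDifferentiableAt (𝓡 n) 𝓘(ℝ, ℝ) ρ p) (hw : MDifferentiableAt (𝓡 n) 𝓘(ℝ, ℝ) w p) :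
    ⟪grad n (fun p ↦ ρ p ^ s * w p) p, grad n h p⟫_ℝ =
      ρ p ^ s * ⟪grad n w p, grad n h p⟫_ℝ +
        s * ρ p ^ (s - 1) * w p * ⟪grad n ρ p, grad n h p⟫_ℝ := by
  simp only [inner_grad_grad_self_chart]
  have e1 : (ρ ∘ (𝔠 p).symm) (𝔠 p p) = ρ p := by simp
  have e2 : (w ∘ (𝔠 p).symm) (𝔠 p p) = w p := by simp
  have h1 := ((differentiableAt_self_chart hρ).hasFDerivAt.rpow_const (p := s)
    (Or.inl (by rwa [e1]))).mul (differentiableAt_self_chart hw).hasFDerivAt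
  have h2 : (fun p ↦ ρ p ^ s * w p) ∘ (𝔠 p).symm =
    (fun y ↦ (ρ ∘ (𝔠 p).symm) y ^ s) * (w ∘ (𝔠 p).symm) := rfl
  rw [h2, h1.fderiv, e1, e2]
  simp only [add_apply, smul_apply, smul_eq_mul]
  ring

theorem inner_grad_comp {φ : M → ℝ} (h : M → ℝ) {g : ℝ → ℝ} {p : M}
    (hg : DifferentiableAt ℝ g (φ p)) (hφ : MDifferentiableAt (𝓡 n) 𝓘(ℝ, ℝ) φ p) :
    ⟪grad n (fun p ↦ g (φ p)) p, grad n h p⟫_ℝ =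
      deriv g (φ p) * ⟪grad n φ p, grad n h p⟫_ℝ := by
  simp only [inner_grad_grad_self_chart]
  have e1 : (φ ∘ (𝔠 p).symm) (𝔠 p p) = φ p := by simp
  have h1 : HasDerivAt g (deriv g (φ p)) ((φ ∘ (𝔠 p).symm) (𝔠 p p)) := by
    rw [e1]; exact hg.hasDerivAt
  have h2 := h1.comp_hasFDerivAt _ (differentiableAt_self_chart hφ).hasFDerivAt
  have h3 : (fun p ↦ g (φ p)) ∘ (𝔠 p).symm = g ∘ (φ ∘ (𝔠 p).symm) := rfl
  rw [h3, h2.fderiv]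
  simp

theorem inner_grad_sum {ι : Type*} (F : Finset ι) {w : ι → M → ℝ} (h : M → ℝ) {p : M}
    (hw : ∀ i, MDifferentiableAt (𝓡 n) 𝓘(ℝ, ℝ) (w i) p) :
    ⟪grad n (fun p ↦ ∑ i ∈ F, w i p) p, grad n h p⟫_ℝ =
      ∑ i ∈ F, ⟪grad n (w i) p, grad n h p⟫_ℝ := by
  simp only [inner_grad_grad_self_chart]
  have h1 := HasFDerivAt.fun_sum (u := F) fun i _ ↦ (differentiableAt_self_chart (hw i)).hasFDerivAt
  have h3 : (fun p ↦ ∑ i ∈ F, w i p) ∘ (𝔠 p).symm =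
    fun y ↦ ∑ i ∈ F, (w i ∘ (𝔠 p).symm) y := rfl
  rw [h3, h1.fderiv]
  simp

/-- As the gradient defaults to zero, the hypothesis `|∇ρ| = 1` also says that `ρ` is differentiable
at the points in question. -/
theorem mdifferentiableAt_of_grad_ne_zero {f : M → ℝ} {p : M} (hf : grad n f p ≠ 0) :
    MDifferentiableAt (𝓡 n) 𝓘(ℝ, ℝ) f p := by
  by_contra h
  refine hf ?_
  unfold grad
  rw [mfderiv_zero_of_not_mdifferentiableAt h]
  exact map_zero _

variable [IsContMDiffRiemannianBundle (𝓡 n) ∞ (EuclideanSpace ℝ (Fin n))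
      (fun p : M ↦ TangentSpace (𝓡 n) p)]

theorem continuousOn_inv_gramMatrix (x : M) (i j : Fin n) :
    ContinuousOn (fun y ↦ (gramMatrix x y)⁻¹ i j) (𝔠 x).target :=
  (contDiffOn_inv_apply (contDiffOn_gramMatrix x)
    (fun _ hy ↦ (gramMatrix_det_pos hy).ne') i j).continuousOn

theorem continuous_inner_grad_grad {f h : M → ℝ} (hf : ContMDiff (𝓡 n) 𝓘(ℝ, ℝ) 1 f)
    (hh : ContMDiff (𝓡 n) 𝓘(ℝ, ℝ) 1 h) : Continuous fun p ↦ ⟪grad n f p, grad n h p⟫_ℝ := by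
  refine continuous_iff_continuousAt.2 fun x ↦ ?_
  have hC : ∀ g : M → ℝ, ContMDiff (𝓡 n) 𝓘(ℝ, ℝ) 1 g → ∀ i, ContinuousOn (fun y ↦
      fderiv ℝ (g ∘ (𝔠 x).symm) y (EuclideanSpace.single i (1 : ℝ))) (𝔠 x).target := by
    intro g hg i
    have h1 : ContMDiffOn (𝓡 n) (𝓡 n) ∞ (𝔠 x).symm (𝔠 x).target := contMDiffOn_chart_symm
    have h2 := (hg.comp_contMDiffOn (h1.of_le (by simp))).contDiffOn
    exact (h2.continuousOn_fderiv_of_isOpen (𝔠 x).open_target le_rfl).clm_apply continuousOn_const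
  have h3 : ContinuousOn (fun y ↦ fderiv ℝ (f ∘ (𝔠 x).symm) y (chartGrad h x y))
      (𝔠 x).target := by
    simp only [fderiv_chartGrad]
    exact continuousOn_finsetSum _ fun i _ ↦ continuousOn_finsetSum _ fun j _ ↦
      (continuousOn_inv_gramMatrix x i j).mul ((hC f hf i).mul (hC h hh j))
  have hx := (𝔠 x).open_source.mem_nhds (mem_chart_source 𝔼 x)
  refine ((h3.comp (𝔠 x).continuousOn fun p hp ↦ (𝔠 x).map_source hp).continuousAt hx).congr ?_
  filter_upwards [hx] with p hp
  have := inner_grad_grad f h ((𝔠 x).map_source hp)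
  rw [(𝔠 x).left_inv hp] at this
  exact this.symm

variable [MeasurableSpace M] [BorelSpace M]

theorem aestronglyMeasurable_inner_grad_grad [SecondCountableTopology M] (f h : M → ℝ) :
    AEStronglyMeasurable (fun p ↦ ⟪grad n f p, grad n h p⟫_ℝ) (riemannianVolume n M) := by
  refine aestronglyMeasurable_riemannianVolume fun x ↦ ?_
  have h3 : AEStronglyMeasurable (fun y ↦ fderiv ℝ (f ∘ (𝔠 x).symm) y (chartGrad h x y))
      ((volume : Measure 𝔼).restrict (𝔠 x).target) := by
    simp only [fderiv_chartGrad]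
    refine Finset.aestronglyMeasurable_fun_sum _ fun i _ ↦
      Finset.aestronglyMeasurable_fun_sum _ fun j _ ↦ ?_
    exact ((continuousOn_inv_gramMatrix x i j).aestronglyMeasurable
      (𝔠 x).open_target.measurableSet).mul
      ((measurable_fderiv_apply_const ℝ _ _).mul
        (measurable_fderiv_apply_const ℝ _ _)).aestronglyMeasurable
  refine h3.congr ?_
  filter_upwards [ae_restrict_mem (𝔠 x).open_target.measurableSet] with y hy
  exact (inner_grad_grad f h hy).symm

/-- Negative powers are harmless: `ρ` does not vanish on the closed support of `g`, and off the
support the product is locally zero. -/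
theorem continuous_rpow_mul {ρ g : M → ℝ} (hρ : Continuous ρ) (hg : Continuous g)
    (hgρ : tsupport g ⊆ {p | ρ p ≠ 0}) (s : ℝ) : Continuous fun p ↦ ρ p ^ s * g p := by
  refine continuous_iff_continuousAt.2 fun p ↦ ?_
  by_cases hp : p ∈ tsupport g
  · exact (hρ.continuousAt.rpow_const (Or.inl (hgρ hp))).mul hg.continuousAt
  · have h0 : (fun p ↦ ρ p ^ s * g p) =ᶠ[𝓝 p] fun _ ↦ 0 := by
      filter_upwards [(isClosed_tsupport g).isOpen_compl.mem_nhds hp] with q hq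
      rw [image_eq_zero_of_notMem_tsupport hq, mul_zero]
    exact continuousAt_const.congr h0.symm

theorem integrable_rpow_mul {ρ g : M → ℝ} (hρ : Continuous ρ) (hg : Continuous g)
    (hgc : HasCompactSupport g) (hgρ : tsupport g ⊆ {p | ρ p ≠ 0}) (s : ℝ) :
    Integrable (fun p ↦ ρ p ^ s * g p) (riemannianVolume n M) := by
  have := isLocallyFiniteMeasure_riemannianVolume (n := n) (M := M)
  exact (continuous_rpow_mul hρ hg hgρ s).integrable_of_hasCompactSupport hgc.mul_left

theorem lipschitzAround_rpow_mul {ρ w : M → ℝ} {x : M}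
    (hρ : ∀ y ∈ (𝔠 x).target, LipschitzAround (ρ ∘ (𝔠 x).symm) y)
    (hw : ContMDiff (𝓡 n) 𝓘(ℝ, ℝ) 1 w) (hwρ : tsupport w ⊆ {p | ρ p ≠ 0}) (s : ℝ) :
    ∀ y ∈ (𝔠 x).target, LipschitzAround ((fun p ↦ ρ p ^ s * w p) ∘ (𝔠 x).symm) y := by
  intro y hy
  by_cases hp : (𝔠 x).symm y ∈ tsupport w
  · have h1 := (hρ y hy).prodMk (lipschitzAround_comp_chart_symm hw x y hy)
    have h2 : ContDiffAt ℝ 1 (fun q : ℝ × ℝ ↦ q.1 ^ s * q.2)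
        ((ρ ∘ (𝔠 x).symm) y, (w ∘ (𝔠 x).symm) y) :=
      (ContDiffAt.rpow_const_of_ne (f := fun q : ℝ × ℝ ↦ q.1) contDiffAt_fst
        (show ρ ((𝔠 x).symm y) ≠ 0 from hwρ hp)).mul contDiffAt_snd
    exact LipschitzAround.comp (f := fun z ↦ ((ρ ∘ (𝔠 x).symm) z, (w ∘ (𝔠 x).symm) z))
      (g := fun q : ℝ × ℝ ↦ q.1 ^ s * q.2) h2.lipschitzAround h1
  · have ho : IsOpen ((𝔠 x).target ∩ (𝔠 x).symm ⁻¹' (tsupport w)ᶜ) :=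
      (𝔠 x).symm.isOpen_inter_preimage (isClosed_tsupport w).isOpen_compl
    have h0 : (fun _ ↦ (0 : ℝ)) =ᶠ[𝓝 y] (fun p ↦ ρ p ^ s * w p) ∘ (𝔠 x).symm := by
      filter_upwards [ho.mem_nhds ⟨hy, hp⟩] with z hz
      simp [image_eq_zero_of_notMem_tsupport hz.2]
    exact (contDiffAt_const (c := (0 : ℝ))).lipschitzAround.congr h0

section Weighted

variable [SecondCountableTopology M] {ρ : M → ℝ} (hρc : Continuous ρ)
  (hρL : ∀ x : M, ∀ y ∈ (chartAt (EuclideanSpace ℝ (Fin n)) x).target,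
    LipschitzAround (ρ ∘ (chartAt (EuclideanSpace ℝ (Fin n)) x).symm) y)
  (hρ1 : ∀ᵐ p ∂(riemannianVolume n M), ρ p ≠ 0 → ‖grad n ρ p‖ = 1)

include hρc hρ1 in
-- The gradient of `ρ` is only measurable, but has norm 1 almost everywhere where `ρ` is nonzero. By
-- Cauchy–Schwarz the integrand is dominated by a continuous function of compact support.
theorem integrable_rpow_mul_inner_grad {w g : M → ℝ} (hw : ContMDiff (𝓡 n) 𝓘(ℝ, ℝ) 1 w)
    (hg : Continuous g) (hs : HasCompactSupport fun p ↦ g p * ‖grad n w p‖)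
    (hsρ : tsupport (fun p ↦ g p * ‖grad n w p‖) ⊆ {p | ρ p ≠ 0}) (s : ℝ) :
    Integrable (fun p ↦ ρ p ^ s * (g p * ⟪grad n w p, grad n ρ p⟫_ℝ)) (riemannianVolume n M) := by
  have hN : Continuous fun p ↦ ‖grad n w p‖ := by
    have := (continuous_inner_grad_grad hw hw).sqrt
    simpa only [real_inner_self_eq_norm_sq, Real.sqrt_sq (norm_nonneg _)] using this
  have hI : Integrable (fun p ↦ ρ p ^ s * (g p * ‖grad n w p‖)) (riemannianVolume n M) :=
    integrable_rpow_mul (g := fun p ↦ g p * ‖grad n w p‖) hρc (hg.mul hN) hs hsρ s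
  refine hI.mono ?_ ?_
  · exact (hρc.measurable.pow_const s).aestronglyMeasurable.mul
      (hg.aestronglyMeasurable.mul (aestronglyMeasurable_inner_grad_grad w ρ))
  · filter_upwards [hρ1] with p hp
    by_cases h0 : ρ p = 0
    · have h1 : g p * ‖grad n w p‖ = 0 := image_eq_zero_of_notMem_tsupport
        (f := fun p ↦ g p * ‖grad n w p‖) fun h' ↦ hsρ h' h0
      have h2 : g p * ⟪grad n w p, grad n ρ p⟫_ℝ = 0 := by
        rcases mul_eq_zero.1 h1 with h | h
        · rw [h, zero_mul]
        · rw [norm_eq_zero.1 h, inner_zero_left, mul_zero]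
      rw [h2, h1]
    · rw [norm_mul, norm_mul, norm_mul, norm_mul, norm_norm]
      have := norm_inner_le_norm (𝕜 := ℝ) (grad n w p) (grad n ρ p)
      rw [hp h0, mul_one] at this
      gcongr

include hρ1 in
theorem ae_inner_grad_rpow_mul {w : M → ℝ} (h : M → ℝ) (hw : ContMDiff (𝓡 n) 𝓘(ℝ, ℝ) 1 w)
    (hwρ : tsupport w ⊆ {p | ρ p ≠ 0}) (s : ℝ) :
    ∀ᵐ p ∂(riemannianVolume n M), ⟪grad n (fun p ↦ ρ p ^ s * w p) p, grad n h p⟫_ℝ =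
      ρ p ^ s * ⟪grad n w p, grad n h p⟫_ℝ +
        s * (ρ p ^ (s - 1) * (w p * ⟪grad n h p, grad n ρ p⟫_ℝ)) := by
  filter_upwards [hρ1] with p hp
  by_cases h0 : ρ p = 0
  · have hpw : p ∉ tsupport w := fun h' ↦ hwρ h' h0
    have hpf : p ∉ tsupport fun p ↦ ρ p ^ s * w p := fun h' ↦ hpw (tsupport_mul_subset_right h')
    rw [grad_eq_zero_of_notMem_tsupport hpw, grad_eq_zero_of_notMem_tsupport hpf,
      image_eq_zero_of_notMem_tsupport hpw]
    simp
  · have hd : MDifferentiableAt (𝓡 n) 𝓘(ℝ, ℝ) ρ p := by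
      refine mdifferentiableAt_of_grad_ne_zero fun h' ↦ ?_
      have h1 := hp h0
      rw [h', norm_zero] at h1
      exact zero_ne_one h1
    have hc : ⟪grad n h p, grad n ρ p⟫_ℝ = ⟪grad n ρ p, grad n h p⟫_ℝ := real_inner_comm _ _
    have h2 := inner_grad_rpow_mul h s h0 hd (hw.mdifferentiableAt one_ne_zero)
    rw [h2, hc]
    ring

/-- Localization for any integrand `Φ w` additive in `w`: the pieces are `w` times the functions of
a partition of unity, of which finitely many suffice. It reduces both weighted formulas below to
functions supported in one chart. -/
theorem integral_eq_sum_of_partition {U : Set M} {Φ : (M → ℝ) → M → ℝ}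
    (hint : ∀ w : M → ℝ, ContMDiff (𝓡 n) 𝓘(ℝ, ℝ) 1 w → HasCompactSupport w → tsupport w ⊆ U →
      Integrable (Φ w) (riemannianVolume n M))
    (hsum : ∀ (F : Finset M) (w : M → M → ℝ), (∀ i, ContMDiff (𝓡 n) 𝓘(ℝ, ℝ) 1 (w i)) →
      ∀ p, Φ (fun p ↦ ∑ i ∈ F, w i p) p = ∑ i ∈ F, Φ (w i) p)
    {w : M → ℝ} (hw : ContMDiff (𝓡 n) 𝓘(ℝ, ℝ) 1 w) (hwc : HasCompactSupport w)
    (hwU : tsupport w ⊆ U) :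
    ∃ (F : Finset M) (v : M → M → ℝ), (∀ i, ContMDiff (𝓡 n) 𝓘(ℝ, ℝ) 1 (v i)) ∧
      (∀ i, HasCompactSupport (v i)) ∧ (∀ i, tsupport (v i) ⊆ U) ∧
      (∀ i, tsupport (v i) ⊆ (𝔠 i).source) ∧ (∀ i p, 0 ≤ w p → 0 ≤ v i p) ∧
      ∫ p, Φ w p ∂(riemannianVolume n M) =
        ∑ i ∈ F, ∫ p, Φ (v i) p ∂(riemannianVolume n M) := by
  obtain ⟨F, χ, hχ, hχ0, hχs, hχ1⟩ := exists_finite_partition n hwc.isCompact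
  have hv : ∀ i, ContMDiff (𝓡 n) 𝓘(ℝ, ℝ) 1 fun p ↦ χ i p * w p := fun i ↦
    ((hχ i).of_le (by simp)).mul hw
  have hvU : ∀ i, tsupport (fun p ↦ χ i p * w p) ⊆ U := fun i ↦
    tsupport_mul_subset_right.trans hwU
  refine ⟨F, fun i p ↦ χ i p * w p, hv, fun i ↦ hwc.mul_left, hvU,
    fun i ↦ tsupport_mul_subset_left.trans (hχs i), fun i p hp ↦ mul_nonneg (hχ0 i p) hp, ?_⟩
  rw [← integral_finsetSum _ fun i _ ↦ hint _ (hv i) hwc.mul_left (hvU i)]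
  congr 1
  ext p
  rw [← hsum F _ hv p]
  congr 1
  ext p
  rw [← Finset.sum_mul]
  by_cases hp : p ∈ tsupport w
  · rw [hχ1 p hp, one_mul]
  · rw [image_eq_zero_of_notMem_tsupport hp, mul_zero]

include hρc hρ1 in
theorem integrable_rpow_mul_mul_inner_grad {g h : M → ℝ} (hh : ContMDiff (𝓡 n) 𝓘(ℝ, ℝ) 1 h)
    (hg : Continuous g) (hgc : HasCompactSupport g) (hgρ : tsupport g ⊆ {p | ρ p ≠ 0}) (s : ℝ) :
    Integrable (fun p ↦ ρ p ^ s * (g p * ⟪grad n h p, grad n ρ p⟫_ℝ)) (riemannianVolume n M) :=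
  integrable_rpow_mul_inner_grad hρc hρ1 hh hg hgc.mul_right
    (tsupport_mul_subset_left.trans hgρ) s

theorem tsupport_inner_grad_subset (w : M → ℝ) (h : M → ℝ) :
    tsupport (fun p ↦ ⟪grad n w p, grad n h p⟫_ℝ) ⊆ tsupport w :=
  closure_minimal (fun p hp ↦ by
    by_contra h'
    exact hp (by beta_reduce; rw [grad_eq_zero_of_notMem_tsupport h', inner_zero_left]))
    (isClosed_tsupport w)

include hρc in
theorem integrable_rpow_mul_inner_grad_grad {w h : M → ℝ} (hw : ContMDiff (𝓡 n) 𝓘(ℝ, ℝ) 1 w)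
    (hwc : HasCompactSupport w) (hwρ : tsupport w ⊆ {p | ρ p ≠ 0})
    (hh : ContMDiff (𝓡 n) 𝓘(ℝ, ℝ) 1 h) (s : ℝ) :
    Integrable (fun p ↦ ρ p ^ s * ⟪grad n w p, grad n h p⟫_ℝ) (riemannianVolume n M) :=
  integrable_rpow_mul hρc (continuous_inner_grad_grad hw hh)
    (hwc.of_isClosed_subset (isClosed_tsupport _) (tsupport_inner_grad_subset w h))
    ((tsupport_inner_grad_subset w h).trans hwρ) s

include hρc hρ1 in
theorem integrable_rpow_mul_inner_grad_weight {w : M → ℝ} (hw : ContMDiff (𝓡 n) 𝓘(ℝ, ℝ) 1 w)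
    (hwc : HasCompactSupport w) (hwρ : tsupport w ⊆ {p | ρ p ≠ 0}) (s : ℝ) :
    Integrable (fun p ↦ ρ p ^ s * ⟪grad n w p, grad n ρ p⟫_ℝ) (riemannianVolume n M) := by
  have hN : tsupport (fun p ↦ 1 * ‖grad n w p‖) ⊆ tsupport w :=
    closure_minimal (fun p hp ↦ by
      by_contra h'
      exact hp (by beta_reduce; rw [grad_eq_zero_of_notMem_tsupport h', norm_zero, mul_zero]))
      (isClosed_tsupport w)
  have := integrable_rpow_mul_inner_grad hρc hρ1 hw (g := fun _ ↦ 1) continuous_const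
    (hwc.of_isClosed_subset (isClosed_tsupport _) hN) (hN.trans hwρ) s
  simpa only [one_mul] using this

include hρc hρL hρ1 in
/-- Green's formula with the weight `ρ ^ s`. -/
theorem integral_rpow_mul_laplacian {w h : M → ℝ} (hw : ContMDiff (𝓡 n) 𝓘(ℝ, ℝ) 1 w)
    (hwc : HasCompactSupport w) (hwρ : tsupport w ⊆ {p | ρ p ≠ 0})
    (hh : ContMDiff (𝓡 n) 𝓘(ℝ, ℝ) ∞ h) (s : ℝ) :
    ∫ p, ρ p ^ s * (w p * laplacian n h p) + (ρ p ^ s * ⟪grad n w p, grad n h p⟫_ℝ +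
      s * (ρ p ^ (s - 1) * (w p * ⟪grad n h p, grad n ρ p⟫_ℝ))) ∂(riemannianVolume n M) = 0 := by
  have hh1 : ContMDiff (𝓡 n) 𝓘(ℝ, ℝ) 1 h := hh.of_le (by simp)
  have hi1 : ∀ w : M → ℝ, ContMDiff (𝓡 n) 𝓘(ℝ, ℝ) 1 w → HasCompactSupport w →
      tsupport w ⊆ {p | ρ p ≠ 0} →
      Integrable (fun p ↦ ρ p ^ s * (w p * laplacian n h p)) (riemannianVolume n M) :=
    fun w hw hwc hwρ ↦ integrable_rpow_mul (g := fun p ↦ w p * laplacian n h p) hρc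
      (hw.continuous.mul (continuous_laplacian hh)) hwc.mul_right
      (tsupport_mul_subset_left.trans hwρ) s
  have hi2 : ∀ w : M → ℝ, ContMDiff (𝓡 n) 𝓘(ℝ, ℝ) 1 w → HasCompactSupport w →
      tsupport w ⊆ {p | ρ p ≠ 0} → Integrable (fun p ↦ ρ p ^ s * ⟪grad n w p, grad n h p⟫_ℝ +
      s * (ρ p ^ (s - 1) * (w p * ⟪grad n h p, grad n ρ p⟫_ℝ))) (riemannianVolume n M) :=
    fun w hw hwc hwρ ↦ (integrable_rpow_mul_inner_grad_grad hρc hw hwc hwρ hh1 s).add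
      ((integrable_rpow_mul_mul_inner_grad hρc hρ1 hh1 hw.continuous hwc hwρ (s - 1)).const_mul s)
  obtain ⟨F, v, hv, hvc, hvρ, hvs, -, hsum⟩ := integral_eq_sum_of_partition (U := {p | ρ p ≠ 0})
    (Φ := fun w p ↦ ρ p ^ s * (w p * laplacian n h p) + (ρ p ^ s * ⟪grad n w p, grad n h p⟫_ℝ +
      s * (ρ p ^ (s - 1) * (w p * ⟪grad n h p, grad n ρ p⟫_ℝ))))
    (fun w hw hwc hwρ ↦ (hi1 w hw hwc hwρ).add (hi2 w hw hwc hwρ))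
    (fun F w hw p ↦ by
      rw [inner_grad_sum F h fun i ↦ (hw i).mdifferentiableAt one_ne_zero]
      simp only [Finset.sum_mul, Finset.mul_sum, Finset.sum_add_distrib]) hw hwc hwρ
  rw [hsum]
  refine Finset.sum_eq_zero fun i _ ↦ ?_
  have hL := lipschitzAround_rpow_mul (hρL i) (hv i) (hvρ i) s
  have hs : tsupport (fun p ↦ ρ p ^ s * v i p) ⊆ (𝔠 i).source :=
    tsupport_mul_subset_right.trans (hvs i)
  have hc : HasCompactSupport fun p ↦ ρ p ^ s * v i p := (hvc i).mul_left
  have h1 : ∫ p, ρ p ^ s * v i p * laplacian n h p ∂(riemannianVolume n M) =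
      -∫ p, ⟪grad n (fun p ↦ ρ p ^ s * v i p) p, grad n h p⟫_ℝ ∂(riemannianVolume n M) :=
    integral_mul_laplacian_of_tsupport_subset_source hL hc hs hh
  rw [integral_congr_ae (ae_inner_grad_rpow_mul hρ1 h (hv i) (hvρ i) s)] at h1
  simp only [mul_assoc] at h1
  rw [integral_add (hi1 _ (hv i) (hvc i) (hvρ i)) (hi2 _ (hv i) (hvc i) (hvρ i)), h1,
    neg_add_cancel]

include hρc hρL hρ1 in
/-- The distributional inequality `Δ ρ ≥ C / ρ` tested against `ρ ^ s * w`. -/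
theorem integral_rpow_mul_inner_grad_le {C : ℝ} (hρ0 : ∀ p, 0 ≤ ρ p)
    (hGE : LaplacianGE n {p | ρ p ≠ 0} ρ fun p ↦ C / ρ p) {w : M → ℝ}
    (hw : ContMDiff (𝓡 n) 𝓘(ℝ, ℝ) 1 w) (hwc : HasCompactSupport w)
    (hwρ : tsupport w ⊆ {p | ρ p ≠ 0}) (hw0 : ∀ p, 0 ≤ w p) (s : ℝ) :
    (C + s) * ∫ p, ρ p ^ (s - 1) * w p ∂(riemannianVolume n M) ≤
      -∫ p, ρ p ^ s * ⟪grad n w p, grad n ρ p⟫_ℝ ∂(riemannianVolume n M) := by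
  have hi1 : ∀ w : M → ℝ, ContMDiff (𝓡 n) 𝓘(ℝ, ℝ) 1 w → HasCompactSupport w →
      tsupport w ⊆ {p | ρ p ≠ 0} →
      Integrable (fun p ↦ ρ p ^ s * ⟪grad n w p, grad n ρ p⟫_ℝ) (riemannianVolume n M) :=
    fun w hw hwc hwρ ↦ integrable_rpow_mul_inner_grad_weight hρc hρ1 hw hwc hwρ s
  have hi2 : ∀ w : M → ℝ, ContMDiff (𝓡 n) 𝓘(ℝ, ℝ) 1 w → HasCompactSupport w →
      tsupport w ⊆ {p | ρ p ≠ 0} → Integrable (fun p ↦ ρ p ^ (s - 1) * w p)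
      (riemannianVolume n M) :=
    fun w hw hwc hwρ ↦ integrable_rpow_mul hρc hw.continuous hwc hwρ (s - 1)
  obtain ⟨F, v, hv, hvc, hvρ, hvs, hv0, hsum⟩ := integral_eq_sum_of_partition (U := {p | ρ p ≠ 0})
    (Φ := fun w p ↦ ρ p ^ s * ⟪grad n w p, grad n ρ p⟫_ℝ + (C + s) * (ρ p ^ (s - 1) * w p))
    (fun w hw hwc hwρ ↦ (hi1 w hw hwc hwρ).add ((hi2 w hw hwc hwρ).const_mul _))
    (fun F w hw p ↦ by
      rw [inner_grad_sum F ρ fun i ↦ (hw i).mdifferentiableAt one_ne_zero]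
      simp only [Finset.mul_sum, Finset.sum_add_distrib]) hw hwc hwρ
  suffices h : ∫ p, ρ p ^ s * ⟪grad n w p, grad n ρ p⟫_ℝ + (C + s) * (ρ p ^ (s - 1) * w p)
      ∂(riemannianVolume n M) ≤ 0 by
    rw [integral_add (hi1 w hw hwc hwρ) ((hi2 w hw hwc hwρ).const_mul _),
      integral_const_mul] at h
    linarith
  rw [hsum]
  refine Finset.sum_nonpos fun i _ ↦ ?_
  have hU : IsOpen {p | ρ p ≠ 0} := isOpen_ne_fun hρc continuous_const
  have hh : ContinuousOn (fun p ↦ C / ρ p) {p | ρ p ≠ 0} :=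
    continuousOn_const.div hρc.continuousOn fun p hp ↦ hp
  have hL := lipschitzAround_rpow_mul (hρL i) (hv i) (hvρ i) s
  have hs : tsupport (fun p ↦ ρ p ^ s * v i p) ⊆ (𝔠 i).source :=
    tsupport_mul_subset_right.trans (hvs i)
  have hsU : tsupport (fun p ↦ ρ p ^ s * v i p) ⊆ {p | ρ p ≠ 0} :=
    tsupport_mul_subset_right.trans (hvρ i)
  have hc : HasCompactSupport fun p ↦ ρ p ^ s * v i p := (hvc i).mul_left
  have h0 : ∀ p, 0 ≤ ρ p ^ s * v i p :=
    fun p ↦ mul_nonneg (Real.rpow_nonneg (hρ0 p) s) (hv0 i p (hw0 p))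
  have h1 : ∫ p, C / ρ p * (ρ p ^ s * v i p) ∂(riemannianVolume n M) ≤
      -∫ p, ⟪grad n (fun p ↦ ρ p ^ s * v i p) p, grad n ρ p⟫_ℝ ∂(riemannianVolume n M) :=
    LaplacianGE.integral_le_of_tsupport_subset_source hU hGE hh (hρL i) hL hc hs hsU h0
  have e1 : ∀ p, C / ρ p * (ρ p ^ s * v i p) = C * (ρ p ^ (s - 1) * v i p) := by
    intro p
    by_cases h0 : ρ p = 0
    · rw [image_eq_zero_of_notMem_tsupport fun h' ↦ hvρ i h' h0]
      ring
    · rw [Real.rpow_sub_one h0]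
      ring
  -- By `|∇ρ| = 1`, differentiating the weight produces `s * ρ ^ (s - 1) * v i`; with the
  -- contribution of `C / ρ` this is the origin of the constant `C + s`.
  have e2 : ∀ᵐ p ∂(riemannianVolume n M),
      ⟪grad n (fun p ↦ ρ p ^ s * v i p) p, grad n ρ p⟫_ℝ =
        ρ p ^ s * ⟪grad n (v i) p, grad n ρ p⟫_ℝ + s * (ρ p ^ (s - 1) * v i p) := by
    filter_upwards [ae_inner_grad_rpow_mul hρ1 ρ (hv i) (hvρ i) s, hρ1] with p hp hp1
    rw [hp]
    by_cases h0 : ρ p = 0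
    · rw [image_eq_zero_of_notMem_tsupport fun h' ↦ hvρ i h' h0]
      ring
    · rw [real_inner_self_eq_norm_sq, hp1 h0, one_pow, mul_one]
  rw [integral_congr_ae (Eventually.of_forall e1), integral_congr_ae e2, integral_const_mul, integral_add (hi1 _ (hv i) (hvc i) (hvρ i))
    ((hi2 _ (hv i) (hvc i) (hvρ i)).const_mul _), integral_const_mul] at h1
  rw [integral_add (hi1 _ (hv i) (hvc i) (hvρ i)) ((hi2 _ (hv i) (hvc i) (hvρ i)).const_mul _),
    integral_const_mul]
  linarith

end Weighted

end Global

/-! ### Properness, Lipschitz charts and finite volume -/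

section Proper

open Filter Topology Metric Manifold

/-- The Hopf–Rinow theorem for length spaces: completeness and local compactness imply
properness. -/
theorem properSpace_of_isLength {X : Type*} [MetricSpace X] [CompleteSpace X]
    [LocallyCompactSpace X]
    (hlen : ∀ x y : X, ∀ t ε : ℝ, 0 ≤ t → t ≤ dist x y → 0 < ε →
      ∃ z, dist x z = t ∧ dist z y < dist x y - t + ε) : ProperSpace X := by
  refine ⟨fun x r₀ ↦ ?_⟩
  -- compactness of a closed ball propagates to slightly larger radii
  have hext : ∀ r, 0 ≤ r → IsCompact (closedBall x r) →
      ∃ δ > 0, IsCompact (closedBall x (r + δ)) := by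
    intro r hr hc
    obtain ⟨K', hK', hKK'⟩ := exists_compact_superset hc
    obtain ⟨δ, hδ, hδK⟩ := hc.exists_thickening_subset_open isOpen_interior hKK'
    refine ⟨δ / 2, by positivity, hK'.of_isClosed_subset isClosed_closedBall fun y hy ↦ ?_⟩
    refine interior_subset (hδK ?_)
    rw [mem_closedBall, dist_comm] at hy
    rcases le_total (dist x y) r with h | h
    · exact self_subset_thickening hδ _ (by rwa [mem_closedBall, dist_comm])
    · obtain ⟨z, hz1, hz2⟩ := hlen x y r (δ / 2) hr h (by positivity)
      exact mem_thickening_iff.2 ⟨z, by rw [mem_closedBall, dist_comm, hz1],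
        by rw [dist_comm]; linarith⟩
  -- compactness passes to the limit radius
  have hlim : ∀ r, 0 < r → (∀ s, 0 ≤ s → s < r → IsCompact (closedBall x s)) →
      IsCompact (closedBall x r) := by
    intro r hr hs
    refine TotallyBounded.isCompact_of_isClosed (totallyBounded_iff.2 fun ε hε ↦ ?_)
      isClosed_closedBall
    set s := max 0 (r - ε / 4) with hs_def
    have hs0 : 0 ≤ s := le_max_left _ _
    have hsr : s < r := max_lt hr (by linarith)
    have hs1 : r - ε / 4 ≤ s := le_max_right _ _
    obtain ⟨t, htf, ht⟩ := totallyBounded_iff.1 (hs s hs0 hsr).totallyBounded (ε / 2)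
      (by positivity)
    refine ⟨t, htf, fun y hy ↦ ?_⟩
    rw [mem_closedBall, dist_comm] at hy
    obtain ⟨z, hz, hzy⟩ : ∃ z ∈ closedBall x s, dist z y < ε / 2 := by
      rcases le_total (dist x y) s with h | h
      · exact ⟨y, by rwa [mem_closedBall, dist_comm], by rw [dist_self]; positivity⟩
      · obtain ⟨z, hz1, hz2⟩ := hlen x y s (ε / 4) hs0 h (by positivity)
        exact ⟨z, by rw [mem_closedBall, dist_comm, hz1], by linarith⟩
    obtain ⟨w, hw, hzw⟩ := Set.mem_iUnion₂.1 (ht hz)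
    refine Set.mem_iUnion₂.2 ⟨w, hw, ?_⟩
    rw [mem_ball] at hzw ⊢
    calc dist y w ≤ dist z y + dist z w := by rw [dist_comm z y]; exact dist_triangle _ _ _
      _ < ε := by linarith
  -- The ball of radius `sInf T` is compact by the limit step, hence so is a slightly larger one,
  -- which contradicts the choice of the infimum.
  by_contra hnot
  set T := {r : ℝ | 0 ≤ r ∧ ¬IsCompact (closedBall x r)} with hT
  have hr₀ : 0 ≤ r₀ := by
    by_contra h
    exact hnot (by rw [closedBall_eq_empty.2 (not_le.1 h)]; exact isCompact_empty)
  have hbdd : BddBelow T := ⟨0, fun r hr ↦ hr.1⟩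
  have hne : T.Nonempty := ⟨r₀, hr₀, hnot⟩
  have hR0 : 0 ≤ sInf T := le_csInf hne fun r hr ↦ hr.1
  have hlt : ∀ s, 0 ≤ s → s < sInf T → IsCompact (closedBall x s) := by
    intro s hs hsT
    by_contra h
    exact absurd (csInf_le hbdd ⟨hs, h⟩) (not_le.2 hsT)
  have hR : IsCompact (closedBall x (sInf T)) := by
    rcases hR0.eq_or_lt with h | h
    · rw [← h, closedBall_zero]
      exact isCompact_singleton
    · exact hlim _ h hlt
  obtain ⟨δ, hδ, hc⟩ := hext _ hR0 hR
  have : sInf T + δ ≤ sInf T := le_csInf hne fun r hr ↦ by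
    by_contra h
    exact hr.2 (hc.of_isClosed_subset isClosed_closedBall
      (closedBall_subset_closedBall (not_le.1 h).le))
  linarith

variable {n : ℕ} {M : Type*} [MetricSpace M] [ChartedSpace (EuclideanSpace ℝ (Fin n)) M]
  [RiemannianBundle (fun p : M ↦ TangentSpace (𝓡 n) p)]

local notation "𝔼" => EuclideanSpace ℝ (Fin n)
local notation "𝔠" => chartAt (EuclideanSpace ℝ (Fin n))

variable (n) in
-- Take a curve of length less than `dist x y + ε` and, by the intermediate value theorem, a point
-- on it at distance `t` from `x`. The two arcs bound the two distances, and their lengths add up.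
theorem exists_dist_eq_of_isRiemannianManifold [IsRiemannianManifold (𝓡 n) M] (x y : M)
    (t ε : ℝ) (ht : 0 ≤ t) (hty : t ≤ dist x y) (hε : 0 < ε) :
    ∃ z, dist x z = t ∧ dist z y < dist x y - t + ε := by
  have hd : ∀ a b : M, riemannianEDist (𝓡 n) a b = ENNReal.ofReal (dist a b) := fun a b ↦ by
    rw [← IsRiemannianManifold.out (I := 𝓡 n) a b, edist_dist]
  have h1 : riemannianEDist (𝓡 n) x y < ENNReal.ofReal (dist x y + ε) := by
    rw [hd]
    exact (ENNReal.ofReal_lt_ofReal_iff (by positivity)).2 (by linarith)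
  obtain ⟨γ, h0, h1, hγ, hlen⟩ := exists_lt_of_riemannianEDist_lt h1
  have hcont : ContinuousOn (fun s ↦ dist x (γ s)) (Set.Icc 0 1) :=
    (continuous_const.dist continuous_id).comp_continuousOn hγ.continuousOn
  obtain ⟨s, hs, hst⟩ := intermediate_value_Icc zero_le_one hcont
    (show t ∈ Set.Icc (dist x (γ 0)) (dist x (γ 1)) by rw [h0, h1, dist_self]; exact ⟨ht, hty⟩)
  refine ⟨γ s, hst, ?_⟩
  have h2 := riemannianEDist_le_pathELength
    (hγ.mono (Set.Icc_subset_Icc_right hs.2)) h0 rfl hs.1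
  have h3 := riemannianEDist_le_pathELength
    (hγ.mono (Set.Icc_subset_Icc_left hs.1)) rfl h1 hs.2
  rw [← pathELength_add hs.1 hs.2] at hlen
  have h4 := (add_le_add h2 h3).trans_lt hlen
  rw [hd, hd, ← ENNReal.ofReal_add dist_nonneg dist_nonneg,
    ENNReal.ofReal_lt_ofReal_iff (by positivity)] at h4
  simp only at hst
  linarith

variable (n M) in
theorem properSpace_of_isRiemannianManifold [IsRiemannianManifold (𝓡 n) M] [CompleteSpace M] :
    ProperSpace M :=
  have := ChartedSpace.locallyCompactSpace 𝔼 M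
  properSpace_of_isLength (exists_dist_eq_of_isRiemannianManifold n)

variable [IsManifold (𝓡 n) ∞ M] [IsContMDiffRiemannianBundle (𝓡 n) ∞ (EuclideanSpace ℝ (Fin n))
      (fun p : M ↦ TangentSpace (𝓡 n) p)]

theorem eventually_norm_mfderiv_symm_le {x : M} {y : 𝔼} (hy : y ∈ (𝔠 x).target) :
    ∃ K : NNReal, ∀ᶠ z in 𝓝 y, ∀ v : 𝔼,
      ‖mfderiv (𝓡 n) (𝓡 n) (𝔠 x).symm z v‖ ≤ K * ‖v‖ := by
  set B : ℝ := ∑ i, ∑ j, (|gramMatrix x y i j| + 1) with hB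
  have hB0 : 0 ≤ B := by positivity
  have hev : ∀ᶠ z in 𝓝 y, ∀ i j, |gramMatrix x z i j| < |gramMatrix x y i j| + 1 := by
    rw [eventually_all]
    intro i
    rw [eventually_all]
    intro j
    have := ((contDiffOn_gramMatrix x i j).continuousOn.continuousAt
      ((𝔠 x).open_target.mem_nhds hy)).abs
    exact this.eventually_lt continuousAt_const (lt_add_one _)
  refine ⟨⟨√B, Real.sqrt_nonneg _⟩, hev.mono fun z hz v ↦ ?_⟩
  have h1 : ‖mfderiv (𝓡 n) (𝓡 n) (𝔠 x).symm z v‖ ^ 2 ≤ B * ‖v‖ ^ 2 := by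
    rw [← real_inner_self_eq_norm_sq, inner_mfderiv_symm, hB, Finset.sum_mul]
    refine Finset.sum_le_sum fun i _ ↦ ?_
    rw [Finset.sum_mul]
    refine Finset.sum_le_sum fun j _ ↦ ?_
    calc v i * v j * gramMatrix x z i j ≤ |v i| * |v j| * |gramMatrix x z i j| := by
          rw [← abs_mul, ← abs_mul]; exact le_abs_self _
      _ ≤ ‖v‖ * ‖v‖ * (|gramMatrix x y i j| + 1) := by
          gcongr
          · exact PiLp.norm_apply_le v i
          · exact PiLp.norm_apply_le v j
          · exact (hz i j).le
      _ = _ := by ring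
  refine le_of_sq_le_sq ?_ (mul_nonneg (Real.sqrt_nonneg _) (norm_nonneg v))
  rw [mul_pow]
  change _ ≤ √B ^ 2 * _
  rwa [Real.sq_sqrt hB0]

/-- The inverse chart maps a segment to a curve whose length bounds the Riemannian distance, and its
speed is bounded near `y`. Functions locally Lipschitz for the distance of `M` thus become locally
Lipschitz in coordinates. -/
theorem lipschitzAround_chart_symm [IsRiemannianManifold (𝓡 n) M] {x : M} {y : 𝔼}
    (hy : y ∈ (𝔠 x).target) : LipschitzAround (𝔠 x).symm y := by
  have : IsManifold (𝓡 n) 1 M := IsManifold.of_le (n := ∞) (by simp)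
  obtain ⟨K, hK⟩ := eventually_norm_mfderiv_symm_le hy
  obtain ⟨r, hr, hball⟩ := Metric.mem_nhds_iff.1 (hK.and ((𝔠 x).open_target.mem_nhds hy))
  refine ⟨K, ball y r, ball_mem_nhds y hr, fun a ha b hb ↦ ?_⟩
  have hη : ∀ t ∈ Set.Icc (0 : ℝ) 1, ContinuousAffineMap.lineMap (R := ℝ) a b t ∈ ball y r := by
    intro t ht
    rw [ContinuousAffineMap.coe_lineMap_eq]
    exact (convex_ball y r).lineMap_mem ha hb ht
  have hηs : ContMDiff 𝓘(ℝ, ℝ) (𝓡 n) 1 (ContinuousAffineMap.lineMap (R := ℝ) a b) := by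
    rw [contMDiff_iff_contDiff]
    exact ContinuousAffineMap.contDiff _
  have hγ : ContMDiffOn 𝓘(ℝ, ℝ) (𝓡 n) 1
      ((𝔠 x).symm ∘ ContinuousAffineMap.lineMap (R := ℝ) a b) (Set.Icc 0 1) :=
    (contMDiffOn_chart_symm (I := 𝓡 n) (n := 1) (x := x)).comp hηs.contMDiffOn
      fun t ht ↦ (hball (hη t ht)).2
  rw [IsRiemannianManifold.out (I := 𝓡 n)]
  refine (riemannianEDist_le_pathELength hγ (by simp [ContinuousAffineMap.coe_lineMap_eq])
    (by simp [ContinuousAffineMap.coe_lineMap_eq]) zero_le_one).trans ?_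
  rw [pathELength_eq_lintegral_mfderiv_Icc]
  have hbd : ∀ t ∈ Set.Icc (0 : ℝ) 1, ‖mfderiv 𝓘(ℝ, ℝ) (𝓡 n)
      ((𝔠 x).symm ∘ ContinuousAffineMap.lineMap (R := ℝ) a b) t 1‖ₑ ≤ K * edist a b := by
    intro t ht
    have h1 : MDifferentiableAt (𝓡 n) (𝓡 n) (𝔠 x).symm
        (ContinuousAffineMap.lineMap (R := ℝ) a b t) :=
      (contMDiffOn_chart_symm (I := 𝓡 n) (n := 1) (x := x)).mdifferentiableOn one_ne_zero _
        (hball (hη t ht)).2 |>.mdifferentiableAt ((𝔠 x).open_target.mem_nhds (hball (hη t ht)).2)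
    have h2 := mfderiv_comp_apply t h1 (hηs.mdifferentiableAt one_ne_zero) 1
    have h3 : mfderiv 𝓘(ℝ, ℝ) (𝓡 n) (ContinuousAffineMap.lineMap (R := ℝ) a b) t 1 = b - a := by
      rw [mfderiv_eq_fderiv]
      exact show fderiv ℝ (ContinuousAffineMap.lineMap (R := ℝ) a b) t (1 : ℝ) = b - a by simp
    rw [h2, h3, edist_comm, edist_eq_enorm_sub]
    have h4 := (hball (hη t ht)).1 (b - a)
    simp only [enorm_eq_nnnorm]
    rw [← ENNReal.coe_mul, ENNReal.coe_le_coe]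
    exact h4
  refine (setLIntegral_mono' measurableSet_Icc hbd).trans ?_
  simp

theorem LocallyLipschitz.lipschitzAround_comp_chart_symm [IsRiemannianManifold (𝓡 n) M]
    {ρ : M → ℝ} (hρ : LocallyLipschitz ρ) (x : M) {y : 𝔼} (hy : y ∈ (𝔠 x).target) :
    LipschitzAround (ρ ∘ (𝔠 x).symm) y :=
  LipschitzAround.comp (hρ _) (lipschitzAround_chart_symm hy)

variable [MeasurableSpace M] [BorelSpace M]

/-- In a proper space a bounded set has compact closure, and the volume is locally finite. -/
theorem riemannianVolume_lt_top_of_isBounded [ProperSpace M] {Ω : Set M}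
    (hΩ : Bornology.IsBounded Ω) : riemannianVolume n M Ω < ⊤ := by
  have := isLocallyFiniteMeasure_riemannianVolume (n := n) (M := M)
  exact (measure_mono subset_closure).trans_lt hΩ.isCompact_closure.measure_lt_top

end Proper

/-! ### From a flux inequality to an `L ^ q` bound -/

section Interpolation

theorem rpow_add_le_two_rpow_mul {a b p : ℝ} (ha : 0 ≤ a) (hb : 0 ≤ b) (hp : 1 ≤ p) :
    (a + b) ^ p ≤ 2 ^ (p - 1) * (a ^ p + b ^ p) := by
  lift a to NNReal using ha
  lift b to NNReal using hb
  exact_mod_cast NNReal.rpow_add_le_mul_rpow_add_rpow a b hp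

/-- Young's inequality for the flux of `|c| ^ q` in the direction `v`, after completing the
square. -/
theorem neg_flux_le {q k γ u v c : ℝ} (hq : 1 < q) (hk : 0 < k) (hvu : |v| ≤ u) :
    -(q * (|c| ^ (q - 2) * c * v)) ≤ (q * γ + k * (1 - q⁻¹)) * |c| ^ q +
      k * q⁻¹ * (q / k) ^ q * √(u ^ 2 + 2 * γ * (c * v) + γ ^ 2 * c ^ 2) ^ q := by
  have hq0 : 0 < q := by linarith
  set b := √(u ^ 2 + 2 * γ * (c * v) + γ ^ 2 * c ^ 2) with hb_def
  -- The square `b ^ 2` exceeds `(v + γ * c) ^ 2` by `u ^ 2 - v ^ 2 ≥ 0`.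
  have hb : |v + γ * c| ≤ b := by
    refine Real.abs_le_sqrt ?_
    nlinarith [sq_le_sq' (abs_le.1 hvu).1 (abs_le.1 hvu).2]
  have hb0 : 0 ≤ b := Real.sqrt_nonneg _
  rcases eq_or_ne c 0 with rfl | hc
  · rw [mul_zero, zero_mul, mul_zero, neg_zero, abs_zero, Real.zero_rpow hq0.ne', mul_zero, zero_add]
    positivity
  have hc0 : 0 < |c| := abs_pos.2 hc
  have h1 : |c| ^ (q - 2) * c * c = |c| ^ q := by
    rw [mul_assoc, ← sq, ← sq_abs, ← Real.rpow_natCast, ← Real.rpow_add hc0]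
    norm_num
  have h2 : -(|c| ^ (q - 2) * c * (v + γ * c)) ≤ |c| ^ (q - 1) * b := by
    calc -(|c| ^ (q - 2) * c * (v + γ * c)) ≤ |(|c| ^ (q - 2) * c * (v + γ * c))| :=
          neg_le_abs _
      _ = |c| ^ (q - 1) * |v + γ * c| := by
          rw [abs_mul, abs_mul, abs_of_nonneg (Real.rpow_nonneg hc0.le _),
            ← Real.rpow_add_one hc0.ne']
          ring_nf
      _ ≤ _ := by gcongr
  -- Young's inequality with exponents `q / (q - 1)` and `q`. The scaling `q / k` makes the term in
  -- `|c| ^ q` cost only `k * (1 - q⁻¹)` after multiplication by `k`, less than the available `k`.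
  have h3 : |c| ^ (q - 1) * ((q / k) * b) ≤ (1 - q⁻¹) * |c| ^ q + q⁻¹ * ((q / k) ^ q * b ^ q) := by
    have := Real.geom_mean_le_arith_mean2_weighted (w₁ := 1 - q⁻¹) (w₂ := q⁻¹)
      (p₁ := |c| ^ q) (p₂ := ((q / k) * b) ^ q)
      (by rw [sub_nonneg]; exact inv_le_one_of_one_le₀ hq.le) (by positivity) (by positivity)
      (by positivity) (by ring)
    rwa [← Real.rpow_mul hc0.le, ← Real.rpow_mul (by positivity), mul_inv_cancel₀ hq0.ne',
      Real.rpow_one, mul_sub, mul_one, mul_inv_cancel₀ hq0.ne',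
      Real.mul_rpow (by positivity : 0 ≤ q / k) hb0] at this
  have h4 : q * (|c| ^ (q - 1) * b) = k * (|c| ^ (q - 1) * ((q / k) * b)) := by
    field_simp
  have h5 : -(q * (|c| ^ (q - 2) * c * v)) =
      q * -(|c| ^ (q - 2) * c * (v + γ * c)) + q * γ * (|c| ^ (q - 2) * c * c) := by ring
  rw [h5, h1]
  linarith [mul_le_mul_of_nonneg_left h2 hq0.le, mul_le_mul_of_nonneg_left h3 hk.le]

theorem le_sqrt_add_abs {γ u v c : ℝ} (hγ : 0 ≤ γ) (hvu : |v| ≤ u) :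
    u ≤ √(u ^ 2 + 2 * γ * (c * v) + γ ^ 2 * c ^ 2) + γ * |c| := by
  rw [← sub_le_iff_le_add]
  refine Real.le_sqrt_of_sq_le ?_
  have h1 : -(|c| * u) ≤ c * v := by
    refine (neg_le_neg ?_).trans (neg_abs_le _)
    rw [abs_mul]
    gcongr
  nlinarith [sq_abs c, mul_le_mul_of_nonneg_left h1 hγ]

variable {X : Type*} [MeasurableSpace X] {μ : Measure X}

/-- Hölder's inequality on a set of finite measure, for exponents `q < 2`. -/
theorem integral_sqrt_rpow_le {q : ℝ} (hq : 1 < q) (hq2 : q < 2) {Ω : Set X}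
    (hΩ : MeasurableSet Ω) (hΩf : μ Ω ≠ ⊤) {Z : X → ℝ} (hZ : Integrable Z μ)
    (hZ0 : ∀ᵐ x ∂μ, 0 ≤ Z x) (hZΩ : ∀ x ∉ Ω, Z x = 0) :
    Integrable (fun x ↦ √(Z x) ^ q) μ ∧
      ∫ x, √(Z x) ^ q ∂μ ≤ (∫ x, Z x ∂μ) ^ (q / 2) * μ.real Ω ^ (1 - q / 2) := by
  have hq0 : 0 < q := by linarith
  -- The factor paired with `√Z ^ q` is the indicator of `Ω`, outside which `Z` vanishes.
  have hconj : (2 / q).HolderConjugate (2 / (2 - q)) := by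
    rw [Real.holderConjugate_iff]
    refine ⟨by rw [lt_div_iff₀ hq0]; linarith, ?_⟩
    field_simp
    ring
  have e : ∀ᵐ x ∂μ, (√(Z x) ^ q) ^ (2 / q) = Z x := by
    filter_upwards [hZ0] with x hx
    rw [← Real.rpow_mul (Real.sqrt_nonneg _), mul_div_cancel₀ _ hq0.ne']
    simpa using Real.sq_sqrt hx
  have hm : AEStronglyMeasurable (fun x ↦ √(Z x) ^ q) μ :=
    ((Real.continuous_sqrt.comp_aestronglyMeasurable hZ.1).aemeasurable.pow_const
      q).aestronglyMeasurable
  have hf : MemLp (fun x ↦ √(Z x) ^ q) (ENNReal.ofReal (2 / q)) μ := by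
    have h2q : 0 < 2 / q := by positivity
    rw [← integrable_norm_rpow_iff hm (by simpa using h2q) ENNReal.ofReal_ne_top,
      ENNReal.toReal_ofReal h2q.le]
    refine hZ.congr ?_
    filter_upwards [e] with x hx
    rw [Real.norm_of_nonneg (by positivity), hx]
  have hg : MemLp (Ω.indicator fun _ ↦ (1 : ℝ)) (ENNReal.ofReal (2 / (2 - q))) μ :=
    memLp_indicator_const _ hΩ _ (Or.inr hΩf)
  have hfg : ∀ x, √(Z x) ^ q * Ω.indicator (fun _ ↦ (1 : ℝ)) x = √(Z x) ^ q := by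
    intro x
    by_cases hx : x ∈ Ω
    · rw [Set.indicator_of_mem hx, mul_one]
    · rw [hZΩ x hx, Real.sqrt_zero, Real.zero_rpow hq0.ne', zero_mul]
  have hpq : (ENNReal.ofReal (2 / q)).HolderConjugate (ENNReal.ofReal (2 / (2 - q))) :=
    hconj.ennrealOfReal
  constructor
  · have := hf.integrable_mul hg
    exact this.congr (Filter.Eventually.of_forall hfg)
  · have := integral_mul_le_Lp_mul_Lq_of_nonneg hconj
      (Filter.Eventually.of_forall fun x ↦ Real.rpow_nonneg (Real.sqrt_nonneg (Z x)) q)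
      (Filter.Eventually.of_forall fun x ↦ Set.indicator_nonneg (fun _ _ ↦ zero_le_one) x) hf hg
    have h1 : ∀ x, Ω.indicator (fun _ ↦ (1 : ℝ)) x ^ (2 / (2 - q)) =
        Ω.indicator (fun _ ↦ (1 : ℝ)) x := by
      intro x
      by_cases hx : x ∈ Ω
      · simp [hx]
      · simp only [Set.indicator_of_notMem hx]
        rw [Real.zero_rpow]
        exact (div_pos two_pos (by linarith)).ne'
    simp only [hfg, h1] at this
    rw [integral_congr_ae e, integral_indicator hΩ, setIntegral_const, smul_eq_mul, mul_one] at this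
    convert this using 3
    · field_simp
    · field_simp

/-- If the flux of `|c| ^ q` controls its integral, then the `L ^ q` norm of `u` is controlled by
the `L ^ 2` norm of the completed square. -/
theorem integral_rpow_le_of_flux {q k γ : ℝ} (hq : 1 < q) (hq2 : q < 2) (hk : 0 < k)
    (hγ : 0 ≤ γ) (hγk : γ * (2 - q) ≤ k) {Ω : Set X} (hΩ : MeasurableSet Ω) (hΩf : μ Ω ≠ ⊤)
    {u v c : X → ℝ} (hvu : ∀ᵐ x ∂μ, |v x| ≤ u x)
    (hZ : Integrable (fun x ↦ u x ^ 2 + 2 * γ * (c x * v x) + γ ^ 2 * c x ^ 2) μ)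
    (hZΩ : ∀ x ∉ Ω, u x ^ 2 + 2 * γ * (c x * v x) + γ ^ 2 * c x ^ 2 = 0)
    (hc : Integrable (fun x ↦ |c x| ^ q) μ)
    (hcv : Integrable (fun x ↦ q * (|c x| ^ (q - 2) * c x * v x)) μ)
    (hX : (k + q * γ) * ∫ x, |c x| ^ q ∂μ ≤ -∫ x, q * (|c x| ^ (q - 2) * c x * v x) ∂μ) :
    (∫ x, u x ^ q ∂μ) ^ (2 / q) ≤ (2 ^ (q - 1) * (1 + (q / (2 - q)) ^ q)) ^ (2 / q) *
      μ.real Ω ^ (2 / q - 1) * ∫ x, u x ^ 2 + 2 * γ * (c x * v x) + γ ^ 2 * c x ^ 2 ∂μ := by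
  have hq0 : 0 < q := by linarith
  have hZ0 : ∀ᵐ x ∂μ, 0 ≤ u x ^ 2 + 2 * γ * (c x * v x) + γ ^ 2 * c x ^ 2 := by
    filter_upwards [hvu] with x hx
    nlinarith [sq_le_sq' (abs_le.1 hx).1 (abs_le.1 hx).2, sq_nonneg (v x + γ * c x)]
  obtain ⟨hbi, hb⟩ := integral_sqrt_rpow_le hq hq2 hΩ hΩf hZ hZ0 hZΩ
  set Z : X → ℝ := fun x ↦ u x ^ 2 + 2 * γ * (c x * v x) + γ ^ 2 * c x ^ 2 with hZ_def
  set Y := ∫ x, √(Z x) ^ q ∂μ with hY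
  have hY0 : 0 ≤ Y := integral_nonneg fun x ↦ by positivity
  have hS0 : 0 ≤ ∫ x, Z x ∂μ := integral_nonneg_of_ae hZ0
  have hX1 : ∫ x, |c x| ^ q ∂μ ≤ (q / k) ^ q * Y := by
    have h1 : -∫ x, q * (|c x| ^ (q - 2) * c x * v x) ∂μ ≤
        (q * γ + k * (1 - q⁻¹)) * ∫ x, |c x| ^ q ∂μ + k * q⁻¹ * (q / k) ^ q * Y := by
      rw [← integral_neg, hY, ← integral_const_mul, ← integral_const_mul,
        ← integral_add (hc.const_mul _) (hbi.const_mul _)]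
      refine integral_mono_ae hcv.neg ((hc.const_mul _).add (hbi.const_mul _)) ?_
      filter_upwards [hvu] with x hx
      exact neg_flux_le hq hk hx
    -- The terms `q * γ` cancel, and the Young term is absorbed by `k`, leaving `k * q⁻¹`.
    have h2 : k * q⁻¹ * ∫ x, |c x| ^ q ∂μ ≤ k * q⁻¹ * ((q / k) ^ q * Y) := by
      linarith [hX.trans h1]
    exact le_of_mul_le_mul_left h2 (by positivity)
  have hJ : ∫ x, u x ^ q ∂μ ≤ 2 ^ (q - 1) * (1 + (q / (2 - q)) ^ q) * Y := by
    have h1 : ∫ x, u x ^ q ∂μ ≤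
        ∫ x, 2 ^ (q - 1) * (√(Z x) ^ q + γ ^ q * |c x| ^ q) ∂μ := by
      refine integral_mono_of_nonneg ?_ ((hbi.add (hc.const_mul _)).const_mul _) ?_
      · filter_upwards [hvu] with x hx
        exact Real.rpow_nonneg ((abs_nonneg _).trans hx) q
      · filter_upwards [hvu] with x hx
        rw [← Real.mul_rpow hγ (abs_nonneg _)]
        refine le_trans (Real.rpow_le_rpow ((abs_nonneg _).trans hx)
          (le_sqrt_add_abs (c := c x) hγ hx) hq0.le) ?_
        exact rpow_add_le_two_rpow_mul (Real.sqrt_nonneg _) (by positivity) hq.le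
    rw [integral_const_mul, integral_add hbi (hc.const_mul _), integral_const_mul] at h1
    -- By `hγk`, `γ * (q / k) ≤ q / (2 - q)`: here the dependence on `γ` and `k` disappears from the
    -- constant.
    have h2 : γ ^ q * ∫ x, |c x| ^ q ∂μ ≤ (q / (2 - q)) ^ q * Y := by
      calc γ ^ q * ∫ x, |c x| ^ q ∂μ ≤ γ ^ q * ((q / k) ^ q * Y) := by gcongr
        _ = (γ * (q / k)) ^ q * Y := by rw [Real.mul_rpow hγ (by positivity), mul_assoc]
        _ ≤ (q / (2 - q)) ^ q * Y := by
          gcongr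
          have h2q : 0 < 2 - q := by linarith
          rw [← mul_div_assoc, div_le_div_iff₀ hk h2q]
          nlinarith
    refine h1.trans ?_
    rw [mul_assoc, add_mul, one_mul]
    exact mul_le_mul_of_nonneg_left (add_le_add le_rfl h2) (by positivity)
  have hu0 : 0 ≤ ∫ x, u x ^ q ∂μ := integral_nonneg_of_ae (by
    filter_upwards [hvu] with x hx
    exact Real.rpow_nonneg ((abs_nonneg _).trans hx) q)
  have h2q : 0 < 2 - q := by linarith
  have hV : 0 ≤ μ.real Ω := measureReal_nonneg
  calc (∫ x, u x ^ q ∂μ) ^ (2 / q)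
      ≤ (2 ^ (q - 1) * (1 + (q / (2 - q)) ^ q) *
          ((∫ x, Z x ∂μ) ^ (q / 2) * μ.real Ω ^ (1 - q / 2))) ^ (2 / q) := by
        refine Real.rpow_le_rpow hu0 (hJ.trans ?_) (by positivity)
        gcongr
    _ = _ := by
        rw [Real.mul_rpow (x := 2 ^ (q - 1) * (1 + (q / (2 - q)) ^ q)) (by positivity)
          (by positivity), Real.mul_rpow (x := (∫ x, Z x ∂μ) ^ (q / 2)) (by positivity)
          (by positivity), ← Real.rpow_mul hS0, ← Real.rpow_mul hV,
          show q / 2 * (2 / q) = 1 by field_simp, Real.rpow_one,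
          show (1 - q / 2) * (2 / q) = 2 / q - 1 by field_simp]
        ring

end Interpolation

/-! ### The weighted estimates and the Rellich inequality -/

section Rellich

variable {n : ℕ} {M : Type*} [MetricSpace M] [ChartedSpace (EuclideanSpace ℝ (Fin n)) M]
  [IsManifold (𝓡 n) ∞ M] [RiemannianBundle (fun p : M ↦ TangentSpace (𝓡 n) p)]
  [IsContMDiffRiemannianBundle (𝓡 n) ∞ (EuclideanSpace ℝ (Fin n))
      (fun p : M ↦ TangentSpace (𝓡 n) p)]
  [MeasurableSpace M] [BorelSpace M] [SecondCountableTopology M]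
  {ρ : M → ℝ} (hρc : Continuous ρ) (hρ0 : ∀ p, 0 ≤ ρ p)
  (hρL : ∀ x : M, ∀ y ∈ (chartAt (EuclideanSpace ℝ (Fin n)) x).target,
    LipschitzAround (ρ ∘ (chartAt (EuclideanSpace ℝ (Fin n)) x).symm) y)
  (hρ1 : ∀ᵐ p ∂(riemannianVolume n M), ρ p ≠ 0 → ‖grad n ρ p‖ = 1)
  {C : ℝ} (hGE : LaplacianGE n {p | ρ p ≠ 0} ρ fun p ↦ C / ρ p)
  {φ : M → ℝ} (hφ : ContMDiff (𝓡 n) 𝓘(ℝ, ℝ) ∞ φ) (hφc : HasCompactSupport φ)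
  (hφρ : tsupport φ ⊆ {p | ρ p ≠ 0})

/-- The density `ρ ^ β * |∇φ + γ (φ / ρ) ∇ρ| ^ 2`, expanded using `|∇ρ| = 1`. -/
def squareDensity (n : ℕ) {M : Type*} [MetricSpace M]
    [ChartedSpace (EuclideanSpace ℝ (Fin n)) M] [IsManifold (𝓡 n) ∞ M]
    [RiemannianBundle (fun p : M ↦ TangentSpace (𝓡 n) p)] (ρ φ : M → ℝ) (β γ : ℝ) (p : M) : ℝ :=
  ρ p ^ β * ⟪grad n φ p, grad n φ p⟫_ℝ +
    2 * γ * (ρ p ^ (β - 1) * (φ p * ⟪grad n φ p, grad n ρ p⟫_ℝ)) +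
    γ ^ 2 * (ρ p ^ (β - 2) * φ p ^ 2)

include hρc hρ1 hφ hφc hφρ in
theorem integrable_squareDensity (β γ : ℝ) :
    Integrable (squareDensity n ρ φ β γ) (riemannianVolume n M) := by
  have hφ1 : ContMDiff (𝓡 n) 𝓘(ℝ, ℝ) 1 φ := hφ.of_le (by simp)
  refine ((integrable_rpow_mul_inner_grad_grad hρc hφ1 hφc hφρ hφ1 β).add
    ((integrable_rpow_mul_mul_inner_grad hρc hρ1 hφ1 hφ1.continuous hφc hφρ (β - 1)).const_mul
      (2 * γ))).add (Integrable.const_mul ?_ (γ ^ 2))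
  simp only [sq (φ _)]
  exact integrable_rpow_mul (g := fun p ↦ φ p * φ p) hρc (hφ1.continuous.mul hφ1.continuous)
    hφc.mul_left (tsupport_mul_subset_left.trans hφρ) (β - 2)

include hρc hρ0 hρL hρ1 hGE hφ hφc hφρ in
/-- Integration by parts and the distributional inequality for `ρ`, tested against `φ ^ 2`. -/
theorem integral_squareDensity_add_le {β γ : ℝ} (hβ : β < 0) (hγ : 0 < γ)
    (hCγ : C + (β - 1) = 2 * γ) :
    ∫ p, squareDensity n ρ φ β γ p ∂(riemannianVolume n M) +
        γ * (γ - β) * ∫ p, ρ p ^ (β - 2) * φ p ^ 2 ∂(riemannianVolume n M) ≤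
      -∫ p, ρ p ^ β * (φ p * laplacian n φ p) ∂(riemannianVolume n M) := by
  have hφ1 : ContMDiff (𝓡 n) 𝓘(ℝ, ℝ) 1 φ := hφ.of_le (by simp)
  have hφ2 : ContMDiff (𝓡 n) 𝓘(ℝ, ℝ) 1 fun p ↦ φ p ^ 2 := hφ1.pow 2
  have hcs : HasCompactSupport fun p ↦ φ p ^ 2 := by
    simp only [sq]
    exact hφc.mul_left
  have hts : tsupport (fun p ↦ φ p ^ 2) ⊆ {p | ρ p ≠ 0} := by
    simp only [sq]
    exact tsupport_mul_subset_left.trans hφρ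
  have hi0 : Integrable (fun p ↦ ρ p ^ β * (φ p * laplacian n φ p)) (riemannianVolume n M) :=
    integrable_rpow_mul (g := fun p ↦ φ p * laplacian n φ p) hρc
      (hφ1.continuous.mul (continuous_laplacian hφ)) hφc.mul_right
      (tsupport_mul_subset_left.trans hφρ) β
  have hi1 := integrable_rpow_mul_inner_grad_grad hρc hφ1 hφc hφρ hφ1 β
  have hi2 := integrable_rpow_mul_mul_inner_grad hρc hρ1 hφ1 hφ1.continuous hφc hφρ (β - 1)
  have hi3 : Integrable (fun p ↦ ρ p ^ (β - 2) * φ p ^ 2) (riemannianVolume n M) :=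
    integrable_rpow_mul hρc hφ2.continuous hcs hts (β - 2)
  have hG := integral_rpow_mul_laplacian hρc hρL hρ1 hφ1 hφc hφρ hφ β
  have hi12 : ∀ a : ℝ, Integrable (fun p ↦ ρ p ^ β * ⟪grad n φ p, grad n φ p⟫_ℝ +
      a * (ρ p ^ (β - 1) * (φ p * ⟪grad n φ p, grad n ρ p⟫_ℝ))) (riemannianVolume n M) :=
    fun a ↦ hi1.add (hi2.const_mul a)
  rw [integral_add hi0 (hi12 β), integral_add hi1 (hi2.const_mul β),
    integral_const_mul] at hG
  have hH := integral_rpow_mul_inner_grad_le hρc hρL hρ1 hρ0 hGE hφ2 hcs hts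
    (fun p ↦ sq_nonneg _) (β - 1)
  have e : ∀ p, ρ p ^ (β - 1) * ⟪grad n (fun p ↦ φ p ^ 2) p, grad n ρ p⟫_ℝ =
      2 * (ρ p ^ (β - 1) * (φ p * ⟪grad n φ p, grad n ρ p⟫_ℝ)) := by
    intro p
    rw [inner_grad_comp (g := fun x ↦ x ^ 2) ρ (differentiableAt_pow 2)
      (hφ1.mdifferentiableAt one_ne_zero)]
    simp
    ring
  rw [integral_congr_ae (Filter.Eventually.of_forall e), integral_const_mul, hCγ,
    show β - 1 - 1 = β - 2 by ring] at hH
  unfold squareDensity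
  rw [integral_add (hi12 (2 * γ)) (hi3.const_mul _),
    integral_add hi1 (hi2.const_mul _), integral_const_mul, integral_const_mul]
  -- The inequality `hH` bounds the mixed integral from above; it enters with the coefficient `2 * γ
  -- - β > 0`.
  nlinarith

include hρ0 hφρ in
-- Distributes the weight over the three functions `u`, `v`, `c` of the abstract estimate; where `ρ`
-- vanishes, so do `φ` and its gradient.
theorem sq_add_eq_squareDensity (β γ : ℝ) (p : M) :
    (ρ p ^ (β / 2) * ‖grad n φ p‖) ^ 2 + 2 * γ * (ρ p ^ (β / 2 - 1) * φ p *
      (ρ p ^ (β / 2) * ⟪grad n φ p, grad n ρ p⟫_ℝ)) + γ ^ 2 * (ρ p ^ (β / 2 - 1) * φ p) ^ 2 =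
      squareDensity n ρ φ β γ p := by
  unfold squareDensity
  rcases (hρ0 p).eq_or_lt with h | h
  · have hp : p ∉ tsupport φ := fun h' ↦ hφρ h' h.symm
    rw [grad_eq_zero_of_notMem_tsupport hp, image_eq_zero_of_notMem_tsupport hp]
    simp
  · have h1 : ρ p ^ β = (ρ p ^ (β / 2)) ^ 2 := by
      rw [← Real.rpow_mul_natCast h.le]
      norm_num
    have h2 : ρ p ^ (β - 2) = (ρ p ^ (β / 2 - 1)) ^ 2 := by
      rw [← Real.rpow_mul_natCast h.le]
      norm_num
      ring_nf
    have h3 : ρ p ^ (β - 1) = ρ p ^ (β / 2 - 1) * ρ p ^ (β / 2) := by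
      rw [← Real.rpow_add h]
      ring_nf
    rw [h1, h2, h3, real_inner_self_eq_norm_sq]
    ring

include hρc hρ0 hρL hρ1 hGE hφ hφc hφρ in
/-- The weighted `L ^ q` norm of the gradient is controlled by the completed square. -/
theorem integral_norm_grad_rpow_le {q : ℝ} (hq : 1 < q) (hq2 : q < 2) {Ω : Set M}
    (hΩ : MeasurableSet Ω) (hΩf : riemannianVolume n M Ω ≠ ⊤) (hφΩ : tsupport φ ⊆ Ω) {β γ : ℝ}
    (hβ : β < 0) (hγ : 0 < γ) (hCγ : C + (β - 1) = 2 * γ) :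
    (∫ p, ‖grad n φ p‖ ^ q * ρ p ^ (q * β / 2) ∂(riemannianVolume n M)) ^ (2 / q) ≤
      (2 ^ (q - 1) * (1 + (q / (2 - q)) ^ q)) ^ (2 / q) *
        (riemannianVolume n M).real Ω ^ (2 / q - 1) *
          ∫ p, squareDensity n ρ φ β γ p ∂(riemannianVolume n M) := by
  have hq0 : 0 < q := by linarith
  have hφ1 : ContMDiff (𝓡 n) 𝓘(ℝ, ℝ) 1 φ := hφ.of_le (by simp)
  -- `q > 1` makes `|φ| ^ q` continuously differentiable, though in general not smooth; for its sake
  -- the weighted formulas allow `C¹` functions `w`.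
  have hφq : ContMDiff (𝓡 n) 𝓘(ℝ, ℝ) 1 fun p ↦ |φ p| ^ q :=
    (contDiff_norm_rpow (E := ℝ) hq).comp_contMDiff hφ1
  have hsub : tsupport (fun p ↦ |φ p| ^ q) ⊆ tsupport φ :=
    closure_mono fun p hp h0 ↦ hp (by
      beta_reduce
      rw [h0, abs_zero, Real.zero_rpow hq0.ne'])
  have hcs : HasCompactSupport fun p ↦ |φ p| ^ q :=
    hφc.of_isClosed_subset (isClosed_tsupport _) hsub
  -- The exponent for which `ρ ^ (s - 1) * |φ| ^ q` is `|c| ^ q` with `c = ρ ^ (β / 2 - 1) * φ`.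
  set s := q * β / 2 - q + 1 with hs
  have e1 : ∀ p, |ρ p ^ (β / 2 - 1) * φ p| ^ q = ρ p ^ (s - 1) * |φ p| ^ q := by
    intro p
    rw [abs_mul, abs_of_nonneg (Real.rpow_nonneg (hρ0 p) _),
      Real.mul_rpow (Real.rpow_nonneg (hρ0 p) _) (abs_nonneg _), ← Real.rpow_mul (hρ0 p)]
    congr 2
    rw [hs]
    ring
  have e2 : ∀ p, q * (|ρ p ^ (β / 2 - 1) * φ p| ^ (q - 2) * (ρ p ^ (β / 2 - 1) * φ p) *
      (ρ p ^ (β / 2) * ⟪grad n φ p, grad n ρ p⟫_ℝ)) =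
      ρ p ^ s * ⟪grad n (fun p ↦ |φ p| ^ q) p, grad n ρ p⟫_ℝ := by
    intro p
    rcases (hρ0 p).eq_or_lt with h | h
    · have hp : p ∉ tsupport φ := fun h' ↦ hφρ h' h.symm
      rw [grad_eq_zero_of_notMem_tsupport hp,
        grad_eq_zero_of_notMem_tsupport fun h' ↦ hp (hsub h')]
      simp
    · rw [inner_grad_comp (g := fun x ↦ |x| ^ q) ρ (hasDerivAt_abs_rpow _ hq).differentiableAt
        (hφ1.mdifferentiableAt one_ne_zero), (hasDerivAt_abs_rpow _ hq).deriv, abs_mul,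
        abs_of_nonneg (Real.rpow_nonneg h.le _),
        Real.mul_rpow (Real.rpow_nonneg h.le _) (abs_nonneg _), ← Real.rpow_mul h.le]
      have h3 : ρ p ^ s = ρ p ^ ((β / 2 - 1) * (q - 2)) * ρ p ^ (β / 2 - 1) * ρ p ^ (β / 2) := by
        rw [← Real.rpow_add h, ← Real.rpow_add h]
        congr 1
        rw [hs]
        ring
      rw [h3]
      ring
  have e3 : ∀ p, (ρ p ^ (β / 2) * ‖grad n φ p‖) ^ q =
      ‖grad n φ p‖ ^ q * ρ p ^ (q * β / 2) := by
    intro p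
    rw [Real.mul_rpow (Real.rpow_nonneg (hρ0 p) _) (norm_nonneg _), ← Real.rpow_mul (hρ0 p),
      mul_comm]
    congr 2
    ring
  -- This `k` is `C + s - q * γ`, the surplus in the distributional inequality; it is positive since
  -- `q < 2`. As `β < 0`, also `γ ≤ (C + 1) / 2`, which is the condition `γ * (2 - q) ≤ k`.
  have hk : 0 < (C + 1) * (1 - q / 2) := mul_pos (by linarith) (by linarith)
  have h := integral_rpow_le_of_flux (μ := riemannianVolume n M) (γ := γ)
    (k := (C + 1) * (1 - q / 2))
    (u := fun p ↦ ρ p ^ (β / 2) * ‖grad n φ p‖)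
    (v := fun p ↦ ρ p ^ (β / 2) * ⟪grad n φ p, grad n ρ p⟫_ℝ)
    (c := fun p ↦ ρ p ^ (β / 2 - 1) * φ p) hq hq2 hk hγ.le (by nlinarith) hΩ hΩf
    (by
      filter_upwards [hρ1] with p hp
      by_cases h0 : ρ p = 0
      · rw [grad_eq_zero_of_notMem_tsupport fun h' ↦ hφρ h' h0]
        simp
      · rw [abs_mul, abs_of_nonneg (Real.rpow_nonneg (hρ0 p) _)]
        refine mul_le_mul_of_nonneg_left ?_ (Real.rpow_nonneg (hρ0 p) _)
        have := abs_real_inner_le_norm (grad n φ p) (grad n ρ p)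
        rwa [hp h0, mul_one] at this)
    (by
      simp only [sq_add_eq_squareDensity hρ0 hφρ]
      exact integrable_squareDensity hρc hρ1 hφ hφc hφρ β γ)
    (fun p hp ↦ by
      have hp' : p ∉ tsupport φ := fun h' ↦ hp (hφΩ h')
      rw [grad_eq_zero_of_notMem_tsupport hp', image_eq_zero_of_notMem_tsupport hp']
      simp)
    (by
      simp only [e1]
      exact integrable_rpow_mul hρc hφq.continuous hcs (hsub.trans hφρ) (s - 1))
    (by
      simp only [e2]
      exact integrable_rpow_mul_inner_grad_weight hρc hρ1 hφq hcs (hsub.trans hφρ) s)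
    (by
      simp only [e1, e2]
      have := integral_rpow_mul_inner_grad_le hρc hρL hρ1 hρ0 hGE hφq hcs (hsub.trans hφρ)
        (fun p ↦ by positivity) s
      convert this using 2
      rw [hs]
      linear_combination (-q / 2) * hCγ)
  simpa only [e3, sq_add_eq_squareDensity hρ0 hφρ] using h

include hρc hρ0 hρL hρ1 hGE hφ hφc hφρ in
/-- The Rellich inequality with a gradient remainder, in terms of `β = α - 2`. -/
theorem rellich_of_remainder {β γ J : ℝ} (hβ : β < 0) (hγ : 0 < γ)
    (hCγ : C + (β - 1) = 2 * γ)
    (hJ : J ≤ ∫ p, squareDensity n ρ φ β γ p ∂(riemannianVolume n M)) :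
    (γ * (γ - β)) ^ 2 * ∫ p, ρ p ^ (β - 2) * φ p ^ 2 ∂(riemannianVolume n M) +
        2 * (γ * (γ - β)) * J ≤
      ∫ p, ρ p ^ (β + 2) * |laplacian n φ p| ^ 2 ∂(riemannianVolume n M) := by
  have hA : 0 < γ * (γ - β) := mul_pos hγ (by linarith)
  set A := γ * (γ - β) with hA_def
  have hφ1 : Continuous φ := hφ.continuous
  have hL : Continuous (laplacian n φ) := continuous_laplacian hφ
  have hts : tsupport (laplacian n φ) ⊆ tsupport φ :=
    closure_minimal (fun p hp ↦ by
      by_contra h'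
      exact hp (laplacian_eq_zero_of_notMem_tsupport h')) (isClosed_tsupport φ)
  have hi0 : Integrable (fun p ↦ ρ p ^ β * (φ p * laplacian n φ p)) (riemannianVolume n M) :=
    integrable_rpow_mul (g := fun p ↦ φ p * laplacian n φ p) hρc (hφ1.mul hL) hφc.mul_right
      (tsupport_mul_subset_left.trans hφρ) β
  have hi1 : Integrable (fun p ↦ ρ p ^ (β - 2) * φ p ^ 2) (riemannianVolume n M) := by
    simp only [sq (φ _)]
    exact integrable_rpow_mul (g := fun p ↦ φ p * φ p) hρc (hφ1.mul hφ1)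
      hφc.mul_left (tsupport_mul_subset_left.trans hφρ) (β - 2)
  have hi2 : Integrable (fun p ↦ ρ p ^ (β + 2) * |laplacian n φ p| ^ 2)
      (riemannianVolume n M) := by
    simp only [sq_abs, sq (laplacian n φ _)]
    exact integrable_rpow_mul (g := fun p ↦ laplacian n φ p * laplacian n φ p) hρc (hL.mul hL)
      (hφc.of_isClosed_subset (isClosed_tsupport _) (tsupport_mul_subset_left.trans hts))
      ((tsupport_mul_subset_left.trans hts).trans hφρ) (β + 2)
  have hE := integral_squareDensity_add_le hρc hρ0 hρL hρ1 hGE hφ hφc hφρ hβ hγ hCγ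
  -- This is `ρ ^ (β - 2) * (ρ ^ 2 * Δφ + A * φ) ^ 2 ≥ 0`, expanded.
  have hpt : ∀ p, -(2 * A) * (ρ p ^ β * (φ p * laplacian n φ p)) -
      A ^ 2 * (ρ p ^ (β - 2) * φ p ^ 2) ≤ ρ p ^ (β + 2) * |laplacian n φ p| ^ 2 := by
    intro p
    rcases (hρ0 p).eq_or_lt with h | h
    · have hp : p ∉ tsupport φ := fun h' ↦ hφρ h' h.symm
      rw [laplacian_eq_zero_of_notMem_tsupport hp, image_eq_zero_of_notMem_tsupport hp]
      simp
    · have h1 : ρ p ^ β = ρ p ^ (β - 2) * ρ p ^ 2 := by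
        rw [← Real.rpow_add_natCast h.ne']
        norm_num
      have h2 : ρ p ^ (β + 2) = ρ p ^ (β - 2) * (ρ p ^ 2) ^ 2 := by
        rw [← pow_mul, ← Real.rpow_add_natCast h.ne']
        congr 1
        norm_num
        ring
      rw [h1, h2, sq_abs]
      have h3 := mul_nonneg (Real.rpow_nonneg h.le (β - 2))
        (sq_nonneg (ρ p ^ 2 * laplacian n φ p + A * φ p))
      linarith
  have hint := integral_mono ((hi0.const_mul (-(2 * A))).sub (hi1.const_mul (A ^ 2))) hi2 hpt
  simp only [Pi.sub_apply] at hint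
  rw [integral_sub (hi0.const_mul _) (hi1.const_mul _), integral_const_mul,
    integral_const_mul] at hint
  nlinarith

end Rellich

end RellichRiemannian

end

/-! ### The theorem -/

open RellichRiemannian in
theorem theorem2p4 {n : ℕ} (hn : 1 < n) {M : Type*} [MetricSpace M]
    [ChartedSpace (EuclideanSpace ℝ (Fin n)) M] [IsManifold (𝓡 n) ∞ M]
    [RiemannianBundle (fun p : M ↦ TangentSpace (𝓡 n) p)]
    [IsContMDiffRiemannianBundle (𝓡 n) ∞ (EuclideanSpace ℝ (Fin n))
      (fun p : M ↦ TangentSpace (𝓡 n) p)]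
    [IsRiemannianManifold (𝓡 n) M] [CompleteSpace M] [NoncompactSpace M]
    [MeasurableSpace M] [BorelSpace M]
    (q : ℝ) (hq₁ : 1 < q) (hq₂ : q < 2)
    (Ω : Set M) (hΩ : IsOpen Ω) (hΩb : Bornology.IsBounded Ω) :
    ∃ C₁ : ℝ, 0 < C₁ ∧
      ∀ (ρ : M → ℝ) (C α : ℝ),
        (∀ x, 0 ≤ ρ x) → LocallyLipschitz ρ →
        (∀ᵐ x ∂(RellichRiemannian.riemannianVolume n M),
          ρ x ≠ 0 → ‖RellichRiemannian.grad n ρ x‖ = 1) →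
        RellichRiemannian.LaplacianGE n {x | ρ x ≠ 0} ρ (fun x ↦ C / ρ x) →
        0 < C → α < 2 → 0 < C + α - 3 →
        ∀ φ : M → ℝ, RellichRiemannian.IsTestFunction n (Ω \ ρ ⁻¹' {0}) φ →
          (C + α - 3) ^ 2 * (C - α + 1) ^ 2 / 16 *
              ∫ x, ρ x ^ α * (φ x ^ 2 / ρ x ^ 4) ∂(RellichRiemannian.riemannianVolume n M) +
            (C + α - 3) * (C - α + 1) / 2 * C₁ *
              (∫ x, ‖RellichRiemannian.grad n φ x‖ ^ q * ρ x ^ (q * (α - 2) / 2)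
                ∂(RellichRiemannian.riemannianVolume n M)) ^ (2 / q) ≤
          ∫ x, ρ x ^ α * |RellichRiemannian.laplacian n φ x| ^ 2
            ∂(RellichRiemannian.riemannianVolume n M) := by
  have hproper := properSpace_of_isRiemannianManifold n M
  have hsc : SecondCountableTopology M := secondCountable_of_proper
  set V := (riemannianVolume n M).real Ω with hV
  have hV0 : 0 ≤ V := measureReal_nonneg
  set K : ℝ := (2 ^ (q - 1) * (1 + (q / (2 - q)) ^ q)) ^ (2 / q) with hK
  have hq0 : 0 < q := by linarith
  have h2q : 0 < 2 - q := by linarith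
  have hK0 : 0 < K := by positivity
  -- The volume is enlarged to `V + 1` so that the constant stays positive when `Ω` is empty; the
  -- exponent `2 / q - 1` is nonnegative, so the estimate only weakens.
  refine ⟨(K * (V + 1) ^ (2 / q - 1))⁻¹, by positivity, ?_⟩
  intro ρ C α hρ0 hρL hρ1 hGE hC hα hCα φ hφ
  have hρc := hρL.continuous
  have hφρ : tsupport φ ⊆ {p | ρ p ≠ 0} := fun p hp ↦ (hφ.2.2 hp).2
  have hφΩ : tsupport φ ⊆ Ω := fun p hp ↦ (hφ.2.2 hp).1
  have hloc : ∀ x : M, ∀ y ∈ (chartAt (EuclideanSpace ℝ (Fin n)) x).target,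
      LipschitzAround (ρ ∘ (chartAt (EuclideanSpace ℝ (Fin n)) x).symm) y :=
    fun x y hy ↦ RellichRiemannian.LocallyLipschitz.lipschitzAround_comp_chart_symm hρL x hy
  have hβ : α - 2 < 0 := by linarith
  have hγ : 0 < (C + α - 3) / 2 := by linarith
  have hCγ : C + (α - 2 - 1) = 2 * ((C + α - 3) / 2) := by ring
  have hJ := integral_norm_grad_rpow_le hρc hρ0 hloc hρ1 hGE hφ.1 hφ.2.1 hφρ hq₁ hq₂
    hΩ.measurableSet (riemannianVolume_lt_top_of_isBounded hΩb).ne hφΩ hβ hγ hCγ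
  set S := ∫ p, squareDensity n ρ φ (α - 2) ((C + α - 3) / 2) p ∂(riemannianVolume n M) with hS
  set J := (∫ x, ‖grad n φ x‖ ^ q * ρ x ^ (q * (α - 2) / 2) ∂(riemannianVolume n M)) ^ (2 / q)
    with hJ_def
  have hJ0 : 0 ≤ J := Real.rpow_nonneg (integral_nonneg fun x ↦
    mul_nonneg (Real.rpow_nonneg (norm_nonneg _) _) (Real.rpow_nonneg (hρ0 x) _)) _
  have he : 0 ≤ 2 / q - 1 := by
    rw [sub_nonneg, one_le_div hq0]
    exact hq₂.le
  -- Needed to replace `V` by `V + 1` in front of `S`. The density is a square up to a nonnegative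
  -- remainder, by Cauchy–Schwarz and `|∇ρ| = 1`.
  have hS0 : 0 ≤ S := by
    refine integral_nonneg_of_ae ?_
    filter_upwards [hρ1] with p hp
    rw [Pi.zero_apply, ← sq_add_eq_squareDensity hρ0 hφρ]
    by_cases h0 : ρ p = 0
    · have hp' : p ∉ tsupport φ := fun h' ↦ hφρ h' h0
      rw [grad_eq_zero_of_notMem_tsupport hp', image_eq_zero_of_notMem_tsupport hp']
      simp
    · have h1 := abs_real_inner_le_norm (grad n φ p) (grad n ρ p)
      rw [hp h0, mul_one] at h1
      have h2 := sq_le_sq' (abs_le.1 h1).1 (abs_le.1 h1).2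
      nlinarith [mul_le_mul_of_nonneg_left h2 (sq_nonneg (ρ p ^ ((α - 2) / 2))),
        sq_nonneg (ρ p ^ ((α - 2) / 2) * ⟪grad n φ p, grad n ρ p⟫_ℝ +
          (C + α - 3) / 2 * (ρ p ^ ((α - 2) / 2 - 1) * φ p))]
  have hJS : (K * (V + 1) ^ (2 / q - 1))⁻¹ * J ≤ S := by
    rw [inv_mul_le_iff₀ (by positivity)]
    refine hJ.trans ?_
    gcongr
    linarith
  have hfin := rellich_of_remainder hρc hρ0 hloc hρ1 hGE hφ.1 hφ.2.1 hφρ hβ hγ hCγ hJS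
  have e1 : ∀ x, ρ x ^ α * (φ x ^ 2 / ρ x ^ 4) = ρ x ^ (α - 2 - 2) * φ x ^ 2 := by
    intro x
    rcases (hρ0 x).eq_or_lt with h | h
    · rw [image_eq_zero_of_notMem_tsupport fun h' ↦ hφρ h' h.symm]
      simp
    · have : ρ x ^ α = ρ x ^ (α - 2 - 2) * ρ x ^ 4 := by
        rw [← Real.rpow_add_natCast h.ne']
        congr 1
        norm_num
        ring
      rw [this]
      field_simp
  simp only [e1]
  rw [sub_add_cancel] at hfin
  refine le_trans (le_of_eq ?_) hfin
  ring
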